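/- Let $L>0$ and consider real-valued, $L$-periodic (in $x$) solutions of the Drinfeld--Sokolov--Wilson system $$u_t+(uv)_x+u_{xxx}=0,\qquad v_t+uu_x=0,\qquad u|_{t=0}=u_0,\quad v|_{t=0}=v_0 ,$$ where $(u,v)$ is called a solution on a time interval $I\ni 0$ if $u,v\in C^0(I;L^2_{per}(0,L))$ and the equations, integrated in time from $0$, hold in the sense of distributions in $x$ (with $uu_x=\tfrac12(u^2)_x$). For a time interval $I$ let $Y_I$ be the set of restrictions to $I$ of pairs $(w,z)$ of functions on $\mathbb R\times\mathbb R/L\mathbb Z$ whose space-time Fourier transforms satisfy $$\|\langle\tau-\xi_k^3\rangle^{1/2}\widetilde w\|_{\ell^2_kL^2_\tau}+\|\widetilde w\|_{\ell^2_kL^1_\tau}+\|\langle\tau\rangle^{1/2}\widetilde z\|_{\ell^2_kL^2_\tau}+\|\widetilde z\|_{\ell^2_kL^1_\tau}<\infty,\qquad \xi_k=\tfrac{2\pi k}{L},\quad \langle r\rangle=(1+r^2)^{1/2}.$$ Given $v_0$ with mean $m=\frac1L\int_0^Lv_0\,dx$, say that a solution $(u,v)$ on $I$ is of class $Y$ if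 $\big(u(t,x+mt),\,v(t,x)-m\big)\in Y_I$. There is a function $r\mapsto T(r)>0$, depending only on $L$, such that for all $(u_0,v_0)\in L^2_{per}(0,L)\times L^2_{per}(0,L)$ there is a global solution $(u,v)$ on $[0,\infty)$, so $u,v\in C^0([0,\infty);L^2_{per}(0,L))$, which is of class $Y$ on $[0,T(\|u_0\|_{L^2}+\|v_0\|_{L^2})]$ and which extends every local solution of class $Y$: for each $T'>0$, every solution on $[0,T']$ of class $Y$ with the data $(u_0,v_0)$ coincides with $(u,v)$ on $[0,T']$. In particular the local solution, which is the unique one of class $Y$, extends to a global solution in $C^0_tL^2_x\times C^0_tL^2_x$. -/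

import Mathlib

open MeasureTheory Set
open scoped ContDiff

noncomputable section

namespace DSW

/-- Real-valued `L²` functions on the circle `ℝ / Lℤ`, i.e. `L²_per(0, L)`. The measure is the
Lebesgue measure divided by `L` (the normalisation used by Mathlib for Fourier coefficients). -/
abbrev L2 (L : ℝ) [Fact (0 < L)] : Type :=
  Lp ℝ 2 (AddCircle.haarAddCircle (T := L))

variable {L : ℝ}

/-- Smoothness of a function on the circle: its `L`-periodic lift to `ℝ` is `C^∞`. -/
def SmoothOnCircle (φ : AddCircle L → ℝ) : Prop :=
  ContDiff ℝ ∞ (fun y : ℝ => φ (y : AddCircle L))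

/-- The `n`-th derivative of a function on the circle. -/
def circleDeriv (n : ℕ) (φ : AddCircle L → ℝ) : AddCircle L → ℝ :=
  fun x => iteratedDeriv n (fun y : ℝ => φ (x + (y : AddCircle L))) 0

/-- `(u, v)` is a solution, continuous in time with values in `L² × L²`, of
`u_t + (u v)_x + u_xxx = 0`, `v_t + u u_x = 0`, `u(0) = u₀`, `v(0) = v₀`
on the time interval `I` (an interval with left end point `0`). The equations hold in the sense of
distributions in `x` and are integrated in time; `u u_x` is `(u² / 2)_x`. -/
structure IsSolutionOn [Fact (0 < L)] (I : Set ℝ) (u₀ v₀ : L2 L) (u v : ℝ → L2 L) : Prop where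
  continuousOn_u : ContinuousOn u I
  continuousOn_v : ContinuousOn v I
  initial_u : u 0 = u₀
  initial_v : v 0 = v₀
  eq_u : ∀ φ : AddCircle L → ℝ, SmoothOnCircle φ → ∀ t ∈ I,
    ∫ x, u t x * φ x ∂AddCircle.haarAddCircle
      = (∫ x, u₀ x * φ x ∂AddCircle.haarAddCircle)
        + ∫ s in (0 : ℝ)..t, ∫ x, (u s x * v s x * circleDeriv 1 φ x
            + u s x * circleDeriv 3 φ x) ∂AddCircle.haarAddCircle
  eq_v : ∀ φ : AddCircle L → ℝ, SmoothOnCircle φ → ∀ t ∈ I,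
    ∫ x, v t x * φ x ∂AddCircle.haarAddCircle
      = (∫ x, v₀ x * φ x ∂AddCircle.haarAddCircle)
        + ∫ s in (0 : ℝ)..t, ∫ x, (u s x) ^ 2 / 2 * circleDeriv 1 φ x ∂AddCircle.haarAddCircle

/-- The Japanese bracket `⟨r⟩ = (1 + r²)^{1/2}`. -/
def bracket (r : ℝ) : ℝ := Real.sqrt (1 + r ^ 2)

/-- The restriction to the time set `I` of the space of functions `w(t, x)` on `ℝ × ℝ/Lℤ` whose
space-time Fourier transform `a k τ` satisfies
`‖⟨τ - p k⟩^{1/2} a‖_{ℓ²_k L²_τ} < ∞` and `‖a‖_{ℓ²_k L¹_τ} < ∞`: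
the function `w` has an extension from `I` to all times (with transform `a`) in that space. -/
def MemRestricted [Fact (0 < L)] (p : ℤ → ℝ) (I : Set ℝ) (w : ℝ → AddCircle L → ℝ) : Prop :=
  ∃ a : ℤ → ℝ → ℂ, (∀ k, Measurable (a k)) ∧
    (∑' k, (∫⁻ τ : ℝ, ENNReal.ofReal (bracket (τ - p k)) * ‖a k τ‖ₑ ^ 2)) < ⊤ ∧
    (∑' k, (∫⁻ τ : ℝ, ‖a k τ‖ₑ) ^ 2) < ⊤ ∧
    ∀ t ∈ I, ∀ k, fourierCoeff (fun x => (w t x : ℂ)) k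
      = ∫ τ : ℝ, Complex.exp (Complex.I * (τ : ℂ) * (t : ℂ)) * a k τ

/-- The space `X^{0,1/2} ∩ L²_x L¹_τ` of the Airy flow `u_t + u_xxx = 0`, restricted to `I`. -/
def MemKdV [Fact (0 < L)] (I : Set ℝ) (w : ℝ → AddCircle L → ℝ) : Prop :=
  MemRestricted (fun k => (2 * Real.pi * k / L) ^ 3) I w

/-- The space `H^{1/2}_t L²_x ∩ L²_x L¹_τ`, restricted to `I`. -/
def MemHalf [Fact (0 < L)] (I : Set ℝ) (w : ℝ → AddCircle L → ℝ) : Prop :=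
  MemRestricted (fun _ => 0) I w

/-- The mean value `(1 / L) ∫₀ᴸ f dx`. -/
def mean [Fact (0 < L)] (f : L2 L) : ℝ := ∫ x, f x ∂AddCircle.haarAddCircle

/-- The auxiliary space for solutions with initial datum `v₀` in the second component: with
`m = mean v₀`, the pair `(u(t, x + m t), v(t, x) - m)` obtained by the reduction to mean zero
belongs to `Y = (X^{0,1/2} ∩ L²_x L¹_τ) × (H^{1/2}_t L²_x ∩ L²_x L¹_τ)`, restricted to `I`. -/
def MemY [Fact (0 < L)] (I : Set ℝ) (v₀ : L2 L) (u v : ℝ → L2 L) : Prop :=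
  MemKdV I (fun t x => u t (x + ((mean v₀ * t : ℝ) : AddCircle L))) ∧
    MemHalf I (fun t x => v t x - mean v₀)

end DSW

end

/-! The mean m of v is conserved. Subtracting it from v moves the term m u_x into the linear part,
so that u has the dispersion relation ξ³ - mξ. In the interaction picture the Fourier coefficients
then solve a quadratic system with multipliers M and oscillating factors exp(iΦt). For u_{k-n}, v_n
→ u_k the resonance function is, up to sign, ξ_n (ξ_k² + ξ_k ξ_{k-n} + ξ_{k-n}² - m); for u_k, u_l →
v_{k+l} it is ξ_{k+l} (ξ_k² - ξ_k ξ_l + ξ_l² - m). The first factor is at least 2π/L in size unless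
the interaction is absent, and the quadratic form dominates the square of the output frequency.
Hence |M|² ≤ C⟨Φ⟩: the derivative in the nonlinearity costs at most ⟨Φ⟩^{1/2}
(`dswSys_norm_M_sq_le`).

The modulations of the output and of the two inputs add up to Φ, so one of them is comparable to ⟨Φ⟩
or larger, and the weight of X^{0,1/2} pays for the derivative. What is left is a sum of ⟨Φ -
s⟩^{-5/8} over one free frequency. There Φ is a cubic or quadratic polynomial with leading
coefficient bounded below, and the sum converges because 2 · 5/8 > 1 (`dswSys_small`). This gives
the bilinear estimate `QSys.Small.zNorm_absForm_le` in X^{0,1/2} ∩ ℓ²L¹; the ℓ²L¹ part supplies the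
continuity in time that X^{0,1/2} just misses.

Smallness comes from slowing time down by a factor lam: M and Φ are divided by lam, and the constant
of the estimate becomes O(lam^{-3/8}), while the size of the data is unchanged. A Picard iteration
on the unit interval (`QSys.Small.exists_solution`) therefore handles data of any size, with a
lifetime depending only on that size. Functions on [0, 1] are written as e^t times a Fourier
integral, so that the Duhamel integral amounts to division by 1 + iτ, which has no singularity.

The quantity ‖u‖² + ‖v‖² is formally conserved, since ∫ u (uv)_x + ∫ v u u_x = 0. For systems
truncated to finitely many frequencies this is exact (`dswSys_conservative`); by
`QSys.Small.stability` the truncated solutions converge to the true one, which gives the inequality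
`QSys.Small.energy_le`. That bound lets the local existence theorem be iterated with a fixed step
(`exists_global`).

For uniqueness, a solution of class Y, slowed down by lam, has a norm bounded independently of lam
(`HasRep.exists_bound`), because the relevant norms are invariant under dilation. For large lam any
two solutions of class Y with equal data thus fall into the small regime and agree for a short time.
A continuity argument carries the agreement along the whole interval (`eqOn_of_hasRep`). -/

open scoped ENNReal ComplexConjugate Topology

/-! ### Brackets and their convolution -/

namespace DSW

/-- The bracket `1 + |x|`, as an extended nonnegative real. -/
noncomputable def jb (x : ℝ) : ℝ≥0∞ := ENNReal.ofReal (1 + |x|)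

lemma one_le_jb (x : ℝ) : 1 ≤ jb x := by
  rw [jb, ← ENNReal.ofReal_one]
  exact ENNReal.ofReal_le_ofReal (by linarith [abs_nonneg x])

lemma jb_ne_zero (x : ℝ) : jb x ≠ 0 := (zero_lt_one.trans_le (one_le_jb x)).ne'

lemma jb_ne_top (x : ℝ) : jb x ≠ ⊤ := ENNReal.ofReal_ne_top

@[fun_prop]
lemma measurable_jb : Measurable jb := by unfold jb; fun_prop

lemma jb_neg (x : ℝ) : jb (-x) = jb x := by simp [jb]

lemma jb_sub_comm (x y : ℝ) : jb (x - y) = jb (y - x) := by simp [jb, abs_sub_comm]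

lemma jb_add_le (x y : ℝ) : jb (x + y) ≤ jb x + jb y := by
  rw [jb, jb, jb, ← ENNReal.ofReal_add (by positivity) (by positivity)]
  exact ENNReal.ofReal_le_ofReal (by linarith [abs_add_le x y])

lemma jb_rpow (x s : ℝ) : jb x ^ s = ENNReal.ofReal ((1 + |x|) ^ s) := by
  rw [jb, ENNReal.ofReal_rpow_of_pos (by positivity)]

lemma measurable_jb_rpow (s : ℝ) : Measurable fun x => jb x ^ s := measurable_jb.pow_const s

lemma lintegral_jb_rpow_lt_top {s : ℝ} (hs : 1 < s) : ∫⁻ x, jb x ^ (-s) < ⊤ := by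
  simp_rw [jb_rpow, ← Real.norm_eq_abs]
  exact finite_integral_one_add_norm (by simpa using hs)

lemma jb_rpow_add (x s t : ℝ) : jb x ^ (s + t) = jb x ^ s * jb x ^ t :=
  ENNReal.rpow_add _ _ (jb_ne_zero x) (jb_ne_top x)

lemma jb_rpow_le_of_le {x s t : ℝ} (h : s ≤ t) : jb x ^ s ≤ jb x ^ t :=
  ENNReal.rpow_le_rpow_of_exponent_le (one_le_jb x) h

lemma rpow_neg_le_two_mul {y z : ℝ≥0∞} {s : ℝ} (hs : 0 ≤ s) (hs' : s ≤ 1)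
    (h : z ≤ 2 * y) : y ^ (-s) ≤ 2 * z ^ (-s) := by
  have h1 : z ^ s ≤ 2 * y ^ s := by
    calc z ^ s ≤ (2 * y) ^ s := ENNReal.rpow_le_rpow h hs
      _ = 2 ^ s * y ^ s := ENNReal.mul_rpow_of_nonneg _ _ hs
      _ ≤ 2 ^ (1 : ℝ) * y ^ s := by
          gcongr
          exact one_le_two
      _ = 2 * y ^ s := by simp
  rw [ENNReal.rpow_neg, ENNReal.rpow_neg]
  have h2 : (2 * y ^ s)⁻¹ ≤ (z ^ s)⁻¹ := ENNReal.inv_le_inv.2 h1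
  rw [ENNReal.mul_inv (by simp) (by simp)] at h2
  calc (y ^ s)⁻¹ = 2 * (2⁻¹ * (y ^ s)⁻¹) := by
        rw [← mul_assoc, ENNReal.mul_inv_cancel (by simp) (by simp), one_mul]
    _ ≤ _ := by gcongr

/-- The larger of the two brackets is at least half of ⟨c⟩. Of its exponent 7/8, the part 5/8
becomes decay in c; the remaining 1/4 is passed to the smaller bracket, whose exponent then is 9/8 >
1, hence integrable. -/
lemma jb_mul_jb_le (s c : ℝ) :
    jb s ^ (-(7 / 8) : ℝ) * jb (c - s) ^ (-(7 / 8) : ℝ)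
      ≤ 2 * jb c ^ (-(5 / 8) : ℝ) * (jb s ^ (-(9 / 8) : ℝ) + jb (c - s) ^ (-(9 / 8) : ℝ)) := by
  have key : ∀ s y : ℝ, jb s ≤ jb y → jb c ≤ jb s + jb y →
      jb s ^ (-(7 / 8) : ℝ) * jb y ^ (-(7 / 8) : ℝ)
        ≤ 2 * jb c ^ (-(5 / 8) : ℝ) * jb s ^ (-(9 / 8) : ℝ) := by
    intro s y hsy hc
    have h1 : jb c ≤ 2 * jb y := hc.trans (by rw [two_mul]; gcongr)
    have h2 : jb y ^ (-(7 / 8) : ℝ) = jb y ^ (-(5 / 8) : ℝ) * jb y ^ (-(1 / 4) : ℝ) := by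
      rw [← jb_rpow_add]; norm_num
    have h3 : jb s ^ (-(9 / 8) : ℝ) = jb s ^ (-(7 / 8) : ℝ) * jb s ^ (-(1 / 4) : ℝ) := by
      rw [← jb_rpow_add]; norm_num
    have h4 : jb y ^ (-(1 / 4) : ℝ) ≤ jb s ^ (-(1 / 4) : ℝ) := by
      rw [ENNReal.rpow_neg, ENNReal.rpow_neg]
      exact ENNReal.inv_le_inv.2 (ENNReal.rpow_le_rpow hsy (by norm_num))
    rw [h2, h3]
    calc _ ≤ jb s ^ (-(7 / 8) : ℝ) * ((2 * jb c ^ (-(5 / 8) : ℝ)) * jb s ^ (-(1 / 4) : ℝ)) := by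
          gcongr
          exact rpow_neg_le_two_mul (by norm_num) (by norm_num) h1
      _ = _ := by ring
  have hc : jb c ≤ jb s + jb (c - s) := by
    simpa using jb_add_le s (c - s)
  rcases le_total (jb s) (jb (c - s)) with h | h
  · refine (key s (c - s) h hc).trans ?_
    gcongr; exact le_self_add
  · rw [mul_comm (jb s ^ _)]
    refine (key (c - s) s h (by rwa [add_comm])).trans ?_
    gcongr; exact le_add_self

/-- The total mass of `(1 + |x|)^(-9/8)`. -/
noncomputable def jbMass : ℝ≥0∞ := ∫⁻ x, jb x ^ (-(9 / 8) : ℝ)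

lemma jbMass_ne_top : jbMass ≠ ⊤ := (lintegral_jb_rpow_lt_top (by norm_num)).ne

lemma lintegral_jb_mul_jb_le (c : ℝ) :
    ∫⁻ s, jb s ^ (-(7 / 8) : ℝ) * jb (c - s) ^ (-(7 / 8) : ℝ)
      ≤ 4 * jbMass * jb c ^ (-(5 / 8) : ℝ) := by
  have hm := measurable_jb_rpow (-(9 / 8))
  calc _ ≤ ∫⁻ s, 2 * jb c ^ (-(5 / 8) : ℝ) *
        (jb s ^ (-(9 / 8) : ℝ) + jb (c - s) ^ (-(9 / 8) : ℝ)) :=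
        lintegral_mono fun s => jb_mul_jb_le s c
    _ = 2 * jb c ^ (-(5 / 8) : ℝ) * (jbMass + jbMass) := by
        rw [lintegral_const_mul _ (by fun_prop), lintegral_add_left hm,
          lintegral_sub_left_eq_self (fun s => jb s ^ (-(9 / 8) : ℝ)) c]
        rfl
    _ = _ := by ring

/-! ### Cauchy–Schwarz for sums and integrals in `ℝ≥0∞` -/

section CauchySchwarz

lemma sq_lintegral_mul_le {X : Type*} [MeasurableSpace X] (μ : Measure X) {f g : X → ℝ≥0∞}
    (hf : Measurable f) (hg : Measurable g) :
    (∫⁻ x, f x * g x ∂μ) ^ 2 ≤ (∫⁻ x, f x ^ 2 ∂μ) * ∫⁻ x, g x ^ 2 ∂μ := by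
  have h := ENNReal.lintegral_mul_le_Lp_mul_Lq μ (Real.HolderConjugate.two_two)
    hf.aemeasurable hg.aemeasurable
  calc _ ≤ ((∫⁻ x, f x ^ (2 : ℝ) ∂μ) ^ (1 / 2 : ℝ) * (∫⁻ x, g x ^ (2 : ℝ) ∂μ) ^ (1 / 2 : ℝ)) ^ 2 := by
        gcongr; exact h
    _ = _ := by
        rw [mul_pow, ← ENNReal.rpow_natCast, ← ENNReal.rpow_mul, ← ENNReal.rpow_natCast,
          ← ENNReal.rpow_mul]
        norm_num

lemma sq_tsum_mul_le {J : Type*} (f g : J → ℝ≥0∞) :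
    (∑' e, f e * g e) ^ 2 ≤ (∑' e, f e ^ 2) * ∑' e, g e ^ 2 := by
  let _ : MeasurableSpace J := ⊤
  have h := sq_lintegral_mul_le (Measure.count : Measure J) (f := f) (g := g)
    measurable_from_top measurable_from_top
  simpa only [lintegral_count] using h

lemma sqrt_sq (x : ℝ≥0∞) : (x ^ (1 / 2 : ℝ)) ^ 2 = x := by
  rw [← ENNReal.rpow_natCast, ← ENNReal.rpow_mul]; norm_num

lemma le_sqrt_mul_sqrt {x y z : ℝ≥0∞} (h : x ^ 2 ≤ y * z) :
    x ≤ y ^ (1 / 2 : ℝ) * z ^ (1 / 2 : ℝ) := by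
  have h1 := ENNReal.rpow_le_rpow h (z := 1 / 2) (by norm_num)
  rw [ENNReal.mul_rpow_of_nonneg _ _ (by norm_num : (0 : ℝ) ≤ 1 / 2), ← ENNReal.rpow_natCast,
    ← ENNReal.rpow_mul] at h1
  simpa using h1

lemma sq_tsum_lintegral_mul_le {J : Type*} {f g : J → ℝ → ℝ≥0∞}
    (hf : ∀ e, Measurable (f e)) (hg : ∀ e, Measurable (g e)) :
    (∑' e, ∫⁻ s, f e s * g e s) ^ 2 ≤ (∑' e, ∫⁻ s, f e s ^ 2) * ∑' e, ∫⁻ s, g e s ^ 2 := by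
  calc (∑' e, ∫⁻ s, f e s * g e s) ^ 2
      ≤ (∑' e, (∫⁻ s, f e s ^ 2) ^ (1 / 2 : ℝ) * (∫⁻ s, g e s ^ 2) ^ (1 / 2 : ℝ)) ^ 2 := by
        gcongr with e
        exact le_sqrt_mul_sqrt (sq_lintegral_mul_le _ (hf e) (hg e))
    _ ≤ _ := by
        refine (sq_tsum_mul_le _ _).trans_eq ?_
        simp_rw [sqrt_sq]

lemma add_sq_le (x y : ℝ≥0∞) : (x + y) ^ 2 ≤ 2 * x ^ 2 + 2 * y ^ 2 := by
  rcases eq_or_ne x ⊤ with rfl | hx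
  · simp
  rcases eq_or_ne y ⊤ with rfl | hy
  · simp
  lift x to NNReal using hx
  lift y to NNReal using hy
  norm_cast
  rw [← NNReal.coe_le_coe]
  push_cast
  nlinarith [sq_nonneg ((x : ℝ) - y)]

end CauchySchwarz

end DSW

/-! ### Quadratic systems and their weighted convolutions -/

namespace DSW

/-- A quadratic system `c_i' = ∑_{out e = i} M(e) exp(i Φ(e) t) c_{inl e} c_{inr e}`, indexed by a
set `E` of interactions. -/
structure QSys (ι E : Type*) where
  out : E → ι
  inl : E → ι
  inr : E → ι
  M : E → ℂ
  Φ : E → ℝ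

namespace QSys

variable {ι E : Type*} (q : QSys ι E)

/-- The system with the two factors exchanged. -/
def swap : QSys ι E := ⟨q.out, q.inr, q.inl, q.M, q.Φ⟩

/-- The size `|M|² / ⟨Φ⟩` of an interaction after exploiting the resonance function once. -/
noncomputable def gain (e : E) : ℝ≥0∞ := ‖q.M e‖ₑ ^ 2 * jb (q.Φ e) ^ (-1 : ℝ)

/-- The square root of `gain`. -/
noncomputable def gainSqrt (e : E) : ℝ≥0∞ := ‖q.M e‖ₑ * jb (q.Φ e) ^ (-(1 / 2) : ℝ)

/-- The multiplier of an interaction for which the resonance function is absorbed by the output. -/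
noncomputable def gainOut (e : E) : ℝ≥0∞ := ‖q.M e‖ₑ * jb (q.Φ e) ^ (-(13 / 16) : ℝ)

/-- Smallness of the interactions: after gaining `⟨Φ⟩^{1/2}` the multiplier is square summable
against `⟨Φ - s⟩^{-5/8}` when the output or one of the inputs is kept fixed. -/
structure Small (ε : ℝ≥0∞) : Prop where
  inj_in : Function.Injective fun e => (q.inl e, q.inr e)
  inj_outl : Function.Injective fun e => (q.out e, q.inl e)
  inj_outr : Function.Injective fun e => (q.out e, q.inr e)
  sum_out : ∀ i s, ∑' e : q.out ⁻¹' {i}, q.gain e * jb (q.Φ e - s) ^ (-(5 / 8) : ℝ) ≤ ε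
  sum_inl : ∀ i s, ∑' e : q.inl ⁻¹' {i}, q.gain e * jb (q.Φ e - s) ^ (-(5 / 8) : ℝ) ≤ ε
  sum_inr : ∀ i s, ∑' e : q.inr ⁻¹' {i}, q.gain e * jb (q.Φ e - s) ^ (-(5 / 8) : ℝ) ≤ ε
  -- Not uniform in `i`: it serves only for the absolute convergence of the series defining the
  -- nonlinearity and enters no estimate.
  bdd : ∀ i, ∃ m : ℝ, ∀ e, q.out e = i → ‖q.M e‖ ≤ m

/-- The convolution of two nonnegative families, with weight `W` on the interactions. -/
noncomputable def conv (W : E → ℝ≥0∞) (f g : ι → ℝ → ℝ≥0∞) (i : ι) (σ : ℝ) : ℝ≥0∞ :=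
  ∑' e : q.out ⁻¹' {i}, W e * ∫⁻ s, f (q.inl e) s * g (q.inr e) (σ - s - q.Φ e)

end QSys

/-- The squared `X^{0,1/2}` norm. -/
noncomputable def hNorm {ι : Type*} (f : ι → ℝ → ℝ≥0∞) : ℝ≥0∞ := ∑' i, ∫⁻ s, jb s * f i s ^ 2

/-- The squared `ℓ² L¹` norm. -/
noncomputable def sNorm {ι : Type*} (f : ι → ℝ → ℝ≥0∞) : ℝ≥0∞ := ∑' i, (∫⁻ s, f i s) ^ 2

namespace QSys

variable {ι E : Type*} {q : QSys ι E} {ε : ℝ≥0∞}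

lemma Small.swap (h : q.Small ε) : q.swap.Small ε where
  inj_in := fun a b hab => h.inj_in (by simpa [QSys.swap, and_comm] using hab)
  inj_outl := h.inj_outr
  inj_outr := h.inj_outl
  sum_out := h.sum_out
  sum_inl := h.sum_inr
  sum_inr := h.sum_inl
  bdd := h.bdd

/-- The substitution s ↦ σ - Φ - s exchanges the factors, so every estimate favouring the left input
yields its mirror image. -/
lemma conv_swap (W : E → ℝ≥0∞) (f g : ι → ℝ → ℝ≥0∞) (i : ι) (σ : ℝ) :
    q.swap.conv W g f i σ = q.conv W f g i σ := by
  unfold conv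
  refine tsum_congr fun e => ?_
  congr 1
  rw [← lintegral_sub_left_eq_self _ (σ - q.Φ e)]
  refine lintegral_congr fun s => ?_
  simp only [QSys.swap]
  rw [mul_comm]
  congr 2 <;> ring

lemma measurable_conv [Countable E] (W : E → ℝ≥0∞) {f g : ι → ℝ → ℝ≥0∞}
    (hf : ∀ i, Measurable (f i)) (hg : ∀ i, Measurable (g i)) (i : ι) :
    Measurable (q.conv W f g i) := by
  unfold conv
  refine Measurable.tsum fun e => Measurable.const_mul ?_ _
  refine Measurable.lintegral_prod_right' (f := fun p : ℝ × ℝ =>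
    f (q.inl e) p.2 * g (q.inr e) (p.1 - p.2 - q.Φ e)) ?_
  have h1 := hf (q.inl e)
  have h2 := hg (q.inr e)
  fun_prop

lemma tsum_fiber_le {π ψ : E → ι} (hinj : Function.Injective fun e => (π e, ψ e)) (y : ι → ℝ≥0∞)
    (i : ι) : ∑' e : π ⁻¹' {i}, y (ψ e) ≤ ∑' j, y j := by
  refine ENNReal.tsum_comp_le_tsum_of_injective (f := fun e : π ⁻¹' {i} => ψ e) ?_ y
  intro a b hab
  have ha : π a = i := a.2
  have hb : π b = i := b.2
  exact Subtype.ext (hinj (by simp only [ha, hb]; simpa using hab))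

lemma tsum_mul_le_of_injective {π ψ : E → ι} (hinj : Function.Injective fun e => (π e, ψ e))
    (x y : ι → ℝ≥0∞) : ∑' e, x (π e) * y (ψ e) ≤ (∑' j, x j) * ∑' j, y j := by
  calc ∑' e, x (π e) * y (ψ e) ≤ ∑' p : ι × ι, x p.1 * y p.2 :=
        ENNReal.tsum_comp_le_tsum_of_injective hinj (fun p : ι × ι => x p.1 * y p.2)
    _ = _ := by
        rw [ENNReal.tsum_prod']
        simp_rw [ENNReal.tsum_mul_left, ENNReal.tsum_mul_right]

lemma tsum_fiber_mul_le {π : E → ι} (w : E → ℝ≥0∞) (x : ι → ℝ≥0∞)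
    (hw : ∀ i, ∑' e : π ⁻¹' {i}, w e ≤ ε) : ∑' e, w e * x (π e) ≤ ε * ∑' i, x i := by
  rw [← ENNReal.tsum_fiberwise _ π, ← ENNReal.tsum_mul_left]
  refine ENNReal.tsum_le_tsum fun i => ?_
  calc ∑' e : π ⁻¹' {i}, w e * x (π e) = ∑' e : π ⁻¹' {i}, w e * x i := by
        refine tsum_congr fun e => ?_
        rw [show π e = i from e.2]
    _ = (∑' e : π ⁻¹' {i}, w e) * x i := ENNReal.tsum_mul_right
    _ ≤ _ := by gcongr; exact hw i

lemma gainSqrt_sq (e : E) : q.gainSqrt e ^ 2 = q.gain e := by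
  rw [gainSqrt, gain, mul_pow, ← ENNReal.rpow_natCast (jb _ ^ _), ← ENNReal.rpow_mul]
  norm_num

lemma gainOut_sq (e : E) : q.gainOut e ^ 2 = q.gain e * jb (q.Φ e - 0) ^ (-(5 / 8) : ℝ) := by
  rw [gainOut, gain, mul_pow, ← ENNReal.rpow_natCast (jb _ ^ _), ← ENNReal.rpow_mul, sub_zero,
    mul_assoc, ← jb_rpow_add]
  norm_num

lemma jb_half_mul (x : ℝ) : jb x ^ (1 / 2 : ℝ) * jb x ^ (-(1 / 2) : ℝ) = 1 := by
  rw [← jb_rpow_add]; norm_num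

lemma jb_half_sq (x : ℝ) : (jb x ^ (-(1 / 2) : ℝ)) ^ 2 = jb x ^ (-1 : ℝ) := by
  rw [← ENNReal.rpow_natCast, ← ENNReal.rpow_mul]; norm_num

lemma lintegral_jb_conv_le (c : ℝ) :
    ∫⁻ s, jb s ^ (-1 : ℝ) * jb (c - s) ^ (-1 : ℝ) ≤ 4 * jbMass * jb c ^ (-(5 / 8) : ℝ) :=
  (lintegral_mono fun s => by
    exact mul_le_mul' (jb_rpow_le_of_le (by norm_num)) (jb_rpow_le_of_le (by norm_num))).trans (lintegral_jb_mul_jb_le c)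

lemma lintegral_conv_eq {f g : ℝ → ℝ≥0∞} (hf : Measurable f) (hg : Measurable g) (c : ℝ) :
    ∫⁻ σ, ∫⁻ s, f s * g (σ - s - c) = (∫⁻ s, f s) * ∫⁻ s, g s := by
  rw [lintegral_lintegral_swap (by fun_prop)]
  simp_rw [sub_sub]
  calc _ = ∫⁻ s, f s * ∫⁻ σ, g σ := by
        refine lintegral_congr fun s => ?_
        rw [lintegral_const_mul _ (by fun_prop), lintegral_sub_right_eq_self g]
    _ = _ := lintegral_mul_const _ hf

section estimates

variable (h : q.Small ε) {f g : ι → ℝ → ℝ≥0∞} (hf : ∀ i, Measurable (f i))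
  (hg : ∀ i, Measurable (g i))

include h hf hg

/-- Cauchy–Schwarz jointly over interactions and the inner frequency. The weights ⟨s⟩^{-1}⟨σ - s -
Φ⟩^{-1} taken from the inputs integrate to a multiple of ⟨σ - Φ⟩^{-5/8}, which is what `sum_out`
sums against the gain. -/
lemma Small.sq_conv_gainSqrt_le (i : ι) (σ : ℝ) :
    q.conv q.gainSqrt f g i σ ^ 2 ≤ 4 * jbMass * ε * ∑' e : q.out ⁻¹' {i},
      ∫⁻ s, (jb s * f (q.inl e) s ^ 2) * (jb (σ - s - q.Φ e) * g (q.inr e) (σ - s - q.Φ e) ^ 2) := by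
  have e1 : q.conv q.gainSqrt f g i σ = ∑' e : q.out ⁻¹' {i}, ∫⁻ s,
      (q.gainSqrt e * (jb s ^ (-(1 / 2) : ℝ) * jb (σ - s - q.Φ e) ^ (-(1 / 2) : ℝ))) *
      ((jb s ^ (1 / 2 : ℝ) * f (q.inl e) s) *
        (jb (σ - s - q.Φ e) ^ (1 / 2 : ℝ) * g (q.inr e) (σ - s - q.Φ e))) := by
    refine tsum_congr fun e => ?_
    have h1 := hf (q.inl e)
    have h2 := hg (q.inr e)
    rw [← lintegral_const_mul _ (by fun_prop)]
    refine lintegral_congr fun s => ?_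
    have a1 := jb_half_mul s
    have a2 := jb_half_mul (σ - s - q.Φ e)
    calc _ = q.gainSqrt e * (1 * f (q.inl e) s * (1 * g (q.inr e) (σ - s - q.Φ e))) := by ring
      _ = _ := by rw [← a1]; nth_rewrite 2 [a1]; rw [← a2]; ring
  rw [e1]
  refine (sq_tsum_lintegral_mul_le (fun e => ?_) (fun e => ?_)).trans ?_
  · fun_prop
  · have h1 := hf (q.inl e)
    have h2 := hg (q.inr e)
    fun_prop
  refine mul_le_mul' ?_ (le_of_eq ?_)
  · calc _ = ∑' e : q.out ⁻¹' {i}, q.gain e *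
          ∫⁻ s, jb s ^ (-1 : ℝ) * jb ((σ - q.Φ e) - s) ^ (-1 : ℝ) := by
          refine tsum_congr fun e => ?_
          rw [← lintegral_const_mul _ (by fun_prop)]
          refine lintegral_congr fun s => ?_
          rw [mul_pow, mul_pow, gainSqrt_sq, jb_half_sq, jb_half_sq,
            show σ - s - q.Φ e = σ - q.Φ e - s by ring]
      _ ≤ ∑' e : q.out ⁻¹' {i}, q.gain e * (4 * jbMass * jb (σ - q.Φ e) ^ (-(5 / 8) : ℝ)) := by
          gcongr with e
          exact lintegral_jb_conv_le _
      _ = 4 * jbMass * ∑' e : q.out ⁻¹' {i}, q.gain e * jb (q.Φ e - σ) ^ (-(5 / 8) : ℝ) := by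
          rw [← ENNReal.tsum_mul_left]
          refine tsum_congr fun e => ?_
          rw [jb_sub_comm σ]; ring
      _ ≤ _ := by gcongr; exact h.sum_out i σ
  · refine tsum_congr fun e => lintegral_congr fun s => ?_
    rw [mul_pow, mul_pow, mul_pow, sqrt_sq, sqrt_sq]

/-- The estimate when the output carries the largest modulation. -/
lemma Small.lintegral_sq_conv_le [Countable E] :
    ∑' i, ∫⁻ σ, q.conv q.gainSqrt f g i σ ^ 2 ≤ 4 * jbMass * ε * (hNorm f * hNorm g) := by
  have mf : ∀ i, Measurable fun s => jb s * f i s ^ 2 := fun i => by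
    have := hf i; fun_prop
  have mg : ∀ i, Measurable fun s => jb s * g i s ^ 2 := fun i => by
    have := hg i; fun_prop
  have mm : ∀ e, Measurable fun σ => ∫⁻ s, (jb s * f (q.inl e) s ^ 2) *
      (jb (σ - s - q.Φ e) * g (q.inr e) (σ - s - q.Φ e) ^ 2) := fun e => by
    refine Measurable.lintegral_prod_right' (f := fun p : ℝ × ℝ => (jb p.2 * f (q.inl e) p.2 ^ 2) *
      (jb (p.1 - p.2 - q.Φ e) * g (q.inr e) (p.1 - p.2 - q.Φ e) ^ 2)) ?_
    have h1 := hf (q.inl e)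
    have h2 := hg (q.inr e)
    fun_prop
  calc _ ≤ ∑' i, ∫⁻ σ, 4 * jbMass * ε * ∑' e : q.out ⁻¹' {i}, ∫⁻ s, (jb s * f (q.inl e) s ^ 2) *
          (jb (σ - s - q.Φ e) * g (q.inr e) (σ - s - q.Φ e) ^ 2) := by
        gcongr with i σ
        exact h.sq_conv_gainSqrt_le hf hg i σ
    _ = 4 * jbMass * ε * ∑' i, ∑' e : q.out ⁻¹' {i}, (∫⁻ s, jb s * f (q.inl e) s ^ 2) *
          ∫⁻ s, jb s * g (q.inr e) s ^ 2 := by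
        rw [← ENNReal.tsum_mul_left]
        refine tsum_congr fun i => ?_
        rw [lintegral_const_mul _ (Measurable.tsum fun e : q.out ⁻¹' {i} => mm e),
          lintegral_tsum fun e : q.out ⁻¹' {i} => (mm e).aemeasurable]
        congr 1
        refine tsum_congr fun e => ?_
        exact lintegral_conv_eq (mf _) (mg _) (q.Φ e)
    _ = 4 * jbMass * ε * ∑' e, (∫⁻ s, jb s * f (q.inl e) s ^ 2) *
          ∫⁻ s, jb s * g (q.inr e) s ^ 2 := by
        rw [ENNReal.tsum_fiberwise (fun e => (∫⁻ s, jb s * f (q.inl e) s ^ 2) *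
          ∫⁻ s, jb s * g (q.inr e) s ^ 2) q.out]
    _ ≤ _ := by
        gcongr
        exact tsum_mul_le_of_injective h.inj_in (fun i => ∫⁻ s, jb s * f i s ^ 2)
          (fun i => ∫⁻ s, jb s * g i s ^ 2)

/-- The weight of the first factor has been spent on the phase, so only the second one is available
for Cauchy–Schwarz. Interactions with the same output have distinct right inputs, hence the squares
of `g` add up to at most `hNorm g`. -/
lemma Small.sq_conv_left_le (i : ι) (σ : ℝ) :
    q.conv q.gainSqrt (fun i s => jb s ^ (1 / 2 : ℝ) * f i s) g i σ ^ 2 ≤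
      hNorm g * ∑' e : q.out ⁻¹' {i}, ∫⁻ s, q.gain e * (jb s * f (q.inl e) s ^ 2) *
        jb (σ - s - q.Φ e) ^ (-1 : ℝ) := by
  have e1 : q.conv q.gainSqrt (fun i s => jb s ^ (1 / 2 : ℝ) * f i s) g i σ =
      ∑' e : q.out ⁻¹' {i}, ∫⁻ s,
        (jb (σ - s - q.Φ e) ^ (1 / 2 : ℝ) * g (q.inr e) (σ - s - q.Φ e)) *
        (q.gainSqrt e * (jb s ^ (1 / 2 : ℝ) * f (q.inl e) s) *
          jb (σ - s - q.Φ e) ^ (-(1 / 2) : ℝ)) := by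
    refine tsum_congr fun e => ?_
    have h1 := hf (q.inl e)
    have h2 := hg (q.inr e)
    rw [← lintegral_const_mul _ (by fun_prop)]
    refine lintegral_congr fun s => ?_
    have a2 := jb_half_mul (σ - s - q.Φ e)
    calc _ = q.gainSqrt e * (jb s ^ (1 / 2 : ℝ) * f (q.inl e) s) *
          (1 * g (q.inr e) (σ - s - q.Φ e)) := by ring
      _ = _ := by rw [← a2]; ring
  rw [e1]
  refine (sq_tsum_lintegral_mul_le (fun e => ?_) (fun e => ?_)).trans ?_
  · have h2 := hg (q.inr e)
    fun_prop
  · have h1 := hf (q.inl e)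
    fun_prop
  refine mul_le_mul' ?_ (le_of_eq ?_)
  · calc _ = ∑' e : q.out ⁻¹' {i}, ∫⁻ s, jb s * g (q.inr e) s ^ 2 := by
          refine tsum_congr fun e => ?_
          rw [← lintegral_sub_left_eq_self (fun s => jb s * g (q.inr e) s ^ 2) (σ - q.Φ e)]
          refine lintegral_congr fun s => ?_
          rw [mul_pow, sqrt_sq, show σ - s - q.Φ e = σ - q.Φ e - s by ring]
      _ ≤ _ := tsum_fiber_le h.inj_outr (fun i => ∫⁻ s, jb s * g i s ^ 2) i
  · refine tsum_congr fun e => lintegral_congr fun s => ?_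
    rw [mul_pow, mul_pow, mul_pow, sqrt_sq, gainSqrt_sq, jb_half_sq]

/-- The estimate when the first factor carries the largest modulation. -/
lemma Small.lintegral_sq_conv_left_le [Countable E] :
    ∑' i, ∫⁻ σ, jb σ ^ (-(7 / 8) : ℝ) *
        q.conv q.gainSqrt (fun i s => jb s ^ (1 / 2 : ℝ) * f i s) g i σ ^ 2
      ≤ 4 * jbMass * ε * (hNorm f * hNorm g) := by
  have mm : ∀ e, Measurable fun p : ℝ × ℝ => jb p.1 ^ (-(7 / 8) : ℝ) *
      (q.gain e * (jb p.2 * f (q.inl e) p.2 ^ 2) * jb (p.1 - p.2 - q.Φ e) ^ (-1 : ℝ)) := fun e => by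
    have h1 := hf (q.inl e)
    fun_prop
  have mm' : ∀ e, Measurable fun σ => ∫⁻ s, jb σ ^ (-(7 / 8) : ℝ) *
      (q.gain e * (jb s * f (q.inl e) s ^ 2) * jb (σ - s - q.Φ e) ^ (-1 : ℝ)) := fun e =>
    Measurable.lintegral_prod_right' (mm e)
  have inner : ∀ e, ∫⁻ σ, ∫⁻ s, jb σ ^ (-(7 / 8) : ℝ) *
      (q.gain e * (jb s * f (q.inl e) s ^ 2) * jb (σ - s - q.Φ e) ^ (-1 : ℝ))
      ≤ ∫⁻ s, 4 * jbMass * (q.gain e * jb (q.Φ e - (-s)) ^ (-(5 / 8) : ℝ) *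
          (jb s * f (q.inl e) s ^ 2)) := by
    intro e
    -- Integrating in σ first makes the two brackets combine into ⟨s + Φ⟩^{-5/8}.
    rw [lintegral_lintegral_swap (mm e).aemeasurable]
    refine lintegral_mono fun s => ?_
    calc _ = ∫⁻ σ, (q.gain e * (jb s * f (q.inl e) s ^ 2)) *
          (jb σ ^ (-(7 / 8) : ℝ) * jb (s + q.Φ e - σ) ^ (-1 : ℝ)) := by
          refine lintegral_congr fun σ => ?_
          rw [sub_sub, jb_sub_comm σ]; ring
      _ = (q.gain e * (jb s * f (q.inl e) s ^ 2)) *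
          ∫⁻ σ, jb σ ^ (-(7 / 8) : ℝ) * jb (s + q.Φ e - σ) ^ (-1 : ℝ) :=
          lintegral_const_mul _ (by fun_prop)
      _ ≤ (q.gain e * (jb s * f (q.inl e) s ^ 2)) *
          (4 * jbMass * jb (s + q.Φ e) ^ (-(5 / 8) : ℝ)) := by
          gcongr
          refine (lintegral_mono fun σ => ?_).trans (lintegral_jb_mul_jb_le _)
          exact mul_le_mul' le_rfl (jb_rpow_le_of_le (by norm_num))
      _ = _ := by rw [show q.Φ e - -s = s + q.Φ e by ring]; ring
  calc _ ≤ ∑' i, ∫⁻ σ, hNorm g * ∑' e : q.out ⁻¹' {i}, ∫⁻ s, jb σ ^ (-(7 / 8) : ℝ) *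
          (q.gain e * (jb s * f (q.inl e) s ^ 2) * jb (σ - s - q.Φ e) ^ (-1 : ℝ)) := by
        refine ENNReal.tsum_le_tsum fun i => lintegral_mono fun σ => ?_
        refine (mul_le_mul' le_rfl (h.sq_conv_left_le hf hg i σ)).trans_eq ?_
        rw [mul_left_comm, ← ENNReal.tsum_mul_left]
        congr 1
        refine tsum_congr fun e => ?_
        have h1 := hf (q.inl e)
        rw [lintegral_const_mul _ (by fun_prop)]
    _ = hNorm g * ∑' i, ∑' e : q.out ⁻¹' {i}, ∫⁻ σ, ∫⁻ s, jb σ ^ (-(7 / 8) : ℝ) *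
          (q.gain e * (jb s * f (q.inl e) s ^ 2) * jb (σ - s - q.Φ e) ^ (-1 : ℝ)) := by
        rw [← ENNReal.tsum_mul_left]
        refine tsum_congr fun i => ?_
        rw [lintegral_const_mul _ (Measurable.tsum fun e : q.out ⁻¹' {i} => mm' e),
          lintegral_tsum fun e : q.out ⁻¹' {i} => (mm' e).aemeasurable]
    -- The interactions are regrouped by their left input: with that index and s fixed, `sum_inl`
    -- bounds the remaining sum.
    _ = hNorm g * ∑' i, ∑' e : q.inl ⁻¹' {i}, ∫⁻ σ, ∫⁻ s, jb σ ^ (-(7 / 8) : ℝ) *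
          (q.gain e * (jb s * f (q.inl e) s ^ 2) * jb (σ - s - q.Φ e) ^ (-1 : ℝ)) := by
        rw [ENNReal.tsum_fiberwise (fun e => ∫⁻ σ, ∫⁻ s, jb σ ^ (-(7 / 8) : ℝ) *
          (q.gain e * (jb s * f (q.inl e) s ^ 2) * jb (σ - s - q.Φ e) ^ (-1 : ℝ))) q.out,
          ENNReal.tsum_fiberwise (fun e => ∫⁻ σ, ∫⁻ s, jb σ ^ (-(7 / 8) : ℝ) *
          (q.gain e * (jb s * f (q.inl e) s ^ 2) * jb (σ - s - q.Φ e) ^ (-1 : ℝ))) q.inl]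
    _ ≤ hNorm g * ∑' i, (4 * jbMass * ε * ∫⁻ s, jb s * f i s ^ 2) := by
        gcongr with i
        calc _ ≤ ∑' e : q.inl ⁻¹' {i}, ∫⁻ s, 4 * jbMass *
              (q.gain e * jb (q.Φ e - (-s)) ^ (-(5 / 8) : ℝ) * (jb s * f i s ^ 2)) := by
              refine ENNReal.tsum_le_tsum fun e => ?_
              have he : q.inl e = i := e.2
              simpa only [he] using inner e
          _ = ∫⁻ s, 4 * jbMass * ((∑' e : q.inl ⁻¹' {i}, q.gain e *
              jb (q.Φ e - (-s)) ^ (-(5 / 8) : ℝ)) * (jb s * f i s ^ 2)) := by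
              have h1 := hf i
              rw [← lintegral_tsum fun e => by fun_prop]
              simp_rw [ENNReal.tsum_mul_left, ENNReal.tsum_mul_right]
          _ ≤ ∫⁻ s, 4 * jbMass * (ε * (jb s * f i s ^ 2)) := by
              gcongr with s
              exact h.sum_inl i (-s)
          _ = _ := by
              have h1 := hf i
              simp_rw [← mul_assoc]
              simp_rw [mul_assoc _ (jb _)]
              rw [lintegral_const_mul _ (by fun_prop)]
    _ = _ := by rw [ENNReal.tsum_mul_left, hNorm, hNorm]; ring

lemma Small.lintegral_sq_conv_right_le [Countable E] :
    ∑' i, ∫⁻ σ, jb σ ^ (-(7 / 8) : ℝ) *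
        q.conv q.gainSqrt f (fun i s => jb s ^ (1 / 2 : ℝ) * g i s) i σ ^ 2
      ≤ 4 * jbMass * ε * (hNorm f * hNorm g) := by
  have := h.swap.lintegral_sq_conv_left_le hg hf
  rw [mul_comm (hNorm f)]
  simp only [conv_swap] at this
  exact this

/-- By Tonelli the L¹ norm of each convolution is a product of L¹ norms, and no modulation weight of
the inputs is needed. The exponent 13/16 of `gainOut` satisfies 2 · 13/16 = 1 + 5/8, so its square
is the gain times the bracket of `sum_inl` at s = 0. -/
lemma Small.sq_lintegral_conv_gainOut_le [Countable E] :
    ∑' i, (∫⁻ σ, q.conv q.gainOut f g i σ) ^ 2 ≤ ε * (sNorm f * sNorm g) := by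
  have mm : ∀ e, Measurable fun σ => ∫⁻ s, f (q.inl e) s * g (q.inr e) (σ - s - q.Φ e) :=
    fun e => by
    refine Measurable.lintegral_prod_right' (f := fun p : ℝ × ℝ =>
      f (q.inl e) p.2 * g (q.inr e) (p.1 - p.2 - q.Φ e)) ?_
    have h1 := hf (q.inl e)
    have h2 := hg (q.inr e)
    fun_prop
  have e1 : ∀ i, ∫⁻ σ, q.conv q.gainOut f g i σ = ∑' e : q.out ⁻¹' {i},
      (∫⁻ s, g (q.inr e) s) * (q.gainOut e * ∫⁻ s, f (q.inl e) s) := by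
    intro i
    unfold conv
    rw [lintegral_tsum fun e => by have := mm e; fun_prop]
    refine tsum_congr fun e => ?_
    rw [lintegral_const_mul _ (mm e), lintegral_conv_eq (hf _) (hg _)]
    ring
  calc _ ≤ ∑' i, sNorm g * ∑' e : q.out ⁻¹' {i}, q.gain e * jb (q.Φ e - 0) ^ (-(5 / 8) : ℝ) *
          (∫⁻ s, f (q.inl e) s) ^ 2 := by
        gcongr with i
        rw [e1]
        refine (sq_tsum_mul_le _ _).trans ?_
        refine mul_le_mul' (tsum_fiber_le h.inj_outr (fun i => (∫⁻ s, g i s) ^ 2) i) (le_of_eq ?_)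
        refine tsum_congr fun e => ?_
        rw [mul_pow, gainOut_sq]
    _ = sNorm g * ∑' e, q.gain e * jb (q.Φ e - 0) ^ (-(5 / 8) : ℝ) * (∫⁻ s, f (q.inl e) s) ^ 2 := by
        rw [ENNReal.tsum_mul_left, ENNReal.tsum_fiberwise (fun e => q.gain e *
          jb (q.Φ e - 0) ^ (-(5 / 8) : ℝ) * (∫⁻ s, f (q.inl e) s) ^ 2) q.out]
    _ ≤ sNorm g * (ε * sNorm f) := by
        gcongr
        exact tsum_fiber_mul_le (fun e => q.gain e * jb (q.Φ e - 0) ^ (-(5 / 8) : ℝ))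
          (fun i => (∫⁻ s, f i s) ^ 2) (fun i => h.sum_inl i 0)
    _ = _ := by ring

end estimates

end QSys

end DSW

/-! ### The bilinear estimate in X^{0,1/2} ∩ ℓ²L¹ -/

namespace DSW

/-- The squared norm of `X^{0,1/2} ∩ ℓ² L¹`. -/
noncomputable def zNorm {ι : Type*} (f : ι → ℝ → ℝ≥0∞) : ℝ≥0∞ := hNorm f + sNorm f

lemma sNorm_le_zNorm {ι : Type*} (f : ι → ℝ → ℝ≥0∞) : sNorm f ≤ zNorm f := le_add_self

lemma hNorm_le_zNorm {ι : Type*} (f : ι → ℝ → ℝ≥0∞) : hNorm f ≤ zNorm f := le_self_add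

lemma zNorm_mono {ι : Type*} {f g : ι → ℝ → ℝ≥0∞} (h : ∀ i s, f i s ≤ g i s) :
    zNorm f ≤ zNorm g := by
  unfold zNorm hNorm sNorm
  gcongr with i s i s
  · exact h i s
  · exact h i s

lemma zNorm_add_le {ι : Type*} {f g : ι → ℝ → ℝ≥0∞} (hf : ∀ i, Measurable (f i)) :
    zNorm (fun i s => f i s + g i s) ≤ 2 * zNorm f + 2 * zNorm g := by
  have h1 : hNorm (fun i s => f i s + g i s) ≤ 2 * hNorm f + 2 * hNorm g := by
    unfold hNorm
    rw [← ENNReal.tsum_mul_left, ← ENNReal.tsum_mul_left, ← ENNReal.tsum_add]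
    gcongr with i
    have := hf i
    rw [← lintegral_const_mul' _ _ (by simp), ← lintegral_const_mul' _ _ (by simp),
      ← lintegral_add_left (by fun_prop)]
    gcongr with s
    calc _ ≤ jb s * (2 * f i s ^ 2 + 2 * g i s ^ 2) := by gcongr; exact add_sq_le _ _
      _ = _ := by ring
  have h2 : sNorm (fun i s => f i s + g i s) ≤ 2 * sNorm f + 2 * sNorm g := by
    unfold sNorm
    rw [← ENNReal.tsum_mul_left, ← ENNReal.tsum_mul_left, ← ENNReal.tsum_add]
    gcongr with i
    rw [lintegral_add_left (hf i)]
    exact add_sq_le _ _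
  calc _ ≤ (2 * hNorm f + 2 * hNorm g) + (2 * sNorm f + 2 * sNorm g) := add_le_add h1 h2
    _ = _ := by unfold zNorm; ring

namespace QSys

variable {ι E : Type*} {q : QSys ι E} {ε : ℝ≥0∞}

/-- The resonance identity Φ = σ - s - (σ - s - Φ): the three modulations cannot all be small
compared with the phase. -/
lemma jb_phase_le (q : QSys ι E) (e : E) (σ s : ℝ) :
    jb (q.Φ e) ≤ jb σ + (jb s + jb (σ - s - q.Φ e)) := by
  calc jb (q.Φ e) = jb (σ + (-s + -(σ - s - q.Φ e))) := by congr 1; ring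
    _ ≤ _ := (jb_add_le _ _).trans (by
      gcongr
      refine (jb_add_le _ _).trans_eq ?_
      rw [jb_neg, jb_neg])

lemma sqrt_add_le (x y : ℝ≥0∞) : (x + y) ^ (1 / 2 : ℝ) ≤ x ^ (1 / 2 : ℝ) + y ^ (1 / 2 : ℝ) :=
  ENNReal.rpow_add_le_add_rpow _ _ (by norm_num) (by norm_num)

lemma enorm_M_eq (e : E) : ‖q.M e‖ₑ = q.gainSqrt e * jb (q.Φ e) ^ (1 / 2 : ℝ) := by
  rw [gainSqrt, mul_assoc, ← jb_rpow_add]; norm_num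

lemma enorm_M_eq_gainOut (e : E) : ‖q.M e‖ₑ = q.gainOut e * jb (q.Φ e) ^ (13 / 16 : ℝ) := by
  rw [gainOut, mul_assoc, ← jb_rpow_add]; norm_num

lemma enorm_M_le (e : E) (σ s : ℝ) :
    ‖q.M e‖ₑ ≤ q.gainSqrt e * (jb σ ^ (1 / 2 : ℝ) + (jb s ^ (1 / 2 : ℝ) +
      jb (σ - s - q.Φ e) ^ (1 / 2 : ℝ))) := by
  rw [enorm_M_eq]
  gcongr
  refine (ENNReal.rpow_le_rpow (q.jb_phase_le e σ s) (by norm_num)).trans ?_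
  refine (sqrt_add_le _ _).trans ?_
  gcongr
  exact sqrt_add_le _ _

/-- A refinement of `enorm_M_le` for the ℓ²L¹ norm, where an output term ⟨σ⟩^{-1/2} F with F in L²
would miss integrability by a logarithm. When the output modulation dominates, ⟨Φ⟩ ≤ 2⟨σ⟩, and the
full power ⟨σ⟩ that Duhamel's formula will cancel is used; this permits more than half a power of
⟨Φ⟩ in `gainOut`. -/
lemma enorm_M_le' (e : E) (σ s : ℝ) :
    ‖q.M e‖ₑ ≤ 2 * q.gainOut e * jb σ +
      2 * q.gainSqrt e * (jb s ^ (1 / 2 : ℝ) + jb (σ - s - q.Φ e) ^ (1 / 2 : ℝ)) := by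
  have h := q.jb_phase_le e σ s
  rcases le_total (jb σ) (jb s + jb (σ - s - q.Φ e)) with h' | h'
  · refine le_trans ?_ le_add_self
    have h2 : jb (q.Φ e) ≤ 4 * (jb s + jb (σ - s - q.Φ e)) := by
      refine (h.trans (add_le_add_left h' _)).trans ?_
      rw [← two_mul]
      gcongr
      norm_num
    have h4 : (4 : ℝ≥0∞) ^ (1 / 2 : ℝ) = 2 := by
      rw [show (4 : ℝ≥0∞) = 2 ^ (2 : ℝ) by norm_num, ← ENNReal.rpow_mul]; norm_num
    calc ‖q.M e‖ₑ = q.gainSqrt e * jb (q.Φ e) ^ (1 / 2 : ℝ) := enorm_M_eq e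
      _ ≤ q.gainSqrt e * (2 * (jb s ^ (1 / 2 : ℝ) + jb (σ - s - q.Φ e) ^ (1 / 2 : ℝ))) := by
          gcongr
          refine (ENNReal.rpow_le_rpow h2 (by norm_num)).trans ?_
          rw [ENNReal.mul_rpow_of_nonneg _ _ (by norm_num : (0 : ℝ) ≤ 1 / 2), h4]
          gcongr
          exact sqrt_add_le _ _
      _ = _ := by ring
  · refine le_trans ?_ le_self_add
    have h2 : jb (q.Φ e) ≤ 2 * jb σ := by
      rw [two_mul]; exact h.trans (add_le_add_right h' _)
    calc ‖q.M e‖ₑ = q.gainOut e * jb (q.Φ e) ^ (13 / 16 : ℝ) := enorm_M_eq_gainOut e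
      _ ≤ q.gainOut e * (jb (q.Φ e)) ^ (1 : ℝ) := by
          gcongr
          · exact one_le_jb _
          · norm_num
      _ ≤ q.gainOut e * (2 * jb σ) := by rw [ENNReal.rpow_one]; gcongr
      _ = _ := by ring

/-- The quadratic form with absolute values everywhere. -/
noncomputable def absForm (q : QSys ι E) (f g : ι → ℝ → ℝ≥0∞) : ι → ℝ → ℝ≥0∞ :=
  q.conv (fun e => ‖q.M e‖ₑ) f g

section pointwise

variable {f g : ι → ℝ → ℝ≥0∞} (hf : ∀ i, Measurable (f i)) (hg : ∀ i, Measurable (g i))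

include hf hg

lemma absForm_le (i : ι) (σ : ℝ) :
    q.absForm f g i σ ≤ jb σ ^ (1 / 2 : ℝ) * q.conv q.gainSqrt f g i σ +
      (q.conv q.gainSqrt (fun i s => jb s ^ (1 / 2 : ℝ) * f i s) g i σ +
        q.conv q.gainSqrt f (fun i s => jb s ^ (1 / 2 : ℝ) * g i s) i σ) := by
  unfold absForm conv
  rw [← ENNReal.tsum_mul_left, ← ENNReal.tsum_add, ← ENNReal.tsum_add]
  refine ENNReal.tsum_le_tsum fun e => ?_
  have h1 := hf (q.inl e)
  have h2 := hg (q.inr e)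
  rw [← mul_assoc]
  rw [← lintegral_const_mul _ (by fun_prop), ← lintegral_const_mul _ (by fun_prop),
    ← lintegral_const_mul _ (by fun_prop), ← lintegral_const_mul _ (by fun_prop),
    ← lintegral_add_left (by fun_prop), ← lintegral_add_left (by fun_prop)]
  refine lintegral_mono fun s => ?_
  calc _ ≤ (q.gainSqrt e * (jb σ ^ (1 / 2 : ℝ) + (jb s ^ (1 / 2 : ℝ) +
      jb (σ - s - q.Φ e) ^ (1 / 2 : ℝ)))) * (f (q.inl e) s * g (q.inr e) (σ - s - q.Φ e)) := by
        gcongr; exact enorm_M_le _ _ _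
    _ = _ := by ring

lemma absForm_le' (i : ι) (σ : ℝ) :
    q.absForm f g i σ ≤ 2 * jb σ * q.conv q.gainOut f g i σ +
      (2 * q.conv q.gainSqrt (fun i s => jb s ^ (1 / 2 : ℝ) * f i s) g i σ +
        2 * q.conv q.gainSqrt f (fun i s => jb s ^ (1 / 2 : ℝ) * g i s) i σ) := by
  unfold absForm conv
  rw [← ENNReal.tsum_mul_left, ← ENNReal.tsum_mul_left, ← ENNReal.tsum_mul_left,
    ← ENNReal.tsum_add, ← ENNReal.tsum_add]
  refine ENNReal.tsum_le_tsum fun e => ?_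
  have h1 := hf (q.inl e)
  have h2 := hg (q.inr e)
  simp_rw [← mul_assoc (2 : ℝ≥0∞), ← mul_assoc (2 * jb σ)]
  rw [← lintegral_const_mul _ (by fun_prop), ← lintegral_const_mul _ (by fun_prop),
    ← lintegral_const_mul _ (by fun_prop), ← lintegral_const_mul _ (by fun_prop),
    ← lintegral_add_left (by fun_prop), ← lintegral_add_left (by fun_prop)]
  refine lintegral_mono fun s => ?_
  calc _ ≤ (2 * q.gainOut e * jb σ +
      2 * q.gainSqrt e * (jb s ^ (1 / 2 : ℝ) + jb (σ - s - q.Φ e) ^ (1 / 2 : ℝ))) *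
        (f (q.inl e) s * g (q.inr e) (σ - s - q.Φ e)) := by
        gcongr; exact enorm_M_le' _ _ _
    _ = _ := by ring

end pointwise

/-- The constant of the bilinear estimate. -/
noncomputable def bilConst : ℝ≥0∞ := 40 * jbMass + 8 + 128 * jbMass ^ 2

lemma bilConst_ne_top : bilConst ≠ ⊤ := by
  unfold bilConst
  have := jbMass_ne_top
  finiteness

lemma jb_inv_rpow (σ : ℝ) : (jb σ)⁻¹ = jb σ ^ (-1 : ℝ) := by rw [ENNReal.rpow_neg_one]

lemma jb_mul_inv_sq (σ : ℝ) (x : ℝ≥0∞) : jb σ * ((jb σ)⁻¹ * x) ^ 2 = jb σ ^ (-1 : ℝ) * x ^ 2 := by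
  have h := ENNReal.mul_inv_cancel (jb_ne_zero σ) (jb_ne_top σ)
  calc jb σ * ((jb σ)⁻¹ * x) ^ 2 = (jb σ * (jb σ)⁻¹) * ((jb σ)⁻¹ * x ^ 2) := by ring
    _ = _ := by rw [h, one_mul, jb_inv_rpow]

/-- Cauchy–Schwarz with 1 = 9/16 + 7/16: the square of ⟨σ⟩^{-9/16} is integrable, and the other
factor leaves the weight ⟨σ⟩^{-7/8}. This is where the exponent 7/8 in the estimates with a dominant
input comes from. -/
lemma sq_lintegral_jb_inv_le {F : ℝ → ℝ≥0∞} (hF : Measurable F) :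
    (∫⁻ σ, (jb σ)⁻¹ * F σ) ^ 2 ≤ jbMass * ∫⁻ σ, jb σ ^ (-(7 / 8) : ℝ) * F σ ^ 2 := by
  have e1 : ∀ σ, (jb σ)⁻¹ * F σ = jb σ ^ (-(9 / 16) : ℝ) * (jb σ ^ (-(7 / 16) : ℝ) * F σ) := by
    intro σ
    rw [jb_inv_rpow, ← mul_assoc, ← jb_rpow_add]; norm_num
  simp_rw [e1]
  refine (sq_lintegral_mul_le _ (by fun_prop) (by fun_prop)).trans_eq ?_
  unfold jbMass
  congr 1
  · refine lintegral_congr fun σ => ?_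
    rw [← ENNReal.rpow_natCast, ← ENNReal.rpow_mul]; norm_num
  · refine lintegral_congr fun σ => ?_
    rw [mul_pow, ← ENNReal.rpow_natCast (jb _ ^ _), ← ENNReal.rpow_mul]; norm_num

variable [Countable E] (h : q.Small ε) {f g : ι → ℝ → ℝ≥0∞} (hf : ∀ i, Measurable (f i))
  (hg : ∀ i, Measurable (g i))

include h hf hg

/-- After division by ⟨σ⟩ the squared norm carries the weight ⟨σ⟩^{-1}. It cancels the factor ⟨σ⟩ of
the term with dominant output, and it is at most ⟨σ⟩^{-7/8} in the terms with a dominant input. -/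
lemma Small.hNorm_absForm_le :
    hNorm (fun i σ => (jb σ)⁻¹ * q.absForm f g i σ) ≤ 40 * jbMass * ε * (hNorm f * hNorm g) := by
  have mf : ∀ i, Measurable (fun s => jb s ^ (1 / 2 : ℝ) * f i s) := fun i => by
    have := hf i; fun_prop
  have mg : ∀ i, Measurable (fun s => jb s ^ (1 / 2 : ℝ) * g i s) := fun i => by
    have := hg i; fun_prop
  have m0 := fun i => measurable_conv (q := q) q.gainSqrt hf hg i
  have m1 := fun i => measurable_conv (q := q) q.gainSqrt mf hg i
  have m2 := fun i => measurable_conv (q := q) q.gainSqrt hf mg i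
  have l0 := h.lintegral_sq_conv_le hf hg
  have l1 := h.lintegral_sq_conv_left_le hf hg
  have l2 := h.lintegral_sq_conv_right_le hf hg
  have key : ∀ i σ, jb σ * ((jb σ)⁻¹ * q.absForm f g i σ) ^ 2 ≤
      2 * q.conv q.gainSqrt f g i σ ^ 2 +
      (4 * (jb σ ^ (-(7 / 8) : ℝ) *
        q.conv q.gainSqrt (fun i s => jb s ^ (1 / 2 : ℝ) * f i s) g i σ ^ 2) +
      4 * (jb σ ^ (-(7 / 8) : ℝ) *
        q.conv q.gainSqrt f (fun i s => jb s ^ (1 / 2 : ℝ) * g i s) i σ ^ 2)) := by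
    intro i σ
    rw [jb_mul_inv_sq]
    have e1 : jb σ ^ (-1 : ℝ) * (jb σ ^ (1 / 2 : ℝ)) ^ 2 = 1 := by
      rw [sqrt_sq, ENNReal.rpow_neg_one, ENNReal.inv_mul_cancel (jb_ne_zero σ) (jb_ne_top σ)]
    have e2 : jb σ ^ (-1 : ℝ) ≤ jb σ ^ (-(7 / 8) : ℝ) := jb_rpow_le_of_le (by norm_num)
    set A := q.conv q.gainSqrt f g i σ
    set B := q.conv q.gainSqrt (fun i s => jb s ^ (1 / 2 : ℝ) * f i s) g i σ
    set C := q.conv q.gainSqrt f (fun i s => jb s ^ (1 / 2 : ℝ) * g i s) i σ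
    calc _ ≤ jb σ ^ (-1 : ℝ) * (jb σ ^ (1 / 2 : ℝ) * A + (B + C)) ^ 2 := by
          gcongr; exact absForm_le hf hg i σ
      _ ≤ jb σ ^ (-1 : ℝ) * (2 * (jb σ ^ (1 / 2 : ℝ) * A) ^ 2 + 2 * (2 * B ^ 2 + 2 * C ^ 2)) := by
          gcongr
          refine (add_sq_le _ _).trans ?_
          gcongr
          exact add_sq_le _ _
      _ = 2 * ((jb σ ^ (-1 : ℝ) * (jb σ ^ (1 / 2 : ℝ)) ^ 2) * A ^ 2) +
          (4 * (jb σ ^ (-1 : ℝ) * B ^ 2) + 4 * (jb σ ^ (-1 : ℝ) * C ^ 2)) := by ring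
      _ ≤ _ := by rw [e1, one_mul]; gcongr
  calc _ ≤ ∑' i, ∫⁻ σ, (2 * q.conv q.gainSqrt f g i σ ^ 2 +
      (4 * (jb σ ^ (-(7 / 8) : ℝ) *
        q.conv q.gainSqrt (fun i s => jb s ^ (1 / 2 : ℝ) * f i s) g i σ ^ 2) +
      4 * (jb σ ^ (-(7 / 8) : ℝ) *
        q.conv q.gainSqrt f (fun i s => jb s ^ (1 / 2 : ℝ) * g i s) i σ ^ 2))) :=
        ENNReal.tsum_le_tsum fun i => lintegral_mono fun σ => key i σ
    _ = 2 * (∑' i, ∫⁻ σ, q.conv q.gainSqrt f g i σ ^ 2) +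
      (4 * (∑' i, ∫⁻ σ, jb σ ^ (-(7 / 8) : ℝ) *
        q.conv q.gainSqrt (fun i s => jb s ^ (1 / 2 : ℝ) * f i s) g i σ ^ 2) +
      4 * (∑' i, ∫⁻ σ, jb σ ^ (-(7 / 8) : ℝ) *
        q.conv q.gainSqrt f (fun i s => jb s ^ (1 / 2 : ℝ) * g i s) i σ ^ 2)) := by
        rw [← ENNReal.tsum_mul_left, ← ENNReal.tsum_mul_left, ← ENNReal.tsum_mul_left,
          ← ENNReal.tsum_add, ← ENNReal.tsum_add]
        refine tsum_congr fun i => ?_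
        have n0 := m0 i
        have n1 := m1 i
        have n2 := m2 i
        rw [lintegral_add_left (by fun_prop), lintegral_add_left (by fun_prop),
          lintegral_const_mul' _ _ (by simp), lintegral_const_mul' _ _ (by simp),
          lintegral_const_mul' _ _ (by simp)]
    _ ≤ 2 * (4 * jbMass * ε * (hNorm f * hNorm g)) + (4 * (4 * jbMass * ε * (hNorm f * hNorm g)) +
          4 * (4 * jbMass * ε * (hNorm f * hNorm g))) := by gcongr
    _ = _ := by ring

/-- In the decomposition `absForm_le'` the term with dominant output loses its factor ⟨σ⟩ entirely
and is a convolution of L¹ functions; the terms with a dominant input pass from weighted L² to L¹ by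
`sq_lintegral_jb_inv_le`. -/
lemma Small.sNorm_absForm_le :
    sNorm (fun i σ => (jb σ)⁻¹ * q.absForm f g i σ) ≤
      8 * ε * (sNorm f * sNorm g) + 128 * jbMass ^ 2 * ε * (hNorm f * hNorm g) := by
  have mf : ∀ i, Measurable (fun s => jb s ^ (1 / 2 : ℝ) * f i s) := fun i => by
    have := hf i; fun_prop
  have mg : ∀ i, Measurable (fun s => jb s ^ (1 / 2 : ℝ) * g i s) := fun i => by
    have := hg i; fun_prop
  have m0 := fun i => measurable_conv (q := q) q.gainOut hf hg i
  have m1 := fun i => measurable_conv (q := q) q.gainSqrt mf hg i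
  have m2 := fun i => measurable_conv (q := q) q.gainSqrt hf mg i
  have l0 := h.sq_lintegral_conv_gainOut_le hf hg
  have l1 := h.lintegral_sq_conv_left_le hf hg
  have l2 := h.lintegral_sq_conv_right_le hf hg
  have key : ∀ i, (∫⁻ σ, (jb σ)⁻¹ * q.absForm f g i σ) ^ 2 ≤
      8 * (∫⁻ σ, q.conv q.gainOut f g i σ) ^ 2 +
      (16 * (jbMass * ∫⁻ σ, jb σ ^ (-(7 / 8) : ℝ) *
        q.conv q.gainSqrt (fun i s => jb s ^ (1 / 2 : ℝ) * f i s) g i σ ^ 2) +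
      16 * (jbMass * ∫⁻ σ, jb σ ^ (-(7 / 8) : ℝ) *
        q.conv q.gainSqrt f (fun i s => jb s ^ (1 / 2 : ℝ) * g i s) i σ ^ 2)) := by
    intro i
    have n0 := m0 i
    have n1 := m1 i
    have n2 := m2 i
    calc _ ≤ (∫⁻ σ, (2 * q.conv q.gainOut f g i σ + (2 * ((jb σ)⁻¹ *
          q.conv q.gainSqrt (fun i s => jb s ^ (1 / 2 : ℝ) * f i s) g i σ) + 2 * ((jb σ)⁻¹ *
          q.conv q.gainSqrt f (fun i s => jb s ^ (1 / 2 : ℝ) * g i s) i σ)))) ^ 2 := by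
          gcongr with σ
          refine (mul_le_mul' le_rfl (absForm_le' hf hg i σ)).trans_eq ?_
          have e1 := ENNReal.inv_mul_cancel (jb_ne_zero σ) (jb_ne_top σ)
          rw [mul_add, mul_add]
          congr 1
          · calc _ = ((jb σ)⁻¹ * jb σ) * (2 * q.conv q.gainOut f g i σ) := by ring
              _ = _ := by rw [e1, one_mul]
          · congr 1 <;> ring
      _ = (2 * (∫⁻ σ, q.conv q.gainOut f g i σ) + (2 * (∫⁻ σ, (jb σ)⁻¹ *
          q.conv q.gainSqrt (fun i s => jb s ^ (1 / 2 : ℝ) * f i s) g i σ) + 2 * ∫⁻ σ, (jb σ)⁻¹ *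
          q.conv q.gainSqrt f (fun i s => jb s ^ (1 / 2 : ℝ) * g i s) i σ)) ^ 2 := by
          rw [lintegral_add_left (by fun_prop), lintegral_add_left (by fun_prop),
            lintegral_const_mul' _ _ (by simp), lintegral_const_mul' _ _ (by simp),
            lintegral_const_mul' _ _ (by simp)]
      _ ≤ 2 * (2 * (∫⁻ σ, q.conv q.gainOut f g i σ)) ^ 2 + 2 * (2 * (2 * (∫⁻ σ, (jb σ)⁻¹ *
          q.conv q.gainSqrt (fun i s => jb s ^ (1 / 2 : ℝ) * f i s) g i σ)) ^ 2 +
          2 * (2 * ∫⁻ σ, (jb σ)⁻¹ *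
          q.conv q.gainSqrt f (fun i s => jb s ^ (1 / 2 : ℝ) * g i s) i σ) ^ 2) := by
          refine (add_sq_le _ _).trans ?_
          gcongr
          exact add_sq_le _ _
      _ = 8 * (∫⁻ σ, q.conv q.gainOut f g i σ) ^ 2 + (16 * (∫⁻ σ, (jb σ)⁻¹ *
          q.conv q.gainSqrt (fun i s => jb s ^ (1 / 2 : ℝ) * f i s) g i σ) ^ 2 +
          16 * (∫⁻ σ, (jb σ)⁻¹ *
          q.conv q.gainSqrt f (fun i s => jb s ^ (1 / 2 : ℝ) * g i s) i σ) ^ 2) := by ring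
      _ ≤ _ := by
          gcongr
          · exact sq_lintegral_jb_inv_le n1
          · exact sq_lintegral_jb_inv_le n2
  calc _ ≤ ∑' i, (8 * (∫⁻ σ, q.conv q.gainOut f g i σ) ^ 2 +
      (16 * (jbMass * ∫⁻ σ, jb σ ^ (-(7 / 8) : ℝ) *
        q.conv q.gainSqrt (fun i s => jb s ^ (1 / 2 : ℝ) * f i s) g i σ ^ 2) +
      16 * (jbMass * ∫⁻ σ, jb σ ^ (-(7 / 8) : ℝ) *
        q.conv q.gainSqrt f (fun i s => jb s ^ (1 / 2 : ℝ) * g i s) i σ ^ 2))) :=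
        ENNReal.tsum_le_tsum key
    _ = 8 * ∑' i, (∫⁻ σ, q.conv q.gainOut f g i σ) ^ 2 +
      (16 * (jbMass * ∑' i, ∫⁻ σ, jb σ ^ (-(7 / 8) : ℝ) *
        q.conv q.gainSqrt (fun i s => jb s ^ (1 / 2 : ℝ) * f i s) g i σ ^ 2) +
      16 * (jbMass * ∑' i, ∫⁻ σ, jb σ ^ (-(7 / 8) : ℝ) *
        q.conv q.gainSqrt f (fun i s => jb s ^ (1 / 2 : ℝ) * g i s) i σ ^ 2)) := by
        simp_rw [ENNReal.tsum_add, ENNReal.tsum_mul_left]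
    _ ≤ 8 * (ε * (sNorm f * sNorm g)) + (16 * (jbMass * (4 * jbMass * ε * (hNorm f * hNorm g))) +
          16 * (jbMass * (4 * jbMass * ε * (hNorm f * hNorm g)))) := by gcongr
    _ = _ := by ring

/-- The bilinear estimate. -/
theorem Small.zNorm_absForm_le :
    zNorm (fun i σ => (jb σ)⁻¹ * q.absForm f g i σ) ≤ bilConst * ε * (zNorm f * zNorm g) := by
  calc _ ≤ 40 * jbMass * ε * (hNorm f * hNorm g) + (8 * ε * (sNorm f * sNorm g) +
        128 * jbMass ^ 2 * ε * (hNorm f * hNorm g)) :=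
        add_le_add (h.hNorm_absForm_le hf hg) (h.sNorm_absForm_le hf hg)
    _ ≤ 40 * jbMass * ε * (zNorm f * zNorm g) + (8 * ε * (zNorm f * zNorm g) +
        128 * jbMass ^ 2 * ε * (zNorm f * zNorm g)) := by
        have := hNorm_le_zNorm f
        have := hNorm_le_zNorm g
        have := sNorm_le_zNorm f
        have := sNorm_le_zNorm g
        gcongr
    _ = _ := by unfold bilConst; ring

end QSys

end DSW

/-! ### Fourier integrals and cutoff profiles -/

namespace DSW

/-- The Fourier integral `∫ exp(i τ t) γ(τ) dτ`. -/
noncomputable def hat (γ : ℝ → ℂ) (t : ℝ) : ℂ :=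
  ∫ τ : ℝ, Complex.exp (Complex.I * (τ : ℂ) * (t : ℂ)) * γ τ

lemma norm_exp_I_mul (τ t : ℝ) : ‖Complex.exp (Complex.I * (τ : ℂ) * (t : ℂ))‖ = 1 := by
  rw [mul_assoc, mul_comm, ← Complex.ofReal_mul, Complex.norm_exp_ofReal_mul_I]

lemma enorm_exp_I_mul (τ t : ℝ) : ‖Complex.exp (Complex.I * (τ : ℂ) * (t : ℂ))‖ₑ = 1 := by
  rw [← ofReal_norm, norm_exp_I_mul, ENNReal.ofReal_one]

lemma enorm_hat_le (γ : ℝ → ℂ) (t : ℝ) : ‖hat γ t‖ₑ ≤ ∫⁻ τ, ‖γ τ‖ₑ := by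
  refine (enorm_integral_le_lintegral_enorm _).trans_eq ?_
  simp_rw [enorm_mul, enorm_exp_I_mul, one_mul]

lemma integrable_of_enorm {γ : ℝ → ℂ} (hγ : Measurable γ) (h : ∫⁻ τ, ‖γ τ‖ₑ ≠ ⊤) :
    Integrable γ := ⟨hγ.aestronglyMeasurable, h.lt_top⟩

lemma integrable_exp_mul {γ : ℝ → ℂ} (h : Integrable γ) (t : ℝ) :
    Integrable fun τ : ℝ => Complex.exp (Complex.I * (τ : ℂ) * (t : ℂ)) * γ τ :=
  h.bdd_mul (c := 1) (by fun_prop) (Filter.Eventually.of_forall fun τ => (norm_exp_I_mul τ t).le)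

lemma continuous_hat {γ : ℝ → ℂ} (h : Integrable γ) : Continuous (hat γ) := by
  unfold hat
  refine continuous_of_dominated (bound := fun τ => ‖γ τ‖)
    (fun t => (integrable_exp_mul h t).aestronglyMeasurable) (fun t => ?_) h.norm ?_
  · refine Filter.Eventually.of_forall fun τ => ?_
    rw [norm_mul, norm_exp_I_mul, one_mul]
  · refine Filter.Eventually.of_forall fun τ => ?_
    fun_prop

lemma hat_add {γ γ' : ℝ → ℂ} (h : Integrable γ) (h' : Integrable γ') (t : ℝ) :
    hat (fun τ => γ τ + γ' τ) t = hat γ t + hat γ' t := by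
  unfold hat
  rw [← integral_add (integrable_exp_mul h t) (integrable_exp_mul h' t)]
  congr 1; ext τ; ring

lemma hat_sub {γ γ' : ℝ → ℂ} (h : Integrable γ) (h' : Integrable γ') (t : ℝ) :
    hat (fun τ => γ τ - γ' τ) t = hat γ t - hat γ' t := by
  unfold hat
  rw [← integral_sub (integrable_exp_mul h t) (integrable_exp_mul h' t)]
  congr 1; ext τ; ring

lemma hat_const_mul (γ : ℝ → ℂ) (c : ℂ) (t : ℝ) : hat (fun τ => c * γ τ) t = c * hat γ t := by
  unfold hat
  rw [← integral_const_mul]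
  congr 1; ext τ; ring

/-- `r` is an admissible cutoff profile: it is integrable and belongs to `H^{1/2}` in frequency. -/
structure IsProfile (r : ℝ → ℂ) : Prop where
  measurable : Measurable r
  mass : ∫⁻ τ, ‖r τ‖ₑ ≠ ⊤
  energy : ∫⁻ τ, jb τ * ‖r τ‖ₑ ^ 2 ≠ ⊤

/-- The Fourier transform of a compactly supported smooth function equal to the exponential near the
unit interval is a Schwartz function, and Fourier inversion recovers the exponential there. -/
lemma exists_profile (μ : ℝ) :
    ∃ r : ℝ → ℂ, IsProfile r ∧ ∀ t ∈ Icc (0 : ℝ) 1, hat r t = Complex.exp (μ * t) := by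
  let χ : ContDiffBump (0 : ℝ) := ⟨1, 2, by norm_num, by norm_num⟩
  -- The 2π converts between the kernel exp(2πiτy) of Fourier inversion and the kernel exp(iτt) of
  -- `hat`, through y = t/(2π). For t in [0, 1] this y lies in the ball where the bump equals 1.
  let φ : ℝ → ℂ := fun y => (χ y : ℂ) * Complex.exp ((2 * Real.pi * μ : ℝ) * y)
  have hφc : HasCompactSupport φ := by
    refine HasCompactSupport.mul_right ?_
    exact χ.hasCompactSupport.comp_left (g := fun x : ℝ => (x : ℂ)) (by simp)
  have hφs : ContDiff ℝ ∞ φ := by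
    refine ContDiff.mul (Complex.ofRealCLM.contDiff.comp χ.contDiff) ?_
    refine ContDiff.cexp ?_
    exact contDiff_const.mul Complex.ofRealCLM.contDiff
  let S : SchwartzMap ℝ ℂ := hφc.toSchwartzMap hφs
  let R : SchwartzMap ℝ ℂ := FourierTransform.fourier S
  refine ⟨R, ⟨R.continuous.measurable, ?_, ?_⟩, ?_⟩
  · exact (R.integrable).2.ne
  · have h1 : Integrable (fun τ : ℝ => (1 + |τ|) * ‖R τ‖ * (SchwartzMap.seminorm ℝ 0 0 R)) := by
      refine Integrable.mul_const ?_ _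
      have := (R.integrable_pow_mul volume 0).add (R.integrable_pow_mul volume 1)
      refine this.congr (Filter.Eventually.of_forall fun τ => ?_)
      simp only [Pi.add_apply, pow_zero, pow_one, Real.norm_eq_abs]
      ring
    refine ne_top_of_le_ne_top h1.2.ne (lintegral_mono fun τ => ?_)
    have hb : ‖R τ‖ ≤ SchwartzMap.seminorm ℝ 0 0 R := SchwartzMap.norm_le_seminorm ℝ R τ
    have hs : (0 : ℝ) ≤ SchwartzMap.seminorm ℝ 0 0 R := (norm_nonneg _).trans hb
    rw [Real.enorm_eq_ofReal (by positivity), jb, ← ofReal_norm, ← ENNReal.ofReal_pow (by positivity),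
      ← ENNReal.ofReal_mul (by positivity)]
    refine ENNReal.ofReal_le_ofReal ?_
    beta_reduce
    rw [mul_assoc, sq]
    gcongr
  · intro t ht
    have hinv : FourierTransformInv.fourierInv (FourierTransform.fourier (S : ℝ → ℂ)) (t / (2 * Real.pi))
        = S (t / (2 * Real.pi)) := by
      refine congrFun (S.continuous.fourierInv_fourier_eq S.integrable ?_) _
      have : (FourierTransform.fourier (S : ℝ → ℂ)) = R := (SchwartzMap.fourier_coe S).symm
      rw [this]; exact R.integrable
    have hR : FourierTransform.fourier (S : ℝ → ℂ) = R := (SchwartzMap.fourier_coe S).symm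
    rw [hR, Real.fourierInv_eq'] at hinv
    have hpi := Real.pi_pos
    have h1 : hat R t = S (t / (2 * Real.pi)) := by
      rw [← hinv]
      unfold hat
      congr 1
      ext τ
      rw [smul_eq_mul]
      congr 2
      rw [mul_assoc, mul_comm, ← Complex.ofReal_mul]
      congr 2
      simp only [RCLike.inner_apply, conj_trivial]
      field_simp
    rw [h1]
    change φ (t / (2 * Real.pi)) = _
    have h2 : χ (t / (2 * Real.pi)) = 1 := by
      refine χ.one_of_mem_closedBall ?_
      rw [mem_closedBall_zero_iff, Real.norm_eq_abs, abs_of_nonneg (by have := ht.1; positivity)]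
      rw [div_le_iff₀ (by positivity)]
      change t ≤ 1 * _
      have := ht.2
      have := Real.pi_gt_three
      linarith
    simp only [φ, h2]
    rw [Complex.ofReal_one, one_mul]
    congr 1
    push_cast
    have : (Real.pi : ℂ) ≠ 0 := by exact_mod_cast hpi.ne'
    field_simp

/-! ### Multiplication by a cutoff, as convolution in frequency -/

section rconv

variable {ι : Type*}

/-- Convolution with a fixed profile. -/
noncomputable def rconv (r : ℝ → ℝ≥0∞) (f : ι → ℝ → ℝ≥0∞) (i : ι) (σ : ℝ) : ℝ≥0∞ :=
  ∫⁻ s, r s * f i (σ - s)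

/-- The squared homogeneous norm `∑_i ∫ |τ| f_i(τ)² dτ`. -/
noncomputable def dNorm (f : ι → ℝ → ℝ≥0∞) : ℝ≥0∞ := ∑' i, ∫⁻ s, ENNReal.ofReal |s| * f i s ^ 2

lemma dNorm_le_hNorm (f : ι → ℝ → ℝ≥0∞) : dNorm f ≤ hNorm f := by
  unfold dNorm hNorm jb
  gcongr with i s
  linarith

lemma lintegral_rconv {r f : ℝ → ℝ≥0∞} (hr : Measurable r) (hf : Measurable f) :
    ∫⁻ σ, ∫⁻ s, r s * f (σ - s) = (∫⁻ s, r s) * ∫⁻ s, f s := by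
  simpa using QSys.lintegral_conv_eq hr hf 0

lemma sNorm_rconv {r : ℝ → ℝ≥0∞} (hr : Measurable r) {f : ι → ℝ → ℝ≥0∞}
    (hf : ∀ i, Measurable (f i)) : sNorm (rconv r f) = (∫⁻ s, r s) ^ 2 * sNorm f := by
  unfold sNorm rconv
  rw [← ENNReal.tsum_mul_left]
  refine tsum_congr fun i => ?_
  rw [lintegral_rconv hr (hf i), mul_pow]

/-- From ⟨σ⟩ ≤ ⟨s⟩ + |σ - s|: either the profile takes the weight and `f` is used in L¹, or `f`
takes it and the profile is used in L¹. Only the homogeneous weight ever falls on `f`, which makes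
the bound uniform under dilations of `f`. -/
lemma hNorm_rconv_le {r : ℝ → ℝ≥0∞} (hr : Measurable r) {f : ι → ℝ → ℝ≥0∞}
    (hf : ∀ i, Measurable (f i)) :
    hNorm (rconv r f) ≤ 2 * (∫⁻ s, jb s * r s ^ 2) * sNorm f + 2 * (∫⁻ s, r s) ^ 2 * dNorm f := by
  have key : ∀ i σ, jb σ * rconv r f i σ ^ 2 ≤
      2 * ((∫⁻ s, f i s) * ∫⁻ s, (jb s * r s ^ 2) * f i (σ - s)) +
      2 * ((∫⁻ s, r s) * ∫⁻ s, r s * (ENNReal.ofReal |σ - s| * f i (σ - s) ^ 2)) := by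
    intro i σ
    have hfi := hf i
    have h1 : jb σ ^ (1 / 2 : ℝ) * rconv r f i σ ≤
        (∫⁻ s, f i (σ - s) ^ (1 / 2 : ℝ) * (jb s ^ (1 / 2 : ℝ) * r s * f i (σ - s) ^ (1 / 2 : ℝ))) +
        ∫⁻ s, r s ^ (1 / 2 : ℝ) *
          (r s ^ (1 / 2 : ℝ) * (ENNReal.ofReal |σ - s| ^ (1 / 2 : ℝ) * f i (σ - s))) := by
      unfold rconv
      rw [← lintegral_const_mul _ (by fun_prop), ← lintegral_add_left (by fun_prop)]
      refine lintegral_mono fun s => ?_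
      have hj : jb σ ^ (1 / 2 : ℝ) ≤ jb s ^ (1 / 2 : ℝ) + ENNReal.ofReal |σ - s| ^ (1 / 2 : ℝ) := by
        refine le_trans ?_ (QSys.sqrt_add_le _ _)
        refine ENNReal.rpow_le_rpow ?_ (by norm_num)
        rw [jb, jb, ← ENNReal.ofReal_add (by positivity) (by positivity)]
        refine ENNReal.ofReal_le_ofReal ?_
        have := abs_add_le s (σ - s)
        rw [add_sub_cancel] at this
        linarith
      have e1 : ∀ x : ℝ≥0∞, x ^ (1 / 2 : ℝ) * x ^ (1 / 2 : ℝ) = x := fun x => by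
        rw [← sq, sqrt_sq]
      calc _ ≤ (jb s ^ (1 / 2 : ℝ) + ENNReal.ofReal |σ - s| ^ (1 / 2 : ℝ)) *
            (r s * f i (σ - s)) := by gcongr
        _ = jb s ^ (1 / 2 : ℝ) * r s * (f i (σ - s) ^ (1 / 2 : ℝ) * f i (σ - s) ^ (1 / 2 : ℝ)) +
            (r s ^ (1 / 2 : ℝ) * r s ^ (1 / 2 : ℝ)) *
              (ENNReal.ofReal |σ - s| ^ (1 / 2 : ℝ) * f i (σ - s)) := by
            rw [e1, e1]; ring
        _ = _ := by ring
    calc jb σ * rconv r f i σ ^ 2 = (jb σ ^ (1 / 2 : ℝ) * rconv r f i σ) ^ 2 := by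
          rw [mul_pow, sqrt_sq]
      _ ≤ _ := by
        refine (pow_le_pow_left' h1 2).trans ((add_sq_le _ _).trans ?_)
        gcongr
        · refine (sq_lintegral_mul_le _ (by fun_prop) (by fun_prop)).trans_eq ?_
          simp_rw [mul_pow, sqrt_sq]
          rw [lintegral_sub_left_eq_self (f i) σ]
        · refine (sq_lintegral_mul_le _ (by fun_prop) (by fun_prop)).trans_eq ?_
          simp_rw [mul_pow, sqrt_sq]
  unfold hNorm
  calc _ ≤ ∑' i, ∫⁻ σ, (2 * ((∫⁻ s, f i s) * ∫⁻ s, (jb s * r s ^ 2) * f i (σ - s)) +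
      2 * ((∫⁻ s, r s) * ∫⁻ s, r s * (ENNReal.ofReal |σ - s| * f i (σ - s) ^ 2))) :=
        ENNReal.tsum_le_tsum fun i => lintegral_mono fun σ => key i σ
    _ = ∑' i, (2 * (∫⁻ s, jb s * r s ^ 2) * (∫⁻ s, f i s) ^ 2 +
        2 * (∫⁻ s, r s) ^ 2 * ∫⁻ s, ENNReal.ofReal |s| * f i s ^ 2) := by
        refine tsum_congr fun i => ?_
        have hfi := hf i
        have m1 : Measurable fun σ => ∫⁻ s, (jb s * r s ^ 2) * f i (σ - s) :=
          Measurable.lintegral_prod_right' (f := fun p : ℝ × ℝ =>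
            (jb p.2 * r p.2 ^ 2) * f i (p.1 - p.2)) (by fun_prop)
        have m2 : Measurable fun σ => ∫⁻ s, r s * (ENNReal.ofReal |σ - s| * f i (σ - s) ^ 2) :=
          Measurable.lintegral_prod_right' (f := fun p : ℝ × ℝ =>
            r p.2 * (ENNReal.ofReal |p.1 - p.2| * f i (p.1 - p.2) ^ 2)) (by fun_prop)
        rw [lintegral_add_left (by fun_prop), lintegral_const_mul _ (by fun_prop),
          lintegral_const_mul _ m1, lintegral_const_mul _ (by fun_prop), lintegral_const_mul _ m2,
          lintegral_rconv (r := fun s => jb s * r s ^ 2) (by fun_prop) hfi,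
          lintegral_rconv (f := fun s => ENNReal.ofReal |s| * f i s ^ 2) hr (by fun_prop)]
        ring
    _ = _ := by
        rw [ENNReal.tsum_add, ENNReal.tsum_mul_left, ENNReal.tsum_mul_left]
        rfl

/-- The constant in the estimate of the multiplication by a cutoff. -/
noncomputable def profConst (r : ℝ → ℂ) : ℝ≥0∞ :=
  2 * (∫⁻ s, jb s * ‖r s‖ₑ ^ 2) + 3 * (∫⁻ s, ‖r s‖ₑ) ^ 2

lemma IsProfile.profConst_ne_top {r : ℝ → ℂ} (hr : IsProfile r) : profConst r ≠ ⊤ := by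
  unfold profConst
  have := hr.mass
  have := hr.energy
  finiteness

lemma zNorm_rconv_le {r : ℝ → ℂ} (hr : Measurable r) {f : ι → ℝ → ℝ≥0∞}
    (hf : ∀ i, Measurable (f i)) :
    zNorm (rconv (fun s => ‖r s‖ₑ) f) ≤ profConst r * (dNorm f + sNorm f) := by
  have hr' : Measurable fun s => ‖r s‖ₑ := hr.enorm
  unfold zNorm
  rw [sNorm_rconv hr' hf]
  refine (add_le_add_left (hNorm_rconv_le hr' hf) _).trans ?_
  unfold profConst
  set A := ∫⁻ s, jb s * ‖r s‖ₑ ^ 2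
  set B := (∫⁻ s, ‖r s‖ₑ) ^ 2
  calc 2 * A * sNorm f + 2 * B * dNorm f + B * sNorm f
      ≤ 2 * A * sNorm f + 2 * B * dNorm f + B * sNorm f +
        (2 * A * dNorm f + B * dNorm f + 2 * B * sNorm f) := le_self_add
    _ = _ := by ring

lemma zNorm_const_mul_profile (c : ι → ℝ≥0∞) {r : ℝ → ℂ} (hr : Measurable r) :
    zNorm (fun i s => c i * ‖r s‖ₑ) ≤ profConst r * ∑' i, c i ^ 2 := by
  have hr' : Measurable fun s => ‖r s‖ₑ := hr.enorm
  unfold zNorm hNorm sNorm profConst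
  have h1 : ∑' i, ∫⁻ s, jb s * (c i * ‖r s‖ₑ) ^ 2 =
      (∫⁻ s, jb s * ‖r s‖ₑ ^ 2) * ∑' i, c i ^ 2 := by
    rw [← ENNReal.tsum_mul_left]
    refine tsum_congr fun i => ?_
    rw [mul_comm, ← lintegral_const_mul _ (by fun_prop)]
    refine lintegral_congr fun s => ?_
    ring
  have h2 : ∑' i, (∫⁻ s, c i * ‖r s‖ₑ) ^ 2 = (∫⁻ s, ‖r s‖ₑ) ^ 2 * ∑' i, c i ^ 2 := by
    rw [← ENNReal.tsum_mul_left]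
    refine tsum_congr fun i => ?_
    rw [lintegral_const_mul _ (by fun_prop), mul_pow, mul_comm]
  rw [h1, h2, ← add_mul]
  gcongr
  · exact le_mul_of_one_le_left' (by norm_num)
  · exact le_mul_of_one_le_left' (by norm_num)

end rconv

end DSW

/-! ### The nonlinearity and the Duhamel integral in frequency variables -/

namespace DSW

variable {ι E : Type*}

/-- Pointwise absolute values. -/
noncomputable def en (γ : ι → ℝ → ℂ) : ι → ℝ → ℝ≥0∞ := fun i s => ‖γ i s‖ₑ

lemma measurable_en {γ : ι → ℝ → ℂ} (h : ∀ i, Measurable (γ i)) (i : ι) : Measurable (en γ i) :=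
  (h i).enorm

lemma lintegral_enorm_ne_top {γ : ι → ℝ → ℂ} (h : zNorm (en γ) ≠ ⊤) (i : ι) :
    ∫⁻ s, ‖γ i s‖ₑ ≠ ⊤ := by
  intro hi
  apply h
  refine top_le_iff.1 (le_trans ?_ (sNorm_le_zNorm _))
  refine le_trans ?_ (ENNReal.le_tsum i)
  simp [en, hi]

lemma integrable_of_zNorm {γ : ι → ℝ → ℂ} (hm : ∀ i, Measurable (γ i)) (h : zNorm (en γ) ≠ ⊤)
    (i : ι) : Integrable (γ i) := integrable_of_enorm (hm i) (lintegral_enorm_ne_top h i)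

/-- Evaluation at a fixed time is bounded by the ℓ²L¹ part of the norm; the X^{0,1/2} part alone
would not control it. -/
lemma tsum_sq_hat_le (γ : ι → ℝ → ℂ) (t : ℝ) : ∑' i, ‖hat (γ i) t‖ₑ ^ 2 ≤ zNorm (en γ) := by
  refine le_trans ?_ (sNorm_le_zNorm _)
  unfold sNorm en
  gcongr with i
  exact enorm_hat_le _ _

/-- Convolution of a family with a fixed profile. -/
noncomputable def cconv (r : ℝ → ℂ) (γ : ι → ℝ → ℂ) (i : ι) (σ : ℝ) : ℂ :=
  ∫ s, r s * γ i (σ - s)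

lemma measurable_cconv {r : ℝ → ℂ} (hr : Measurable r) {γ : ι → ℝ → ℂ}
    (hγ : ∀ i, Measurable (γ i)) (i : ι) : Measurable (cconv r γ i) := by
  have h := hγ i
  have : StronglyMeasurable fun p : ℝ × ℝ => r p.2 * γ i (p.1 - p.2) :=
    (show Measurable fun p : ℝ × ℝ => r p.2 * γ i (p.1 - p.2) by fun_prop).stronglyMeasurable
  exact this.integral_prod_right'.measurable

lemma en_cconv_le (r : ℝ → ℂ) (γ : ι → ℝ → ℂ) (i : ι) (σ : ℝ) :
    en (cconv r γ) i σ ≤ rconv (fun s => ‖r s‖ₑ) (en γ) i σ := by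
  unfold en cconv rconv
  refine (enorm_integral_le_lintegral_enorm _).trans_eq ?_
  simp_rw [enorm_mul]

lemma zNorm_cconv_le {r : ℝ → ℂ} (hr : Measurable r) {γ : ι → ℝ → ℂ}
    (hγ : ∀ i, Measurable (γ i)) :
    zNorm (en (cconv r γ)) ≤ profConst r * (dNorm (en γ) + sNorm (en γ)) :=
  (zNorm_mono (en_cconv_le r γ)).trans (zNorm_rconv_le hr (measurable_en hγ))

lemma zNorm_cconv_le' {r : ℝ → ℂ} (hr : Measurable r) {γ : ι → ℝ → ℂ}
    (hγ : ∀ i, Measurable (γ i)) :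
    zNorm (en (cconv r γ)) ≤ profConst r * zNorm (en γ) := by
  refine (zNorm_cconv_le hr hγ).trans ?_
  unfold zNorm
  gcongr
  exact dNorm_le_hNorm _

/-- Fubini: convolution becomes a product, and the translation by `c` becomes the oscillating factor
of an interaction with phase `c`. -/
lemma hat_conv {f g : ℝ → ℂ} (hf : Integrable f) (hg : Integrable g) (c t : ℝ) :
    hat (fun σ => ∫ s, f s * g (σ - s - c)) t =
      Complex.exp (Complex.I * (c : ℂ) * (t : ℂ)) * (hat f t * hat g t) := by
  have hprod : Integrable (fun p : ℝ × ℝ => f p.2 * g (p.1 - p.2 - c)) (volume.prod volume) := by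
    have h1 := hf.convolution_integrand (ContinuousLinearMap.mul ℂ ℂ) (hg.comp_sub_right c)
      (μ := volume) (ν := volume)
    exact h1
  unfold hat
  have e1 : ∀ σ : ℝ, Complex.exp (Complex.I * (σ : ℂ) * (t : ℂ)) * ∫ s, f s * g (σ - s - c) =
      ∫ s, Complex.exp (Complex.I * (σ : ℂ) * (t : ℂ)) * (f s * g (σ - s - c)) := fun σ => by
    rw [integral_const_mul]
  simp_rw [e1]
  rw [integral_integral_swap]
  · have e2 : ∀ s : ℝ, ∫ σ : ℝ, Complex.exp (Complex.I * (σ : ℂ) * (t : ℂ)) * (f s * g (σ - s - c)) =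
        Complex.exp (Complex.I * (c : ℂ) * (t : ℂ)) * (Complex.exp (Complex.I * (s : ℂ) * (t : ℂ)) *
          f s) * ∫ σ : ℝ, Complex.exp (Complex.I * (σ : ℂ) * (t : ℂ)) * g σ := by
      intro s
      rw [← integral_const_mul, ← integral_sub_right_eq_self
        (fun σ : ℝ => _ * (Complex.exp (Complex.I * (σ : ℂ) * (t : ℂ)) * g σ)) (s + c)]
      congr 1
      ext σ
      rw [show σ - s - c = σ - (s + c) by ring]
      have : Complex.exp (Complex.I * (σ : ℂ) * (t : ℂ)) =
          Complex.exp (Complex.I * (c : ℂ) * (t : ℂ)) * Complex.exp (Complex.I * (s : ℂ) * (t : ℂ)) *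
          Complex.exp (Complex.I * ((σ - (s + c) : ℝ) : ℂ) * (t : ℂ)) := by
        rw [← Complex.exp_add, ← Complex.exp_add]
        congr 1
        push_cast
        ring
      rw [this]
      ring
    simp_rw [e2]
    rw [integral_mul_const, integral_const_mul]
    ring
  · refine hprod.bdd_mul (c := 1) (by fun_prop) (Filter.Eventually.of_forall fun p => ?_)
    exact (norm_exp_I_mul p.1 t).le

lemma hat_cconv {r : ℝ → ℂ} (hr : Integrable r) {γ : ι → ℝ → ℂ} {i : ι} (hγ : Integrable (γ i))
    (t : ℝ) : hat (cconv r γ i) t = hat r t * hat (γ i) t := by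
  have := hat_conv hr hγ 0 t
  simp only [sub_zero, Complex.ofReal_zero, mul_zero, zero_mul, Complex.exp_zero, one_mul] at this
  exact this

namespace QSys

variable (q : QSys ι E)

/-- The quadratic nonlinearity in frequency variables. -/
noncomputable def form (γ γ' : ι → ℝ → ℂ) (i : ι) (σ : ℝ) : ℂ :=
  ∑' e : q.out ⁻¹' {i}, q.M e * ∫ s, γ (q.inl e) s * γ' (q.inr e) (σ - s - q.Φ e)

/-- The quadratic nonlinearity in the time variable. -/
noncomputable def rhs (a a' : ι → ℝ → ℂ) (i : ι) (s : ℝ) : ℂ :=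
  ∑' e : q.out ⁻¹' {i}, q.M e * Complex.exp (Complex.I * (q.Φ e : ℂ) * (s : ℂ)) *
    (a (q.inl e) s * a' (q.inr e) s)

/-- The time integral of the nonlinearity. -/
noncomputable def duh (a a' : ι → ℝ → ℂ) (i : ι) (t : ℝ) : ℂ := ∫ s in (0 : ℝ)..t, q.rhs a a' i s

variable {q} {ε : ℝ≥0∞}

lemma en_form_le (γ γ' : ι → ℝ → ℂ) (i : ι) (σ : ℝ) :
    en (q.form γ γ') i σ ≤ q.absForm (en γ) (en γ') i σ := by
  unfold en form absForm conv
  refine enorm_tsum_le_tsum_enorm.trans ?_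
  gcongr with e
  rw [enorm_mul]
  gcongr
  refine (enorm_integral_le_lintegral_enorm _).trans_eq ?_
  simp_rw [enorm_mul]

lemma measurable_conv_integral {f g : ℝ → ℂ} (hf : Measurable f) (hg : Measurable g) (c : ℝ) :
    Measurable fun σ => ∫ s, f s * g (σ - s - c) := by
  have : StronglyMeasurable fun p : ℝ × ℝ => f p.2 * g (p.1 - p.2 - c) :=
    (show Measurable fun p : ℝ × ℝ => f p.2 * g (p.1 - p.2 - c) by fun_prop).stronglyMeasurable
  exact this.integral_prod_right'.measurable

lemma measurable_form [Countable E] {γ γ' : ι → ℝ → ℂ} (h : ∀ i, Measurable (γ i))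
    (h' : ∀ i, Measurable (γ' i)) (i : ι) : Measurable (q.form γ γ' i) := by
  unfold form
  exact Measurable.tsum fun e => (measurable_conv_integral (h _) (h' _) _).const_mul _

lemma enorm_M_le_of_bdd {i : ι} {m : ℝ} (hm : ∀ e, q.out e = i → ‖q.M e‖ ≤ m)
    (e : q.out ⁻¹' {i}) : ‖q.M e‖ₑ ≤ ENNReal.ofReal m := by
  rw [← ofReal_norm]
  exact ENNReal.ofReal_le_ofReal (hm e e.2)

/-- Square summable inputs give absolutely summable interactions for a fixed output. -/
lemma Small.tsum_fiber_ne_top (h : q.Small ε) {x y : ι → ℝ≥0∞} (hx : ∑' i, x i ^ 2 ≠ ⊤)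
    (hy : ∑' i, y i ^ 2 ≠ ⊤) (i : ι) :
    ∑' e : q.out ⁻¹' {i}, ‖q.M e‖ₑ * (x (q.inl e) * y (q.inr e)) ≠ ⊤ := by
  obtain ⟨m, hm⟩ := h.bdd i
  have h1 : (∑' e : q.out ⁻¹' {i}, x (q.inl e) * y (q.inr e)) ^ 2 ≠ ⊤ := by
    refine ne_top_of_le_ne_top ?_ (sq_tsum_mul_le _ _)
    refine ENNReal.mul_ne_top ?_ ?_
    · exact ne_top_of_le_ne_top hx (tsum_fiber_le h.inj_outl (fun j => x j ^ 2) i)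
    · exact ne_top_of_le_ne_top hy (tsum_fiber_le h.inj_outr (fun j => y j ^ 2) i)
  have h2 : ∑' e : q.out ⁻¹' {i}, x (q.inl e) * y (q.inr e) ≠ ⊤ := by
    intro hh; simp [hh] at h1
  refine ne_top_of_le_ne_top (ENNReal.mul_ne_top (ENNReal.ofReal_ne_top (r := m)) h2) ?_
  rw [← ENNReal.tsum_mul_left]
  gcongr with e
  exact enorm_M_le_of_bdd hm e

section form

variable (h : q.Small ε) {γ γ' : ι → ℝ → ℂ} (hm : ∀ i, Measurable (γ i))
  (hm' : ∀ i, Measurable (γ' i)) (hz : zNorm (en γ) ≠ ⊤) (hz' : zNorm (en γ') ≠ ⊤)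

include h hm hm' hz hz'

lemma Small.tsum_lintegral_form_ne_top (i : ι) :
    ∑' e : q.out ⁻¹' {i}, ∫⁻ σ, ‖q.M e * ∫ s, γ (q.inl e) s * γ' (q.inr e) (σ - s - q.Φ e)‖ₑ
      ≠ ⊤ := by
  have hs : ∑' i, (∫⁻ s, ‖γ i s‖ₑ) ^ 2 ≠ ⊤ := ne_top_of_le_ne_top hz (sNorm_le_zNorm _)
  have hs' : ∑' i, (∫⁻ s, ‖γ' i s‖ₑ) ^ 2 ≠ ⊤ := ne_top_of_le_ne_top hz' (sNorm_le_zNorm _)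
  refine ne_top_of_le_ne_top (h.tsum_fiber_ne_top hs hs' i) ?_
  refine ENNReal.tsum_le_tsum fun e => ?_
  simp_rw [enorm_mul]
  rw [lintegral_const_mul _ (measurable_conv_integral (hm _) (hm' _) _).enorm]
  gcongr
  rw [← lintegral_conv_eq (hm _).enorm (hm' _).enorm (q.Φ e)]
  gcongr with σ
  refine (enorm_integral_le_lintegral_enorm _).trans_eq ?_
  simp_rw [enorm_mul]

lemma Small.integrable_form [Countable E] (i : ι) : Integrable (q.form γ γ' i) := by
  refine integrable_of_enorm (measurable_form hm hm' i) ?_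
  refine ne_top_of_le_ne_top (h.tsum_lintegral_form_ne_top hm hm' hz hz' i) ?_
  rw [← lintegral_tsum fun e =>
    ((measurable_conv_integral (hm _) (hm' _) _).const_mul _).enorm.aemeasurable]
  gcongr with σ
  exact enorm_tsum_le_tsum_enorm

/-- Termwise `hat_conv`. The ℓ²L¹ bounds make the series of integrals absolutely convergent for each
output, which allows summation and integration to be exchanged. -/
lemma Small.hat_form [Countable E] (i : ι) (t : ℝ) :
    hat (q.form γ γ' i) t = q.rhs (fun i => hat (γ i)) (fun i => hat (γ' i)) i t := by
  have e1 : hat (q.form γ γ' i) t = ∫ σ : ℝ, ∑' e : q.out ⁻¹' {i},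
      Complex.exp (Complex.I * (σ : ℂ) * (t : ℂ)) *
        (q.M e * ∫ s, γ (q.inl e) s * γ' (q.inr e) (σ - s - q.Φ e)) := by
    unfold hat form
    congr 1
    ext σ
    rw [tsum_mul_left]
  rw [e1, integral_tsum]
  · unfold rhs
    refine tsum_congr fun e => ?_
    have := hat_const_mul (fun σ => ∫ s, γ (q.inl e) s * γ' (q.inr e) (σ - s - q.Φ e)) (q.M e) t
    unfold hat at this
    rw [this]
    have h2 := hat_conv (integrable_of_zNorm hm hz (q.inl e)) (integrable_of_zNorm hm' hz' (q.inr e))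
      (q.Φ e) t
    unfold hat at h2
    rw [h2]
    unfold hat
    ring
  · intro e
    refine Measurable.aestronglyMeasurable ?_
    have := measurable_conv_integral (hm (q.inl e)) (hm' (q.inr e)) (q.Φ e)
    fun_prop
  · simp_rw [enorm_mul _ (q.M _ * _), enorm_exp_I_mul, one_mul]
    exact h.tsum_lintegral_form_ne_top hm hm' hz hz' i

end form

end QSys

/-- Solving `c' + c = f` with zero data: the frequency side of
`f ↦ ∫_0^t exp(-(t - s)) f(s) ds` for `t ∈ [0, 1]`, where `r` is a profile with
`hat r t = exp (-t)` there. -/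
noncomputable def damp (r : ℝ → ℂ) (F : ℝ → ℂ) (σ : ℝ) : ℂ :=
  F σ / (1 + Complex.I * σ) - (∫ τ : ℝ, F τ / (1 + Complex.I * τ)) * r σ

lemma one_add_I_mul_ne_zero (σ : ℝ) : (1 + Complex.I * (σ : ℂ)) ≠ 0 := by
  intro h
  have := congrArg Complex.re h
  simp at this

lemma norm_inv_one_add_le (σ : ℝ) : ‖(1 + Complex.I * (σ : ℂ))⁻¹‖ ≤ 2 * (1 + |σ|)⁻¹ := by
  rw [norm_inv]
  have h1 : 1 + |σ| ≤ 2 * ‖1 + Complex.I * (σ : ℂ)‖ := by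
    have a := Complex.abs_re_le_norm (1 + Complex.I * (σ : ℂ))
    have b := Complex.abs_im_le_norm (1 + Complex.I * (σ : ℂ))
    simp at a b
    linarith
  have h0 : 0 < ‖1 + Complex.I * (σ : ℂ)‖ := norm_pos_iff.2 (one_add_I_mul_ne_zero σ)
  rw [← div_eq_mul_inv, le_div_iff₀ (by positivity), inv_mul_le_iff₀ h0]
  linarith

lemma enorm_div_one_add_le (z : ℂ) (σ : ℝ) :
    ‖z / (1 + Complex.I * (σ : ℂ))‖ₑ ≤ 2 * ((jb σ)⁻¹ * ‖z‖ₑ) := by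
  rw [div_eq_mul_inv, enorm_mul, mul_comm, ← mul_assoc]
  gcongr
  rw [← ofReal_norm, jb, ← ENNReal.ofReal_inv_of_pos (by positivity),
    show (2 : ℝ≥0∞) = ENNReal.ofReal 2 by simp, ← ENNReal.ofReal_mul (by norm_num)]
  exact ENNReal.ofReal_le_ofReal (norm_inv_one_add_le σ)

lemma integrable_div_one_add {F : ℝ → ℂ} (hF : Integrable F) :
    Integrable fun σ : ℝ => F σ / (1 + Complex.I * σ) := by
  simp_rw [div_eq_mul_inv]
  refine hF.mul_bdd (c := 2) (by fun_prop) (Filter.Eventually.of_forall fun σ => ?_)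
  refine (norm_inv_one_add_le σ).trans ?_
  have : (1 + |σ|)⁻¹ ≤ 1 := inv_le_one_of_one_le₀ (by linarith [abs_nonneg σ])
  linarith

/-- On the Fourier side the Duhamel integral is the superposition of (e^{(1+iσ)t} - 1)/(1+iσ) F(σ).
The first exponential gives the division by 1 + iσ in `damp`; the -1 gives the homogeneous solution
e^{-t}, realised by the profile `r`. -/
lemma exp_mul_hat_damp {r F : ℝ → ℂ} (hr : Integrable r) (hF : Integrable F) {t : ℝ}
    (ht : hat r t = Complex.exp (-t)) :
    Complex.exp t * hat (damp r F) t = ∫ s in (0 : ℝ)..t, Complex.exp s * hat F s := by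
  have h1 : hat (damp r F) t = hat (fun σ : ℝ => F σ / (1 + Complex.I * σ)) t -
      (∫ τ : ℝ, F τ / (1 + Complex.I * τ)) * Complex.exp (-t) := by
    unfold damp
    rw [hat_sub (integrable_div_one_add hF) (hr.const_mul _), hat_const_mul, ht]
  have h2 : Complex.exp t * hat (damp r F) t = ∫ σ : ℝ,
      (Complex.exp ((1 + Complex.I * σ) * t) - 1) / (1 + Complex.I * σ) * F σ := by
    rw [h1, mul_sub, mul_left_comm, ← Complex.exp_add]
    simp only [add_neg_cancel, Complex.exp_zero, mul_one]
    unfold hat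
    rw [← integral_const_mul, ← integral_sub]
    · congr 1
      ext σ
      rw [show (1 + Complex.I * (σ : ℂ)) * t = t + Complex.I * σ * t by ring, Complex.exp_add]
      ring
    · exact (integrable_exp_mul (integrable_div_one_add hF) t).const_mul _
    · exact integrable_div_one_add hF
  -- The quotient is ∫₀ᵗ e^{(1+iσ)s} ds; what remains is Fubini on the bounded interval from 0 to t.
  have h3 : ∀ σ : ℝ, (Complex.exp ((1 + Complex.I * σ) * t) - 1) / (1 + Complex.I * σ) * F σ =
      ∫ s in (0 : ℝ)..t, Complex.exp s * (Complex.exp (Complex.I * σ * s) * F σ) := by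
    intro σ
    have := integral_exp_mul_complex (a := 0) (b := t) (one_add_I_mul_ne_zero σ)
    simp only [Complex.ofReal_zero, mul_zero, Complex.exp_zero] at this
    rw [← this, ← intervalIntegral.integral_mul_const]
    refine intervalIntegral.integral_congr fun s _ => ?_
    rw [← mul_assoc, ← Complex.exp_add]
    congr 2
    ring
  rw [h2]
  simp_rw [h3]
  rw [← intervalIntegral_integral_swap]
  · refine intervalIntegral.integral_congr fun s _ => ?_
    rw [integral_const_mul]
    rfl
  · have hi : Integrable (fun p : ℝ × ℝ => (1 : ℂ) * F p.2)
        ((volume.restrict (Set.uIoc 0 t)).prod volume) := by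
      refine Integrable.mul_prod (f := fun _ : ℝ => (1 : ℂ)) (g := F) ?_ hF
      have : IsFiniteMeasure (volume.restrict (Set.uIoc 0 t)) := ⟨by simp [Set.uIoc]⟩
      exact integrable_const _
    simp only [one_mul] at hi
    have hre : ∀ᵐ p : ℝ × ℝ ∂((volume.restrict (Set.uIoc 0 t)).prod volume),
        ‖Complex.exp (p.1 : ℂ) * Complex.exp (Complex.I * p.2 * p.1)‖ ≤ Real.exp |t| := by
      have : ∀ᵐ p : ℝ × ℝ ∂((volume.restrict (Set.uIoc 0 t)).prod volume), p.1 ∈ Set.uIoc 0 t :=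
        Measure.quasiMeasurePreserving_fst.ae (ae_restrict_mem measurableSet_uIoc)
      filter_upwards [this] with p hp
      rw [norm_mul, norm_exp_I_mul, mul_one, Complex.norm_exp, Complex.ofReal_re]
      refine Real.exp_le_exp.2 ?_
      rw [Set.mem_uIoc] at hp
      rcases hp with hp | hp
      · exact hp.2.trans (le_abs_self t)
      · exact hp.2.trans (abs_nonneg t)
    refine (hi.bdd_mul (c := Real.exp |t|)
      (f := fun p : ℝ × ℝ => Complex.exp (p.1 : ℂ) * Complex.exp (Complex.I * p.2 * p.1))
      (by fun_prop) hre).congr ?_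
    refine Filter.Eventually.of_forall fun p => ?_
    simp only [Function.uncurry]
    ring

end DSW

/-! ### Represented families, the Duhamel operator and stability -/

namespace DSW

variable {ι E : Type*}

/-- A profile equal to `exp t` for `t ∈ [0, 1]`. -/
noncomputable def growthProfile : ℝ → ℂ := (exists_profile 1).choose

/-- A profile equal to `exp (-t)` for `t ∈ [0, 1]`. -/
noncomputable def decayProfile : ℝ → ℂ := (exists_profile (-1)).choose

lemma isProfile_growth : IsProfile growthProfile := (exists_profile 1).choose_spec.1

lemma isProfile_decay : IsProfile decayProfile := (exists_profile (-1)).choose_spec.1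

lemma hat_growth {t : ℝ} (ht : t ∈ Icc (0 : ℝ) 1) : hat growthProfile t = Complex.exp t := by
  have h : hat growthProfile t = Complex.exp ((1 : ℝ) * t) := (exists_profile 1).choose_spec.2 t ht
  simpa using h

lemma hat_decay {t : ℝ} (ht : t ∈ Icc (0 : ℝ) 1) : hat decayProfile t = Complex.exp (-t) := by
  have h : hat decayProfile t = Complex.exp ((-1 : ℝ) * t) :=
    (exists_profile (-1)).choose_spec.2 t ht
  simpa using h

lemma IsProfile.integrable {r : ℝ → ℂ} (h : IsProfile r) : Integrable r :=
  integrable_of_enorm h.measurable h.mass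

/-- `γ` represents `a` on the time interval `[0, 1]`: `a_i(t) = e^t ∫ e^{i τ t} γ_i(τ) dτ`. -/
structure Rep (γ a : ι → ℝ → ℂ) : Prop where
  measurable : ∀ i, Measurable (γ i)
  finite : zNorm (en γ) ≠ ⊤
  eq : ∀ t ∈ Icc (0 : ℝ) 1, ∀ i, a i t = Complex.exp t * hat (γ i) t

lemma zNorm_en_add_le {γ γ' : ι → ℝ → ℂ} (h : ∀ i, Measurable (γ i)) :
    zNorm (en fun i s => γ i s + γ' i s) ≤ 2 * zNorm (en γ) + 2 * zNorm (en γ') :=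
  (zNorm_mono fun i s => enorm_add_le (γ i s) (γ' i s)).trans (zNorm_add_le (measurable_en h))

lemma zNorm_en_neg (γ : ι → ℝ → ℂ) : zNorm (en fun i s => -γ i s) = zNorm (en γ) := by
  unfold en; simp

namespace Rep

variable {γ γ' a a' : ι → ℝ → ℂ}

lemma integrable (h : Rep γ a) (i : ι) : Integrable (γ i) :=
  integrable_of_zNorm h.measurable h.finite i

lemma add (h : Rep γ a) (h' : Rep γ' a') :
    Rep (fun i s => γ i s + γ' i s) (fun i t => a i t + a' i t) where
  measurable i := (h.measurable i).add (h'.measurable i)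
  finite := by
    refine ne_top_of_le_ne_top ?_ (zNorm_en_add_le h.measurable)
    have := h.finite
    have := h'.finite
    finiteness
  eq t ht i := by
    rw [h.eq t ht, h'.eq t ht, hat_add (h.integrable i) (h'.integrable i), mul_add]

lemma neg (h : Rep γ a) : Rep (fun i s => -γ i s) (fun i t => -a i t) where
  measurable i := (h.measurable i).neg
  finite := by rw [zNorm_en_neg]; exact h.finite
  eq t ht i := by
    rw [h.eq t ht]
    have := hat_const_mul (γ i) (-1) t
    simp only [neg_one_mul] at this
    rw [this, mul_neg]

lemma congr (h : Rep γ a) (haa' : ∀ t ∈ Icc (0 : ℝ) 1, ∀ i, a i t = a' i t) : Rep γ a' where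
  measurable := h.measurable
  finite := h.finite
  eq t ht i := by rw [← haa' t ht, h.eq t ht]

lemma const {c : ι → ℂ} (hc : ∑' i, ‖c i‖ₑ ^ 2 ≠ ⊤) :
    Rep (fun i s => c i * decayProfile s) (fun i _ => c i) where
  measurable i := isProfile_decay.measurable.const_mul _
  finite := by
    have h1 := zNorm_const_mul_profile (fun i => ‖c i‖ₑ) isProfile_decay.measurable
    refine ne_top_of_le_ne_top (ENNReal.mul_ne_top isProfile_decay.profConst_ne_top hc)
      (le_trans (le_of_eq ?_) h1)
    unfold en; simp
  eq t ht i := by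
    rw [hat_const_mul, hat_decay ht, mul_left_comm, ← Complex.exp_add]
    simp

lemma zNorm_const_le (c : ι → ℂ) :
    zNorm (en fun i s => c i * decayProfile s) ≤ profConst decayProfile * ∑' i, ‖c i‖ₑ ^ 2 := by
  have h1 := zNorm_const_mul_profile (fun i => ‖c i‖ₑ) isProfile_decay.measurable
  refine (le_of_eq ?_).trans h1
  unfold en; simp

lemma norm_exp_le {t : ℝ} (ht : t ∈ Icc (0 : ℝ) 1) : ‖Complex.exp t‖ₑ ≤ 3 := by
  rw [← ofReal_norm, Complex.norm_exp, Complex.ofReal_re]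
  have : Real.exp t ≤ 3 := (Real.exp_le_exp.2 ht.2).trans (by linarith [Real.exp_one_lt_d9])
  refine (ENNReal.ofReal_le_ofReal this).trans (by simp)

lemma tsum_sq_le (h : Rep γ a) {t : ℝ} (ht : t ∈ Icc (0 : ℝ) 1) :
    ∑' i, ‖a i t‖ₑ ^ 2 ≤ 9 * zNorm (en γ) := by
  calc _ ≤ ∑' i, 9 * ‖hat (γ i) t‖ₑ ^ 2 := by
        gcongr with i
        rw [h.eq t ht, enorm_mul, mul_pow]
        gcongr
        calc _ ≤ (3 : ℝ≥0∞) ^ 2 := by gcongr; exact norm_exp_le ht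
          _ = 9 := by norm_num
    _ ≤ _ := by
        rw [ENNReal.tsum_mul_left]
        gcongr
        exact tsum_sq_hat_le γ t

lemma tsum_sq_ne_top (h : Rep γ a) {t : ℝ} (ht : t ∈ Icc (0 : ℝ) 1) :
    ∑' i, ‖a i t‖ₑ ^ 2 ≠ ⊤ :=
  ne_top_of_le_ne_top (by have := h.finite; finiteness) (h.tsum_sq_le ht)

end Rep

namespace QSys

variable (q : QSys ι E)

/-- The frequency side of the bilinear Duhamel operator. -/
noncomputable def op (γ γ' : ι → ℝ → ℂ) (i : ι) : ℝ → ℂ :=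
  damp decayProfile (q.form (cconv growthProfile γ) γ' i)

/-- The constant in the estimate of the bilinear Duhamel operator. -/
noncomputable def opConst : ℝ≥0∞ :=
  (8 + 8 * profConst decayProfile) * (bilConst * profConst growthProfile)

lemma opConst_ne_top : opConst ≠ ⊤ := by
  unfold opConst
  have := isProfile_decay.profConst_ne_top
  have := isProfile_growth.profConst_ne_top
  have := bilConst_ne_top
  finiteness

variable {q} {ε : ℝ≥0∞}

lemma zNorm_const_mul (c : ℝ≥0∞) {f : ι → ℝ → ℝ≥0∞} (hf : ∀ i, Measurable (f i)) :
    zNorm (fun i s => c * f i s) = c ^ 2 * zNorm f := by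
  unfold zNorm hNorm sNorm
  rw [mul_add, ← ENNReal.tsum_mul_left, ← ENNReal.tsum_mul_left]
  congr 1
  · refine tsum_congr fun i => ?_
    have := hf i
    rw [← lintegral_const_mul _ (by fun_prop)]
    refine lintegral_congr fun s => ?_
    ring
  · refine tsum_congr fun i => ?_
    rw [lintegral_const_mul _ (hf i), mul_pow]

section

variable [Countable E] (h : q.Small ε) {γ γ' : ι → ℝ → ℂ} (hm : ∀ i, Measurable (γ i))
  (hm' : ∀ i, Measurable (γ' i))

include hm hm'

omit hm hm' in
lemma measurable_damp {F : ℝ → ℂ} (hF : Measurable F) : Measurable (damp decayProfile F) := by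
  unfold damp
  have := isProfile_decay.measurable
  fun_prop

lemma measurable_op (i : ι) : Measurable (q.op γ γ' i) :=
  measurable_damp (measurable_form (measurable_cconv isProfile_growth.measurable hm) hm' i)

include h

/-- `damp` is division by 1 + iσ, comparable to ⟨σ⟩, corrected by a multiple of the decay profile.
The coefficient of the correction is an integral over all frequencies, so it is controlled by the
ℓ²L¹ part of the bilinear estimate. -/
lemma Small.zNorm_op_le :
    zNorm (en (q.op γ γ')) ≤ opConst * ε * (zNorm (en γ) * zNorm (en γ')) := by
  have hr := isProfile_decay.measurable
  have hmc := measurable_cconv isProfile_growth.measurable hm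
  set G : ι → ℝ → ℝ≥0∞ := fun i σ => (jb σ)⁻¹ * q.absForm (en (cconv growthProfile γ)) (en γ') i σ
    with hG
  have mG : ∀ i, Measurable (G i) := fun i => by
    have := measurable_conv (q := q) (fun e => ‖q.M e‖ₑ) (measurable_en hmc) (measurable_en hm') i
    have h2 : Measurable (q.absForm (en (cconv growthProfile γ)) (en γ') i) := this
    simp only [hG]
    fun_prop
  have h1 : ∀ i σ, en (q.op γ γ') i σ ≤ 2 * G i σ + (2 * ∫⁻ τ, G i τ) * ‖decayProfile σ‖ₑ := by
    intro i σ
    have hd : ∀ τ : ℝ, ‖q.form (cconv growthProfile γ) γ' i τ / (1 + Complex.I * τ)‖ₑ ≤ 2 * G i τ :=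
      fun τ => (enorm_div_one_add_le _ τ).trans (by
        simp only [hG]; gcongr; exact en_form_le _ _ i τ)
    unfold en op damp
    refine enorm_sub_le.trans ?_
    gcongr
    · exact hd σ
    · rw [enorm_mul]
      gcongr
      refine (enorm_integral_le_lintegral_enorm _).trans ?_
      rw [← lintegral_const_mul _ (mG i)]
      gcongr with τ
      exact hd τ
  have h2 : zNorm G ≤ bilConst * ε * (zNorm (en (cconv growthProfile γ)) * zNorm (en γ')) :=
    h.zNorm_absForm_le (measurable_en hmc) (measurable_en hm')
  have h3 : zNorm (fun i σ => (2 * ∫⁻ τ, G i τ) * ‖decayProfile σ‖ₑ) ≤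
      profConst decayProfile * (4 * zNorm G) := by
    refine (zNorm_const_mul_profile _ hr).trans ?_
    gcongr
    simp_rw [mul_pow]
    rw [ENNReal.tsum_mul_left]
    gcongr
    · norm_num
    · exact sNorm_le_zNorm G
  calc _ ≤ zNorm (fun i σ => 2 * G i σ + (2 * ∫⁻ τ, G i τ) * ‖decayProfile σ‖ₑ) := zNorm_mono h1
    _ ≤ 2 * zNorm (fun i σ => 2 * G i σ) +
        2 * zNorm (fun i σ => (2 * ∫⁻ τ, G i τ) * ‖decayProfile σ‖ₑ) :=
        zNorm_add_le fun i => (mG i).const_mul _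
    _ ≤ 2 * (4 * zNorm G) + 2 * (profConst decayProfile * (4 * zNorm G)) := by
        rw [zNorm_const_mul _ mG]
        gcongr
        norm_num
    _ = (8 + 8 * profConst decayProfile) * zNorm G := by ring
    _ ≤ (8 + 8 * profConst decayProfile) * (bilConst * ε * ((profConst growthProfile *
          zNorm (en γ)) * zNorm (en γ'))) := by
        gcongr
        refine h2.trans ?_
        gcongr
        exact zNorm_cconv_le' isProfile_growth.measurable hm
    _ = _ := by unfold opConst; ring

end

section rep

variable [Countable E] {γ γ' a a' : ι → ℝ → ℂ}

/-- A product of two represented families carries e^{2t}, whereas one factor e^t is wanted. The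
surplus factor is absorbed into the first input by convolution with the growth profile, which equals
e^t on [0, 1]. -/
lemma Small.rhs_eq (h : q.Small ε) (hr : Rep γ a) (hr' : Rep γ' a') (i : ι) {t : ℝ}
    (ht : t ∈ Icc (0 : ℝ) 1) :
    q.rhs a a' i t = Complex.exp t * hat (q.form (cconv growthProfile γ) γ' i) t := by
  have hz : zNorm (en (cconv growthProfile γ)) ≠ ⊤ := by
    refine ne_top_of_le_ne_top ?_ (zNorm_cconv_le' isProfile_growth.measurable hr.measurable)
    exact ENNReal.mul_ne_top isProfile_growth.profConst_ne_top hr.finite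
  rw [h.hat_form (measurable_cconv isProfile_growth.measurable hr.measurable) hr'.measurable hz
    hr'.finite]
  unfold rhs
  rw [← tsum_mul_left]
  refine tsum_congr fun e => ?_
  beta_reduce
  rw [hr.eq t ht, hr'.eq t ht, hat_cconv isProfile_growth.integrable (hr.integrable _), hat_growth ht]
  ring

lemma Small.finite_cconv (hr : Rep γ a) : zNorm (en (cconv growthProfile γ)) ≠ ⊤ :=
  ne_top_of_le_ne_top (ENNReal.mul_ne_top isProfile_growth.profConst_ne_top hr.finite)
    (zNorm_cconv_le' isProfile_growth.measurable hr.measurable)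

lemma Small.integrable_form_cconv (h : q.Small ε) (hr : Rep γ a) (hr' : Rep γ' a') (i : ι) :
    Integrable (q.form (cconv growthProfile γ) γ' i) :=
  h.integrable_form (measurable_cconv isProfile_growth.measurable hr.measurable) hr'.measurable
    (Small.finite_cconv hr) hr'.finite i

lemma Small.continuousOn_rhs (h : q.Small ε) (hr : Rep γ a) (hr' : Rep γ' a') (i : ι) :
    ContinuousOn (q.rhs a a' i) (Icc 0 1) := by
  refine ContinuousOn.congr (f := fun t : ℝ => Complex.exp t *
    hat (q.form (cconv growthProfile γ) γ' i) t) ?_ fun t ht => h.rhs_eq hr hr' i ht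
  have := continuous_hat (h.integrable_form_cconv hr hr' i)
  fun_prop

lemma Small.rep_op (h : q.Small ε) (hε : ε ≠ ⊤) (hr : Rep γ a) (hr' : Rep γ' a') :
    Rep (q.op γ γ') (q.duh a a') where
  measurable := measurable_op hr.measurable hr'.measurable
  finite := by
    refine ne_top_of_le_ne_top ?_ (h.zNorm_op_le hr.measurable hr'.measurable)
    have := opConst_ne_top
    have := hr.finite
    have := hr'.finite
    finiteness
  eq t ht i := by
    unfold op duh
    rw [exp_mul_hat_damp isProfile_decay.integrable (h.integrable_form_cconv hr hr' i) (hat_decay ht)]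
    refine intervalIntegral.integral_congr fun s hs => ?_
    rw [uIcc_of_le ht.1] at hs
    exact h.rhs_eq hr hr' i ⟨hs.1, hs.2.trans ht.2⟩

lemma Small.intervalIntegrable_rhs (h : q.Small ε) (hr : Rep γ a) (hr' : Rep γ' a') (i : ι) {t : ℝ}
    (ht : t ∈ Icc (0 : ℝ) 1) : IntervalIntegrable (q.rhs a a' i) volume 0 t := by
  refine ContinuousOn.intervalIntegrable ?_
  rw [uIcc_of_le ht.1]
  exact (h.continuousOn_rhs hr hr' i).mono (Icc_subset_Icc_right ht.2)

omit [Countable E] in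
lemma Small.summable_rhs (h : q.Small ε) {t : ℝ} (ha : ∑' i, ‖a i t‖ₑ ^ 2 ≠ ⊤)
    (ha' : ∑' i, ‖a' i t‖ₑ ^ 2 ≠ ⊤) (i : ι) :
    Summable fun e : q.out ⁻¹' {i} => q.M e * Complex.exp (Complex.I * (q.Φ e : ℂ) * (t : ℂ)) *
      (a (q.inl e) t * a' (q.inr e) t) := by
  refine Summable.of_norm (tsum_enorm_ne_top_iff_summable_norm.1 ?_)
  have := h.tsum_fiber_ne_top ha ha' i
  convert this using 3 with e
  rw [enorm_mul, enorm_mul, enorm_mul, enorm_exp_I_mul, mul_one]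

lemma Small.duh_add_left (h : q.Small ε) {γ₂ a₂ : ι → ℝ → ℂ} (hr : Rep γ a) (hr₂ : Rep γ₂ a₂)
    (hr' : Rep γ' a') (i : ι) {t : ℝ} (ht : t ∈ Icc (0 : ℝ) 1) :
    q.duh (fun i s => a i s + a₂ i s) a' i t = q.duh a a' i t + q.duh a₂ a' i t := by
  unfold duh
  rw [← intervalIntegral.integral_add (h.intervalIntegrable_rhs hr hr' i ht)
    (h.intervalIntegrable_rhs hr₂ hr' i ht)]
  refine intervalIntegral.integral_congr fun s hs => ?_
  rw [uIcc_of_le ht.1] at hs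
  have hs' : s ∈ Icc (0 : ℝ) 1 := ⟨hs.1, hs.2.trans ht.2⟩
  simp only [rhs]
  rw [← (h.summable_rhs (hr.tsum_sq_ne_top hs') (hr'.tsum_sq_ne_top hs') i).tsum_add
    (h.summable_rhs (hr₂.tsum_sq_ne_top hs') (hr'.tsum_sq_ne_top hs') i)]
  refine tsum_congr fun e => ?_
  ring

lemma Small.duh_add_right (h : q.Small ε) {γ₂ a₂ : ι → ℝ → ℂ} (hr : Rep γ a) (hr₂ : Rep γ₂ a₂)
    (hr' : Rep γ' a') (i : ι) {t : ℝ} (ht : t ∈ Icc (0 : ℝ) 1) :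
    q.duh a' (fun i s => a i s + a₂ i s) i t = q.duh a' a i t + q.duh a' a₂ i t := by
  unfold duh
  rw [← intervalIntegral.integral_add (h.intervalIntegrable_rhs hr' hr i ht)
    (h.intervalIntegrable_rhs hr' hr₂ i ht)]
  refine intervalIntegral.integral_congr fun s hs => ?_
  rw [uIcc_of_le ht.1] at hs
  have hs' : s ∈ Icc (0 : ℝ) 1 := ⟨hs.1, hs.2.trans ht.2⟩
  simp only [rhs]
  rw [← (h.summable_rhs (hr'.tsum_sq_ne_top hs') (hr.tsum_sq_ne_top hs') i).tsum_add
    (h.summable_rhs (hr'.tsum_sq_ne_top hs') (hr₂.tsum_sq_ne_top hs') i)]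
  refine tsum_congr fun e => ?_
  ring

omit [Countable E] in
lemma duh_congr {b b' : ι → ℝ → ℂ} (h1 : ∀ t ∈ Icc (0 : ℝ) 1, ∀ i, a i t = b i t)
    (h2 : ∀ t ∈ Icc (0 : ℝ) 1, ∀ i, a' i t = b' i t) (i : ι) {t : ℝ} (ht : t ∈ Icc (0 : ℝ) 1) :
    q.duh a a' i t = q.duh b b' i t := by
  unfold duh
  refine intervalIntegral.integral_congr fun s hs => ?_
  rw [uIcc_of_le ht.1] at hs
  have hs' : s ∈ Icc (0 : ℝ) 1 := ⟨hs.1, hs.2.trans ht.2⟩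
  simp only [rhs]
  refine tsum_congr fun e => ?_
  rw [h1 s hs', h2 s hs']

/-- The difference of two Duhamel terms is a sum of terms linear in the difference. -/
lemma Small.duh_sub_duh (h : q.Small ε) (hr : Rep γ a) (hr' : Rep γ' a') {δ : ι → ℝ → ℂ}
    (hd : Rep δ (fun i t => a i t - a' i t)) (i : ι) {t : ℝ} (ht : t ∈ Icc (0 : ℝ) 1) :
    q.duh a a i t - q.duh a' a' i t =
      q.duh (fun i t => a i t - a' i t) a i t + q.duh a' (fun i t => a i t - a' i t) i t := by
  have e1 : q.duh a a i t = q.duh (fun i t => a i t - a' i t) a i t + q.duh a' a i t := by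
    rw [← h.duh_add_left hd hr' hr i ht]
    exact duh_congr (fun s _ j => by ring) (fun s _ j => rfl) i ht
  have e2 : q.duh a' a i t = q.duh a' (fun i t => a i t - a' i t) i t + q.duh a' a' i t := by
    rw [← h.duh_add_right hd hr' hr' i ht]
    exact duh_congr (fun s _ j => rfl) (fun s _ j => by ring) i ht
  rw [e1, e2]; ring

/-- Stability of solutions under perturbations of the equation. -/
theorem Small.stability (h : q.Small ε) (hε : ε ≠ ⊤) {ρ : ℝ≥0∞} (hρ : 16 * (opConst * ε * ρ) ≤ 1)
    (hr : Rep γ a) (hr' : Rep γ' a') (hb : zNorm (en γ) ≤ ρ) (hb' : zNorm (en γ') ≤ ρ)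
    {X x : ι → ℝ → ℂ} (hX : Rep X x)
    (heq : ∀ t ∈ Icc (0 : ℝ) 1, ∀ i,
      a i t - a' i t = x i t + (q.duh a a i t - q.duh a' a' i t))
    {t : ℝ} (ht : t ∈ Icc (0 : ℝ) 1) :
    ∑' i, ‖a i t - a' i t‖ₑ ^ 2 ≤ 36 * zNorm (en X) := by
  -- The difference has many densities, since only times in [0, 1] matter. Substituting the equation
  -- for the difference into itself yields a new density of the same function, and the smallness 8 ·
  -- opConst · ε · ρ ≤ 1/2 halves the part not due to `X` each time.
  have step : ∀ n : ℕ, ∃ D, Rep D (fun i t => a i t - a' i t) ∧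
      zNorm (en D) ≤ 4 * zNorm (en X) + (2⁻¹) ^ n * (2 * zNorm (en γ) + 2 * zNorm (en γ')) := by
    intro n
    induction n with
    | zero =>
      refine ⟨fun i s => γ i s + -γ' i s, ?_, ?_⟩
      · exact (hr.add hr'.neg).congr fun t _ i => by ring
      · rw [pow_zero, one_mul]
        refine (zNorm_en_add_le hr.measurable).trans ?_
        rw [zNorm_en_neg]
        exact le_add_self
    | succ n ih =>
      obtain ⟨D, hD, hDn⟩ := ih
      have r1 := h.rep_op hε hD hr
      have r2 := h.rep_op hε hr' hD
      refine ⟨fun i s => X i s + (q.op D γ i s + q.op γ' D i s), ?_, ?_⟩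
      · refine (hX.add (r1.add r2)).congr fun t ht i => ?_
        rw [heq t ht, h.duh_sub_duh hr hr' hD i ht]
      · have b1 := h.zNorm_op_le hD.measurable hr.measurable
        have b2 := h.zNorm_op_le hr'.measurable hD.measurable
        have half : (2 : ℝ≥0∞) * 4⁻¹ = 2⁻¹ := by
          rw [show (4 : ℝ≥0∞) = 2 * 2 by norm_num, ENNReal.mul_inv (by simp) (by simp), ← mul_assoc,
            ENNReal.mul_inv_cancel (by simp) (by simp), one_mul]
        have small : opConst * ε * ρ ≤ 16⁻¹ := by
          rw [← one_mul (16⁻¹ : ℝ≥0∞), ← div_eq_mul_inv, ENNReal.le_div_iff_mul_le (by simp) (by simp),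
            mul_comm]
          exact hρ
        have e16 : (8 : ℝ≥0∞) * 16⁻¹ = 2⁻¹ := by
          rw [show (16 : ℝ≥0∞) = 8 * 2 by norm_num, ENNReal.mul_inv (by simp) (by simp), ← mul_assoc,
            ENNReal.mul_inv_cancel (by simp) (by simp), one_mul]
        set Y := zNorm (en X)
        set W := 2 * zNorm (en γ) + 2 * zNorm (en γ')
        calc _ ≤ 2 * Y + 2 * (2 * zNorm (en (q.op D γ)) + 2 * zNorm (en (q.op γ' D))) := by
              refine (zNorm_en_add_le hX.measurable).trans ?_
              gcongr
              exact zNorm_en_add_le r1.measurable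
          _ ≤ 2 * Y + 2 * (2 * (opConst * ε * (zNorm (en D) * ρ)) +
                2 * (opConst * ε * (ρ * zNorm (en D)))) := by
              gcongr
              · exact b1.trans (by gcongr)
              · exact b2.trans (by gcongr)
          _ = 2 * Y + 8 * (opConst * ε * ρ) * zNorm (en D) := by ring
          _ ≤ 2 * Y + 8 * 16⁻¹ * (4 * Y + (2⁻¹) ^ n * W) := by gcongr
          _ = 2 * Y + 2⁻¹ * (4 * Y + (2⁻¹) ^ n * W) := by rw [e16]
          _ = 2 * Y + ((2⁻¹ * 2) * 2 * Y + (2⁻¹) ^ (n + 1) * W) := by ring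
          _ = 4 * Y + (2⁻¹) ^ (n + 1) * W := by
              rw [ENNReal.inv_mul_cancel (by simp) (by simp)]; ring
  have hW : 2 * zNorm (en γ) + 2 * zNorm (en γ') ≠ ⊤ := by
    have := hr.finite
    have := hr'.finite
    finiteness
  -- The norm of the difference itself need not be small for a given density, so the limit is taken
  -- only in the bound for its values at time t.
  have lim : Filter.Tendsto (fun n : ℕ => 9 * (4 * zNorm (en X) +
      (2⁻¹ : ℝ≥0∞) ^ n * (2 * zNorm (en γ) + 2 * zNorm (en γ')))) Filter.atTop
      (nhds (9 * (4 * zNorm (en X) + 0 * (2 * zNorm (en γ) + 2 * zNorm (en γ'))))) := by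
    refine ENNReal.Tendsto.const_mul ?_ (Or.inr (by simp))
    refine tendsto_const_nhds.add (ENNReal.Tendsto.mul_const ?_ (Or.inr hW))
    exact ENNReal.tendsto_pow_atTop_nhds_zero_of_lt_one (by simp)
  have fin : ∑' i, ‖a i t - a' i t‖ₑ ^ 2 ≤
      9 * (4 * zNorm (en X) + 0 * (2 * zNorm (en γ) + 2 * zNorm (en γ'))) := by
    refine ge_of_tendsto' lim fun n => ?_
    obtain ⟨D, hD, hDn⟩ := step n
    exact (hD.tsum_sq_le ht).trans (by gcongr)
  refine fin.trans_eq ?_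
  ring

end rep

end QSys

end DSW

/-! ### Picard iteration -/

namespace DSW

variable {ι E : Type*}

/-- Cauchy–Schwarz against the weights 2^{-n}. It replaces the triangle inequality, which squared
norms lack; the factors 4^n are harmless for series decaying like 16^{-n}. -/
lemma sq_tsum_le (x : ℕ → ℝ≥0∞) : (∑' n, x n) ^ 2 ≤ 2 * ∑' n, 4 ^ n * x n ^ 2 := by
  have e1 : ∀ n : ℕ, x n = (2⁻¹ : ℝ≥0∞) ^ n * (2 ^ n * x n) := fun n => by
    rw [← mul_assoc, ← mul_pow, ENNReal.inv_mul_cancel (by simp) (by simp), one_pow, one_mul]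
  calc (∑' n, x n) ^ 2 = (∑' n, (2⁻¹ : ℝ≥0∞) ^ n * (2 ^ n * x n)) ^ 2 := by
        congr 1; exact tsum_congr e1
    _ ≤ (∑' n, ((2⁻¹ : ℝ≥0∞) ^ n) ^ 2) * ∑' n, (2 ^ n * x n) ^ 2 := sq_tsum_mul_le _ _
    _ ≤ 2 * ∑' n, 4 ^ n * x n ^ 2 := by
        gcongr with n
        · calc _ ≤ ∑' n : ℕ, (2⁻¹ : ℝ≥0∞) ^ n := by
                refine ENNReal.tsum_le_tsum fun n => ?_
                rw [← pow_mul]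
                exact pow_le_pow_right_of_le_one' (by simp) (by lia)
            _ = 2 := ENNReal.tsum_geometric_two
        · rw [mul_pow, ← pow_mul, mul_comm n 2, pow_mul]; norm_num

lemma zNorm_tsum_le {f : ℕ → ι → ℝ → ℝ≥0∞} (hf : ∀ n i, Measurable (f n i)) :
    zNorm (fun i s => ∑' n, f n i s) ≤ 2 * ∑' n, 4 ^ n * zNorm (f n) := by
  have h1 : hNorm (fun i s => ∑' n, f n i s) ≤ 2 * ∑' n, 4 ^ n * hNorm (f n) := by
    unfold hNorm
    calc _ ≤ ∑' i, ∫⁻ s, ∑' n, 2 * (4 ^ n * (jb s * f n i s ^ 2)) := by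
          gcongr with i s
          refine (mul_le_mul' le_rfl (sq_tsum_le _)).trans_eq ?_
          rw [ENNReal.tsum_mul_left, mul_left_comm, ← ENNReal.tsum_mul_left]
          congr 1
          refine tsum_congr fun n => ?_
          ring
      _ = ∑' i, ∑' n, 2 * (4 ^ n * ∫⁻ s, jb s * f n i s ^ 2) := by
          refine tsum_congr fun i => ?_
          have hfi := fun n => hf n i
          rw [lintegral_tsum fun n => by have := hfi n; fun_prop]
          refine tsum_congr fun n => ?_
          have := hfi n
          rw [lintegral_const_mul _ (by fun_prop), lintegral_const_mul _ (by fun_prop)]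
      _ = _ := by
          rw [ENNReal.tsum_comm]
          simp_rw [ENNReal.tsum_mul_left]
  have h2 : sNorm (fun i s => ∑' n, f n i s) ≤ 2 * ∑' n, 4 ^ n * sNorm (f n) := by
    unfold sNorm
    calc _ ≤ ∑' i, ∑' n, 2 * (4 ^ n * (∫⁻ s, f n i s) ^ 2) := by
          gcongr with i
          rw [lintegral_tsum fun n => (hf n i).aemeasurable]
          refine (sq_tsum_le _).trans_eq ?_
          rw [ENNReal.tsum_mul_left]
      _ = _ := by
          rw [ENNReal.tsum_comm]
          simp_rw [ENNReal.tsum_mul_left]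
  calc _ ≤ 2 * ∑' n, 4 ^ n * hNorm (f n) + 2 * ∑' n, 4 ^ n * sNorm (f n) := add_le_add h1 h2
    _ = _ := by
        unfold zNorm
        rw [← mul_add, ← ENNReal.tsum_add]
        simp_rw [mul_add]

/-- A telescoping series of represented differences represents the limit. -/
lemma rep_tsum {d b : ℕ → ι → ℝ → ℂ} {B : ℝ≥0∞} (hB : B ≠ ⊤)
    (hd : ∀ n, Rep (d n) (fun i t => b (n + 1) i t - b n i t))
    (hz : ∀ n, zNorm (en (d n)) ≤ (16⁻¹) ^ n * B) :
    (∀ i, Measurable fun s => ∑' n, d n i s) ∧ zNorm (en fun i s => ∑' n, d n i s) ≤ 4 * B ∧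
      ∀ t ∈ Icc (0 : ℝ) 1, ∀ i, Filter.Tendsto (fun n => b n i t) Filter.atTop
        (nhds (b 0 i t + Complex.exp t * hat (fun s => ∑' n, d n i s) t)) := by
  have mm : ∀ n i, Measurable (d n i) := fun n => (hd n).measurable
  have hbound : zNorm (fun i s => ∑' n, en (d n) i s) ≤ 4 * B := by
    refine (zNorm_tsum_le fun n i => (mm n i).enorm).trans ?_
    have : ∑' n : ℕ, 4 ^ n * zNorm (en (d n)) ≤ 2 * B := by
      calc _ ≤ ∑' n : ℕ, (2⁻¹ : ℝ≥0∞) ^ n * B := by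
            refine ENNReal.tsum_le_tsum fun n => ?_
            refine (mul_le_mul' le_rfl (hz n)).trans ?_
            rw [← mul_assoc, ← mul_pow]
            gcongr
            rw [show (16 : ℝ≥0∞) = 4 * 4 by norm_num, ENNReal.mul_inv (by simp) (by simp),
              ← mul_assoc, ENNReal.mul_inv_cancel (by simp) (by simp), one_mul]
            exact ENNReal.inv_le_inv.2 (by norm_num)
        _ = 2 * B := by rw [ENNReal.tsum_mul_right, ENNReal.tsum_geometric_two]
    calc _ ≤ 2 * (2 * B) := mul_le_mul' le_rfl this
      _ = 4 * B := by ring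
  refine ⟨fun i => Measurable.tsum fun n => mm n i, ?_, ?_⟩
  · refine (zNorm_mono fun i s => ?_).trans hbound
    exact enorm_tsum_le_tsum_enorm
  · intro t ht i
    have hi : ∑' n, ∫⁻ s, ‖d n i s‖ₑ ≠ ⊤ := by
      rw [← lintegral_tsum fun n => (mm n i).enorm.aemeasurable]
      intro htop
      have h1 : (⊤ : ℝ≥0∞) ≤ sNorm (fun i s => ∑' n, en (d n) i s) := by
        refine le_trans ?_ (ENNReal.le_tsum i)
        have : ∫⁻ s, ∑' n, en (d n) i s = ⊤ := htop
        simp [this]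
      have h2 := (h1.trans (sNorm_le_zNorm _)).trans hbound
      exact ENNReal.mul_ne_top (by simp) hB (top_le_iff.1 h2)
    have hsum : HasSum (fun n => hat (d n i) t) (hat (fun s => ∑' n, d n i s) t) := by
      have e1 : hat (fun s => ∑' n, d n i s) t = ∑' n, hat (d n i) t := by
        unfold hat
        rw [← integral_tsum]
        · congr 1; ext s; rw [tsum_mul_left]
        · intro n
          have := mm n i
          exact (by fun_prop : Measurable _).aestronglyMeasurable
        · simp_rw [enorm_mul, enorm_exp_I_mul, one_mul]; exact hi
      rw [e1]
      refine Summable.hasSum (Summable.of_norm (tsum_enorm_ne_top_iff_summable_norm.1 ?_))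
      exact ne_top_of_le_ne_top hi (ENNReal.tsum_le_tsum fun n => enorm_hat_le _ _)
    have h3 := ((hsum.mul_left (Complex.exp t)).tendsto_sum_nat).const_add (b 0 i t)
    refine h3.congr fun n => ?_
    have : ∀ m, Complex.exp t * hat (d m i) t = b (m + 1) i t - b m i t := fun m =>
      ((hd m).eq t ht i).symm
    simp_rw [this]
    rw [Finset.sum_range_sub (fun m => b m i t)]
    ring

namespace QSys

variable (q : QSys ι E)

/-- The Picard iterates in frequency variables. -/
noncomputable def picard (γ₀ : ι → ℝ → ℂ) : ℕ → ι → ℝ → ℂ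
  | 0 => γ₀
  | n + 1 => fun i s => γ₀ i s + q.op (picard γ₀ n) (picard γ₀ n) i s

/-- Representatives of the differences of consecutive Picard iterates. -/
noncomputable def picardDiff (γ₀ : ι → ℝ → ℂ) : ℕ → ι → ℝ → ℂ
  | 0 => q.op γ₀ γ₀
  | n + 1 => fun i s => q.op (picardDiff γ₀ n) (q.picard γ₀ (n + 1)) i s +
      q.op (q.picard γ₀ n) (picardDiff γ₀ n) i s

/-- The Picard iterates in the time variable. -/
noncomputable def picardTime (c : ι → ℂ) : ℕ → ι → ℝ → ℂ
  | 0 => fun i _ => c i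
  | n + 1 => fun i t => c i + q.duh (picardTime c n) (picardTime c n) i t

/-- The constant governing the size of the data for which the Picard iteration converges. -/
noncomputable def dataConst : ℝ≥0∞ := 256 * (opConst * profConst decayProfile)

lemma dataConst_ne_top : dataConst ≠ ⊤ := by
  unfold dataConst
  have := opConst_ne_top
  have := isProfile_decay.profConst_ne_top
  finiteness

variable {q} {ε : ℝ≥0∞}

lemma le_inv_of_mul_le {k x : ℝ≥0∞} (hk : k ≠ 0) (hk' : k ≠ ⊤) (h : k * x ≤ 1) : x ≤ k⁻¹ := by
  rw [← one_mul k⁻¹, ← div_eq_mul_inv, ENNReal.le_div_iff_mul_le (Or.inl hk) (Or.inl hk'), mul_comm]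
  exact h

/-- Contraction by explicit iteration. The iterates stay in the ball of squared norm 4ρ₀,
consecutive differences decay like 16^{-n}, and the telescoping series of their densities represents
the limit. Convergence is followed through densities, so that the limit again has finite norm. -/
theorem Small.exists_solution [Countable E] (h : q.Small ε) (hε : ε ≠ ⊤) {ρ : ℝ≥0∞} (hρt : ρ ≠ ⊤)
    (hρ : dataConst * ε * ρ ≤ 1) {c : ι → ℂ} (hc : ∑' i, ‖c i‖ₑ ^ 2 ≤ ρ) :
    ∃ γ a, Rep γ a ∧ zNorm (en γ) ≤ 10 * (profConst decayProfile * ρ) ∧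
      ∀ t ∈ Icc (0 : ℝ) 1, ∀ i, a i t = c i + q.duh a a i t := by
  set ρ₀ := profConst decayProfile * ρ with hρ₀
  have hρ₀t : ρ₀ ≠ ⊤ := ENNReal.mul_ne_top isProfile_decay.profConst_ne_top hρt
  set A := opConst * ε with hA
  -- The contraction factor of the differences is 16 A ρ₀, wanted at most 1/16; hence the 256 in
  -- `dataConst`.
  have hAρ : A * ρ₀ ≤ 256⁻¹ := by
    refine le_inv_of_mul_le (by simp) (by simp) (le_trans (le_of_eq ?_) hρ)
    rw [hA, hρ₀, dataConst]; ring
  set γ₀ : ι → ℝ → ℂ := fun i s => c i * decayProfile s with hγ₀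
  have r0 : Rep γ₀ (fun i _ => c i) := Rep.const (ne_top_of_le_ne_top hρt hc)
  have z0 : zNorm (en γ₀) ≤ ρ₀ := (Rep.zNorm_const_le c).trans (by rw [hρ₀]; gcongr)
  have i256 : (256 : ℝ≥0∞)⁻¹ = 16⁻¹ * 16⁻¹ := by
    rw [← ENNReal.mul_inv (by simp) (by simp)]; norm_num
  have c16 : (16 : ℝ≥0∞) * 16⁻¹ = 1 := ENNReal.mul_inv_cancel (by simp) (by simp)
  have hA16 : 16 * (A * ρ₀) ≤ 16⁻¹ := by
    calc 16 * (A * ρ₀) ≤ 16 * 256⁻¹ := by gcongr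
      _ = 16⁻¹ := by rw [i256, ← mul_assoc, c16, one_mul]
  have hA1 : 16 * (A * ρ₀) ≤ 1 := hA16.trans (by simp)
  have rp : ∀ n, Rep (q.picard γ₀ n) (q.picardTime c n) ∧ zNorm (en (q.picard γ₀ n)) ≤ 4 * ρ₀ := by
    intro n
    induction n with
    | zero =>
      exact ⟨r0, z0.trans (le_mul_of_one_le_left' (by norm_num))⟩
    | succ n ih =>
      refine ⟨r0.add (h.rep_op hε ih.1 ih.1), ?_⟩
      calc _ ≤ 2 * zNorm (en γ₀) + 2 * zNorm (en (q.op (q.picard γ₀ n) (q.picard γ₀ n))) :=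
            zNorm_en_add_le r0.measurable
        _ ≤ 2 * ρ₀ + 2 * (A * ((4 * ρ₀) * (4 * ρ₀))) := by
            gcongr
            refine (h.zNorm_op_le ih.1.measurable ih.1.measurable).trans ?_
            gcongr
            · exact ih.2
            · exact ih.2
        _ = 2 * ρ₀ + 2 * (16 * (A * ρ₀)) * ρ₀ := by ring
        _ ≤ 2 * ρ₀ + 2 * 1 * ρ₀ := by gcongr
        _ = _ := by ring
  have rd : ∀ n, Rep (q.picardDiff γ₀ n)
      (fun i t => q.picardTime c (n + 1) i t - q.picardTime c n i t) ∧
      zNorm (en (q.picardDiff γ₀ n)) ≤ (16⁻¹) ^ n * ρ₀ := by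
    intro n
    induction n with
    | zero =>
      refine ⟨(h.rep_op hε r0 r0).congr fun t _ i => ?_, ?_⟩
      · change _ = (c i + q.duh (fun i _ => c i) (fun i _ => c i) i t) - c i
        ring
      · rw [pow_zero, one_mul]
        calc _ ≤ A * (ρ₀ * ρ₀) := by
              refine (h.zNorm_op_le r0.measurable r0.measurable).trans ?_
              gcongr
          _ = (A * ρ₀) * ρ₀ := by ring
          _ ≤ 1 * ρ₀ := by gcongr; exact hAρ.trans (by simp)
          _ = ρ₀ := one_mul _
    | succ n ih =>
      have r1 := h.rep_op hε ih.1 (rp (n + 1)).1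
      have r2 := h.rep_op hε (rp n).1 ih.1
      refine ⟨(r1.add r2).congr fun t ht i => ?_, ?_⟩
      · rw [← h.duh_sub_duh (rp (n + 1)).1 (rp n).1 ih.1 i ht]
        change _ = (c i + q.duh (q.picardTime c (n + 1)) (q.picardTime c (n + 1)) i t) -
          (c i + q.duh (q.picardTime c n) (q.picardTime c n) i t)
        ring
      · calc _ ≤ 2 * zNorm (en (q.op (q.picardDiff γ₀ n) (q.picard γ₀ (n + 1)))) +
              2 * zNorm (en (q.op (q.picard γ₀ n) (q.picardDiff γ₀ n))) :=
              zNorm_en_add_le r1.measurable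
          _ ≤ 2 * (A * ((16⁻¹) ^ n * ρ₀ * (4 * ρ₀))) + 2 * (A * ((4 * ρ₀) * ((16⁻¹) ^ n * ρ₀))) := by
              gcongr
              · refine (h.zNorm_op_le ih.1.measurable (rp (n + 1)).1.measurable).trans ?_
                gcongr
                · exact ih.2
                · exact (rp (n + 1)).2
              · refine (h.zNorm_op_le (rp n).1.measurable ih.1.measurable).trans ?_
                gcongr
                · exact (rp n).2
                · exact ih.2
          _ = (16 * (A * ρ₀)) * ((16⁻¹) ^ n * ρ₀) := by ring
          _ ≤ 16⁻¹ * ((16⁻¹) ^ n * ρ₀) := by gcongr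
          _ = _ := by ring
  -- Summing the telescoping series from every n on gives, besides the solution (n = 0), a density
  -- of size 16^{-n} for its distance to the n-th iterate.
  have tail : ∀ n, _ := fun n => rep_tsum (d := fun m => q.picardDiff γ₀ (m + n))
    (b := fun m => q.picardTime c (m + n)) (B := (16⁻¹) ^ n * ρ₀)
    (ENNReal.mul_ne_top (by finiteness) hρ₀t)
    (fun m => by
      have := (rd (m + n)).1
      rwa [show m + n + 1 = m + 1 + n by ring] at this)
    (fun m => by
      refine (rd (m + n)).2.trans_eq ?_
      rw [pow_add]; ring)
  set T : ℕ → ι → ℝ → ℂ := fun n i s => ∑' m, q.picardDiff γ₀ (m + n) i s with hT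
  have hTz : ∀ n, zNorm (en (T n)) ≤ 4 * ((16⁻¹) ^ n * ρ₀) := fun n => (tail n).2.1
  have hTt : ∀ n, zNorm (en (T n)) ≠ ⊤ := fun n =>
    ne_top_of_le_ne_top (by finiteness) (hTz n)
  set a : ι → ℝ → ℂ := fun i t => c i + Complex.exp t * hat (T 0 i) t with ha
  have hT0 : Rep (T 0) (fun i t => Complex.exp t * hat (T 0 i) t) :=
    ⟨(tail 0).1, hTt 0, fun t _ i => rfl⟩
  have hra : Rep (fun i s => γ₀ i s + T 0 i s) a := r0.add hT0
  have hza : zNorm (en fun i s => γ₀ i s + T 0 i s) ≤ 10 * ρ₀ := by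
    refine (zNorm_en_add_le r0.measurable).trans ?_
    calc _ ≤ 2 * ρ₀ + 2 * (4 * ρ₀) := by
          gcongr
          simpa using hTz 0
      _ = _ := by ring
  have hTn : ∀ n, Rep (T n) (fun i t => a i t - q.picardTime c n i t) := by
    intro n
    refine ⟨(tail n).1, hTt n, fun t ht i => ?_⟩
    have l1 := (tail n).2.2 t ht i
    have l2 := ((tail 0).2.2 t ht i).comp (Filter.tendsto_add_atTop_nat n)
    have := tendsto_nhds_unique l1 (l2.congr fun m => rfl)
    simp only [zero_add, add_zero] at this
    simp only [ha]
    have h0 : q.picardTime c 0 i t = c i := rfl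
    rw [h0] at this
    have h4 : c i + Complex.exp t * hat (T 0 i) t =
        q.picardTime c n i t + Complex.exp t * hat (T n i) t := this.symm
    rw [h4]; ring
  refine ⟨_, a, hra, hza, fun t ht i => ?_⟩
  -- The defect of the limit in the equation is its distance to iterate n + 1 minus two Duhamel
  -- terms linear in its distance to iterate n; all are O(16^{-n}).
  have key : ∀ n : ℕ, ‖a i t - (c i + q.duh a a i t)‖ₑ ^ 2 ≤
      (16⁻¹ : ℝ≥0∞) ^ n * (9 * (2 * (4 * ρ₀) + 2 * (2 * (A * ((4 * ρ₀) * (10 * ρ₀))) +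
        2 * (A * ((4 * ρ₀) * (4 * ρ₀)))))) := by
    intro n
    have r1 := h.rep_op hε (hTn n) hra
    have r2 := h.rep_op hε (rp n).1 (hTn n)
    have r3 := (hTn (n + 1)).add (r1.add r2).neg
    have r4 : Rep _ (fun i t => a i t - (c i + q.duh a a i t)) := r3.congr fun t ht i => by
      rw [← h.duh_sub_duh hra (rp n).1 (hTn n) i ht]
      have : q.picardTime c (n + 1) i t =
        c i + q.duh (q.picardTime c n) (q.picardTime c n) i t := rfl
      rw [this]; ring
    refine (ENNReal.le_tsum (f := fun i => ‖a i t - (c i + q.duh a a i t)‖ₑ ^ 2) i).trans ?_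
    refine (r4.tsum_sq_le ht).trans ?_
    rw [mul_left_comm]
    gcongr
    refine (zNorm_en_add_le (hTn (n + 1)).measurable).trans ?_
    rw [zNorm_en_neg (fun i s => q.op (T n) (fun i s => γ₀ i s + T 0 i s) i s +
      q.op (q.picard γ₀ n) (T n) i s)]
    calc _ ≤ 2 * (4 * ((16⁻¹) ^ n * ρ₀)) + 2 * (2 * (A * ((4 * ((16⁻¹) ^ n * ρ₀)) * (10 * ρ₀))) +
          2 * (A * ((4 * ρ₀) * (4 * ((16⁻¹) ^ n * ρ₀))))) := by
          gcongr
          · refine (hTz (n + 1)).trans ?_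
            gcongr 4 * (?_ * ρ₀)
            exact pow_le_pow_right_of_le_one' (by simp) (by lia)
          · refine (zNorm_en_add_le r1.measurable).trans ?_
            gcongr
            · refine (h.zNorm_op_le (hTn n).measurable hra.measurable).trans ?_
              gcongr
              exact hTz n
            · refine (h.zNorm_op_le (rp n).1.measurable (hTn n).measurable).trans ?_
              gcongr
              · exact (rp n).2
              · exact hTz n
      _ = _ := by ring
  have hAt : A ≠ ⊤ := ENNReal.mul_ne_top opConst_ne_top hε
  have lim : Filter.Tendsto (fun n : ℕ => (16⁻¹ : ℝ≥0∞) ^ n * (9 * (2 * (4 * ρ₀) +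
      2 * (2 * (A * ((4 * ρ₀) * (10 * ρ₀))) + 2 * (A * ((4 * ρ₀) * (4 * ρ₀)))))))
      Filter.atTop (nhds (0 * (9 * (2 * (4 * ρ₀) +
      2 * (2 * (A * ((4 * ρ₀) * (10 * ρ₀))) + 2 * (A * ((4 * ρ₀) * (4 * ρ₀)))))))) := by
    refine ENNReal.Tendsto.mul_const ?_ (Or.inr (by finiteness))
    exact ENNReal.tendsto_pow_atTop_nhds_zero_of_lt_one (by simp)
  have h0 := ge_of_tendsto' lim key
  rw [zero_mul, nonpos_iff_eq_zero, pow_eq_zero_iff two_ne_zero, enorm_eq_zero, sub_eq_zero] at h0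
  exact h0

end QSys

end DSW

/-! ### Real solutions, uniqueness and truncation -/

namespace DSW

variable {ι E : Type*}

/-- A conjugation symmetry of a quadratic system, compatible with real-valued solutions. -/
structure QSys.Symm (q : QSys ι E) where
  bar : ι → ι
  ebar : E → E
  bar_bar : ∀ i, bar (bar i) = i
  ebar_ebar : ∀ e, ebar (ebar e) = e
  out_ebar : ∀ e, q.out (ebar e) = bar (q.out e)
  inl_ebar : ∀ e, q.inl (ebar e) = bar (q.inl e)
  inr_ebar : ∀ e, q.inr (ebar e) = bar (q.inr e)
  M_ebar : ∀ e, q.M (ebar e) = conj (q.M e)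
  Φ_ebar : ∀ e, q.Φ (ebar e) = -q.Φ e

lemma hat_conj (γ : ℝ → ℂ) (t : ℝ) : hat (fun s => conj (γ (-s))) t = conj (hat γ t) := by
  unfold hat
  rw [← integral_conj, ← integral_neg_eq_self]
  congr 1
  ext s
  simp only [neg_neg, map_mul, ← Complex.exp_conj, Complex.conj_I, Complex.conj_ofReal]
  congr 2
  push_cast
  ring

lemma jb_lintegral_neg (f : ℝ → ℝ≥0∞) : ∫⁻ s, jb s * f (-s) ^ 2 = ∫⁻ s, jb s * f s ^ 2 := by
  rw [← lintegral_neg_eq_self (fun s => jb s * f s ^ 2)]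
  simp_rw [jb_neg]

namespace QSys

variable {q : QSys ι E} {ε : ℝ≥0∞}

namespace Symm

variable (σ : q.Symm)

/-- The involution on the indices as a permutation. -/
def barEquiv : ι ≃ ι := ⟨σ.bar, σ.bar, σ.bar_bar, σ.bar_bar⟩

lemma zNorm_conj (γ : ι → ℝ → ℂ) :
    zNorm (en fun i s => conj (γ (σ.bar i) (-s))) = zNorm (en γ) := by
  unfold zNorm hNorm sNorm en
  congr 1
  · rw [← σ.barEquiv.tsum_eq (fun i => ∫⁻ s, jb s * ‖γ i s‖ₑ ^ 2)]
    refine tsum_congr fun i => ?_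
    rw [← jb_lintegral_neg]
    refine lintegral_congr fun s => ?_
    rw [RCLike.enorm_conj, neg_neg]
    rfl
  · rw [← σ.barEquiv.tsum_eq (fun i => (∫⁻ s, ‖γ i s‖ₑ) ^ 2)]
    refine tsum_congr fun i => ?_
    rw [← lintegral_neg_eq_self]
    congr 1
    refine lintegral_congr fun s => ?_
    rw [RCLike.enorm_conj, neg_neg]
    rfl

lemma rep_conj {γ a : ι → ℝ → ℂ} (h : Rep γ a) :
    Rep (fun i s => conj (γ (σ.bar i) (-s))) (fun i t => conj (a (σ.bar i) t)) where
  measurable i := by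
    have := h.measurable (σ.bar i)
    have h2 : Measurable fun z : ℂ => conj z := Complex.continuous_conj.measurable
    fun_prop
  finite := by rw [σ.zNorm_conj]; exact h.finite
  eq t ht i := by
    rw [h.eq t ht, hat_conj, map_mul, ← Complex.exp_conj, Complex.conj_ofReal]

/-- The involution on the interactions, between the fibres over `i` and `bar i`. -/
def fiberEquiv (i : ι) : q.out ⁻¹' {i} ≃ q.out ⁻¹' {σ.bar i} where
  toFun e := ⟨σ.ebar e, by
    have : q.out e = i := e.2
    simp [σ.out_ebar, this]⟩
  invFun e := ⟨σ.ebar e, by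
    have : q.out e = σ.bar i := e.2
    simp [σ.out_ebar, this, σ.bar_bar]⟩
  left_inv e := Subtype.ext (σ.ebar_ebar e)
  right_inv e := Subtype.ext (σ.ebar_ebar e)

/-- Reindexing the interactions by `ebar` conjugates multiplier and phase. Thus the reflected
conjugate of a solution is again a solution, and with real data uniqueness forces the two to
coincide. -/
lemma duh_conj (a : ι → ℝ → ℂ) (i : ι) (t : ℝ) :
    q.duh (fun i t => conj (a (σ.bar i) t)) (fun i t => conj (a (σ.bar i) t)) i t =
      conj (q.duh a a (σ.bar i) t) := by
  have h1 : ∀ s, q.rhs (fun i t => conj (a (σ.bar i) t)) (fun i t => conj (a (σ.bar i) t)) i s =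
      conj (q.rhs a a (σ.bar i) s) := by
    intro s
    unfold rhs
    rw [Complex.conj_tsum, ← (σ.fiberEquiv i).tsum_eq]
    refine tsum_congr fun e => ?_
    simp only [fiberEquiv, Equiv.coe_fn_mk, σ.M_ebar, σ.Φ_ebar, σ.inl_ebar, σ.inr_ebar, map_mul,
      Complex.conj_conj, ← Complex.exp_conj, Complex.conj_I, Complex.conj_ofReal]
    congr 3
    push_cast
    ring
  unfold duh
  simp_rw [h1]
  rw [intervalIntegral.intervalIntegral_eq_integral_uIoc,
    intervalIntegral.intervalIntegral_eq_integral_uIoc, integral_conj]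
  rcases le_total 0 t with h | h
  · simp [h]
  · split_ifs <;> simp

end Symm

/-- Uniqueness of small solutions. -/
lemma Small.eq_of_eq [Countable E] (h : q.Small ε) (hε : ε ≠ ⊤) {ρ : ℝ≥0∞}
    (hρ : 16 * (opConst * ε * ρ) ≤ 1) {γ γ' a a' : ι → ℝ → ℂ}
    (hr : Rep γ a) (hr' : Rep γ' a') (hb : zNorm (en γ) ≤ ρ) (hb' : zNorm (en γ') ≤ ρ) {c : ι → ℂ}
    (heq : ∀ t ∈ Icc (0 : ℝ) 1, ∀ i, a i t = c i + q.duh a a i t)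
    (heq' : ∀ t ∈ Icc (0 : ℝ) 1, ∀ i, a' i t = c i + q.duh a' a' i t)
    {t : ℝ} (ht : t ∈ Icc (0 : ℝ) 1) (i : ι) : a i t = a' i t := by
  have h0 : Rep (fun (_ : ι) (_ : ℝ) => (0 : ℂ)) (fun _ _ => 0) := by
    refine ⟨fun i => measurable_const, ?_, fun t _ i => ?_⟩
    · simp [zNorm, hNorm, sNorm, en]
    · simp [hat]
  have := h.stability hε hρ hr hr' hb hb' h0 (fun t ht j => by
    rw [heq t ht j, heq' t ht j]
    ring) ht
  have z0 : zNorm (en fun (_ : ι) (_ : ℝ) => (0 : ℂ)) = 0 := by simp [zNorm, hNorm, sNorm, en]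
  rw [z0, mul_zero, nonpos_iff_eq_zero, ENNReal.tsum_eq_zero] at this
  have h3 := this i
  rwa [pow_eq_zero_iff two_ne_zero, enorm_eq_zero, sub_eq_zero] at h3

/-- Solutions with real data are real. -/
lemma Small.real_of_real [Countable E] (h : q.Small ε) (hε : ε ≠ ⊤) (σ : q.Symm) {ρ : ℝ≥0∞}
    (hρ : 16 * (opConst * ε * ρ) ≤ 1) {γ a : ι → ℝ → ℂ} (hr : Rep γ a) (hb : zNorm (en γ) ≤ ρ)
    {c : ι → ℂ} (hc : ∀ i, c (σ.bar i) = conj (c i))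
    (heq : ∀ t ∈ Icc (0 : ℝ) 1, ∀ i, a i t = c i + q.duh a a i t) {t : ℝ} (ht : t ∈ Icc (0 : ℝ) 1)
    (i : ι) : a (σ.bar i) t = conj (a i t) := by
  rw [← h.eq_of_eq hε hρ (σ.rep_conj hr) hr (by rwa [σ.zNorm_conj]) hb (fun t ht j => by
    rw [heq t ht (σ.bar j), σ.duh_conj, map_add, hc j, Complex.conj_conj]) heq ht i,
    Complex.conj_conj]

open Classical in
/-- The system in which only the interactions inside `S` are kept. -/
noncomputable def trunc (q : QSys ι E) (S : Set ι) : QSys ι E :=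
  { q with M := fun e => if q.out e ∈ S ∧ q.inl e ∈ S ∧ q.inr e ∈ S then q.M e else 0 }

lemma trunc_M_of_mem {S : Set ι} {e : E} (h : q.out e ∈ S ∧ q.inl e ∈ S ∧ q.inr e ∈ S) :
    (q.trunc S).M e = q.M e := if_pos h

lemma trunc_M_of_notMem {S : Set ι} {e : E} (h : ¬(q.out e ∈ S ∧ q.inl e ∈ S ∧ q.inr e ∈ S)) :
    (q.trunc S).M e = 0 := if_neg h

lemma norm_trunc_le (S : Set ι) (e : E) : ‖(q.trunc S).M e‖ ≤ ‖q.M e‖ := by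
  simp only [trunc]
  split_ifs <;> simp

lemma gain_trunc_le (S : Set ι) (e : E) : (q.trunc S).gain e ≤ q.gain e := by
  unfold gain
  gcongr ?_ ^ 2 * ?_
  · rw [← ofReal_norm, ← ofReal_norm]
    exact ENNReal.ofReal_le_ofReal (norm_trunc_le S e)
  · exact le_rfl

lemma Small.trunc (h : q.Small ε) (S : Set ι) : (q.trunc S).Small ε where
  inj_in := h.inj_in
  inj_outl := h.inj_outl
  inj_outr := h.inj_outr
  sum_out i s := (ENNReal.tsum_le_tsum fun e => mul_le_mul' (gain_trunc_le S _) le_rfl).trans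
    (h.sum_out i s)
  sum_inl i s := (ENNReal.tsum_le_tsum fun e => mul_le_mul' (gain_trunc_le S _) le_rfl).trans
    (h.sum_inl i s)
  sum_inr i s := (ENNReal.tsum_le_tsum fun e => mul_le_mul' (gain_trunc_le S _) le_rfl).trans
    (h.sum_inr i s)
  bdd i := by
    obtain ⟨m, hm⟩ := h.bdd i
    exact ⟨m, fun e he => (norm_trunc_le S e).trans (hm e he)⟩

/-- The conjugation symmetry of a truncated system. -/
def Symm.trunc (σ : q.Symm) {S : Set ι} (hS : ∀ i, σ.bar i ∈ S ↔ i ∈ S) : (q.trunc S).Symm where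
  bar := σ.bar
  ebar := σ.ebar
  bar_bar := σ.bar_bar
  ebar_ebar := σ.ebar_ebar
  out_ebar := σ.out_ebar
  inl_ebar := σ.inl_ebar
  inr_ebar := σ.inr_ebar
  M_ebar e := by
    by_cases h : q.out e ∈ S ∧ q.inl e ∈ S ∧ q.inr e ∈ S
    · rw [trunc_M_of_mem h, trunc_M_of_mem (by simpa [σ.out_ebar, σ.inl_ebar, σ.inr_ebar, hS] using h),
        σ.M_ebar]
    · rw [trunc_M_of_notMem h,
        trunc_M_of_notMem (by simpa [σ.out_ebar, σ.inl_ebar, σ.inr_ebar, hS] using h), map_zero]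
  Φ_ebar := σ.Φ_ebar

/-- Truncating the interactions is the same as projecting the inputs to `S`, applying the full
nonlinearity and projecting the output. -/
lemma duh_trunc (S : Set ι) (a : ι → ℝ → ℂ) (i : ι) (t : ℝ) :
    (q.trunc S).duh a a i t = S.indicator (fun i => q.duh (fun j s => S.indicator (fun j => a j s) j)
      (fun j s => S.indicator (fun j => a j s) j) i t) i := by
  by_cases hi : i ∈ S
  · rw [Set.indicator_of_mem hi]
    unfold duh
    congr 1
    ext s
    have key : ∀ e : E, q.out e = i →
        (q.trunc S).M e * Complex.exp (Complex.I * (q.Φ e : ℂ) * (s : ℂ)) *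
          (a (q.inl e) s * a (q.inr e) s) =
        q.M e * Complex.exp (Complex.I * (q.Φ e : ℂ) * (s : ℂ)) *
          (S.indicator (fun j => a j s) (q.inl e) * S.indicator (fun j => a j s) (q.inr e)) := by
      intro e he
      have hi' : q.out e ∈ S := by rw [he]; exact hi
      by_cases h1 : q.inl e ∈ S
      · by_cases h2 : q.inr e ∈ S
        · rw [trunc_M_of_mem ⟨hi', h1, h2⟩, Set.indicator_of_mem h1, Set.indicator_of_mem h2]
        · rw [trunc_M_of_notMem (fun h => h2 h.2.2), Set.indicator_of_notMem h2]
          simp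
      · rw [trunc_M_of_notMem (fun h => h1 h.2.1), Set.indicator_of_notMem h1]
        simp
    exact tsum_congr fun e : q.out ⁻¹' {i} => key e e.2
  · rw [Set.indicator_of_notMem hi]
    unfold duh
    have : ∀ s, (q.trunc S).rhs a a i s = 0 := by
      intro s
      unfold rhs
      refine (tsum_congr fun e => ?_).trans tsum_zero
      have he : q.out e = i := e.2
      rw [trunc_M_of_notMem (fun h => hi (he ▸ h.1))]
      simp
    simp [this]

/-- The formal conservation law: for finitely supported real states the quadratic term is
orthogonal to the state. -/
def Conservative (q : QSys ι E) (σ : q.Symm) : Prop :=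
  ∀ z : ι → ℂ, z.support.Finite → (∀ i, z (σ.bar i) = conj (z i)) → ∀ t : ℝ,
    (∑' e, conj (z (q.out e)) * (q.M e * Complex.exp (Complex.I * (q.Φ e : ℂ) * (t : ℂ)) *
      (z (q.inl e) * z (q.inr e)))).re = 0

end QSys

end DSW

/-! ### The energy inequality -/

namespace DSW

variable {ι E : Type*}

namespace QSys

variable {q : QSys ι E} {ε : ℝ≥0∞}

/-- The energy form of the truncated system at z is the original form at the restriction of z to S.
The symmetry of S keeps that restriction real. -/
lemma Conservative.trunc {σ : q.Symm} (hcons : q.Conservative σ) {S : Set ι}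
    (hS : ∀ i, σ.bar i ∈ S ↔ i ∈ S) : (q.trunc S).Conservative (σ.trunc hS) := by
  intro z hz hreal t
  have := hcons (S.indicator z) (hz.subset (by simp)) (fun i => by
    by_cases hi : i ∈ S
    · rw [indicator_of_mem ((hS i).2 hi), indicator_of_mem hi]
      exact hreal i
    · rw [indicator_of_notMem (fun h => hi ((hS i).1 h)), indicator_of_notMem hi, map_zero]) t
  rw [← this]
  congr 1
  refine tsum_congr fun e => ?_
  change conj (z (q.out e)) * ((q.trunc S).M e * _ * (z (q.inl e) * z (q.inr e))) = _
  by_cases h0 : q.out e ∈ S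
  · by_cases h1 : q.inl e ∈ S
    · by_cases h2 : q.inr e ∈ S
      · rw [trunc_M_of_mem ⟨h0, h1, h2⟩, indicator_of_mem h0, indicator_of_mem h1,
          indicator_of_mem h2]
        rfl
      · rw [trunc_M_of_notMem (fun h => h2 h.2.2), indicator_of_notMem h2]
        simp
    · rw [trunc_M_of_notMem (fun h => h1 h.2.1), indicator_of_notMem h1]
      simp
  · rw [trunc_M_of_notMem (fun h => h0 h.1), indicator_of_notMem h0]
    simp

lemma summable_energy (hinj : Function.Injective fun e => (q.inl e, q.inr e)) {z : ι → ℂ}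
    (hz : z.support.Finite) (t : ℝ) : Summable fun e => conj (z (q.out e)) * (q.M e *
      Complex.exp (Complex.I * (q.Φ e : ℂ) * (t : ℂ)) * (z (q.inl e) * z (q.inr e))) := by
  refine summable_of_hasFiniteSupport (Set.Finite.subset (Set.Finite.preimage hinj.injOn
    (hz.prod hz)) fun e he => ?_)
  simp only [Set.mem_preimage, Set.mem_prod]
  constructor
  · intro h0
    refine he ?_
    simp [h0]
  · intro h0
    refine he ?_
    simp [h0]

/-- The conservation law regrouped by output, in the shape in which it appears in the derivative of
the energy. Finite support leaves finitely many nonzero terms, since the pair of inputs determines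
the interaction. -/
lemma Conservative.sum_fiber {σ : q.Symm} (hcons : q.Conservative σ)
    (hinj : Function.Injective fun e => (q.inl e, q.inr e)) {F : Finset ι} {z : ι → ℂ}
    (hz : ∀ i ∉ F, z i = 0) (hreal : ∀ i, z (σ.bar i) = conj (z i)) (t : ℝ) :
    (∑ i ∈ F, conj (z i) * ∑' e : q.out ⁻¹' {i}, q.M e *
      Complex.exp (Complex.I * (q.Φ e : ℂ) * (t : ℂ)) * (z (q.inl e) * z (q.inr e))).re = 0 := by
  set f : E → ℂ := fun e => conj (z (q.out e)) * (q.M e *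
    Complex.exp (Complex.I * (q.Φ e : ℂ) * (t : ℂ)) * (z (q.inl e) * z (q.inr e))) with hf
  have hsupp : z.support ⊆ F := fun i hi => by
    by_contra h
    exact hi (hz i h)
  have hs : Summable f := summable_energy hinj (F.finite_toSet.subset hsupp) t
  have h1 := (hs.hasSum.tsum_fiberwise q.out).tsum_eq
  have h2 := hcons z (F.finite_toSet.subset hsupp) hreal t
  rw [← h2, ← h1]
  congr 1
  rw [tsum_eq_sum (s := F)]
  · refine Finset.sum_congr rfl fun i _ => ?_
    rw [← tsum_mul_left]
    refine tsum_congr fun e => ?_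
    have : q.out e = i := e.2
    simp only [hf, this]
  · intro i hi
    refine (tsum_congr fun e => ?_).trans tsum_zero
    have : q.out e = i := e.2
    simp [hf, this, hz i hi]

/-- Conservation of the energy for finite systems. -/
lemma Small.energy_eq_of_finite [Countable E] (h : q.Small ε) {σ : q.Symm}
    (hcons : q.Conservative σ) {F : Finset ι} {γ a : ι → ℝ → ℂ} (hr : Rep γ a) {c : ι → ℂ}
    (heq : ∀ t ∈ Icc (0 : ℝ) 1, ∀ i, a i t = c i + q.duh a a i t)
    (hF : ∀ t ∈ Icc (0 : ℝ) 1, ∀ i ∉ F, a i t = 0)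
    (hreal : ∀ t ∈ Icc (0 : ℝ) 1, ∀ i, a (σ.bar i) t = conj (a i t)) {t : ℝ}
    (ht : t ∈ Icc (0 : ℝ) 1) : ∑ i ∈ F, ‖a i t‖ ^ 2 = ∑ i ∈ F, ‖c i‖ ^ 2 := by
  set g : ι → ℝ → ℂ := fun i t => Complex.exp t * hat (q.form (cconv growthProfile γ) γ i) t
    with hg
  have gc : ∀ i, Continuous (g i) := fun i => by
    have := continuous_hat (h.integrable_form_cconv hr hr i)
    simp only [hg]
    fun_prop
  -- The equation is known only on [0, 1]. `G` extends the solution to a differentiable function on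
  -- the line, with the continuous integrand `g` in place of the nonlinearity.
  set G : ι → ℝ → ℂ := fun i t => c i + ∫ s in (0 : ℝ)..t, g i s with hG
  have hGa : ∀ s ∈ Icc (0 : ℝ) 1, ∀ i, a i s = G i s := by
    intro s hs i
    rw [heq s hs]
    simp only [hG, duh]
    congr 1
    refine intervalIntegral.integral_congr fun r hr' => ?_
    rw [uIcc_of_le hs.1] at hr'
    exact h.rhs_eq hr hr i ⟨hr'.1, hr'.2.trans hs.2⟩
  have hGd : ∀ i s, HasDerivAt (G i) (g i s) s := fun i s =>
    ((gc i).integral_hasStrictDerivAt 0 s).hasDerivAt.const_add _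
  have hd : ∀ s, HasDerivAt (fun s => ∑ i ∈ F, ‖G i s‖ ^ 2)
      (∑ i ∈ F, 2 * inner ℝ (G i s) (g i s)) s :=
    fun s => HasDerivAt.fun_sum fun i _ => (hGd i s).norm_sq
  have key := constant_of_has_deriv_right_zero (f := fun s => ∑ i ∈ F, ‖G i s‖ ^ 2) (a := 0) (b := 1)
    (fun s _ => (hd s).continuousAt.continuousWithinAt) (fun s hs => by
      have hs' : s ∈ Icc (0 : ℝ) 1 := ⟨hs.1, hs.2.le⟩
      convert (hd s).hasDerivWithinAt using 1
      have h1 := hcons.sum_fiber h.inj_in (F := F) (z := fun i => a i s) (hF s hs') (hreal s hs') s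
      rw [← Finset.mul_sum]
      rw [eq_comm, mul_eq_zero]
      right
      rw [← h1, Complex.re_sum]
      refine Finset.sum_congr rfl fun i _ => ?_
      rw [Complex.inner, ← hGa s hs', show g i s = q.rhs a a i s from (h.rhs_eq hr hr i hs').symm,
        mul_comm]
      rfl) t ht
  have h0 : ∀ i, G i 0 = c i := fun i => by simp [hG]
  simp only [h0] at key
  rw [← key]
  exact Finset.sum_congr rfl fun i _ => by rw [hGa t ht]

end QSys

/-- Restriction of a family to the indices in `S`. -/
noncomputable def cut (S : Set ι) (γ : ι → ℝ → ℂ) (i : ι) (s : ℝ) : ℂ :=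
  S.indicator (fun j => γ j s) i

lemma cut_of_mem {S : Set ι} {i : ι} (h : i ∈ S) (γ : ι → ℝ → ℂ) : cut S γ i = γ i := by
  ext s; exact indicator_of_mem h _

lemma cut_of_notMem {S : Set ι} {i : ι} (h : i ∉ S) (γ : ι → ℝ → ℂ) : cut S γ i = 0 := by
  ext s; exact indicator_of_notMem h _

lemma sub_cut (S : Set ι) (γ : ι → ℝ → ℂ) (i : ι) (s : ℝ) :
    γ i s - cut S γ i s = cut Sᶜ γ i s := by
  by_cases h : i ∈ S
  · rw [cut_of_mem h, cut_of_notMem (by simpa using h)]; simp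
  · rw [cut_of_notMem h, cut_of_mem (by simpa using h)]; simp

lemma zNorm_cut_mono {S S' : Set ι} (h : S ⊆ S') (γ : ι → ℝ → ℂ) :
    zNorm (en (cut S γ)) ≤ zNorm (en (cut S' γ)) := by
  refine zNorm_mono fun i s => ?_
  unfold en
  by_cases hi : i ∈ S
  · rw [cut_of_mem hi, cut_of_mem (h hi)]
  · rw [cut_of_notMem hi]; simp

lemma zNorm_cut_le (S : Set ι) (γ : ι → ℝ → ℂ) : zNorm (en (cut S γ)) ≤ zNorm (en γ) := by
  refine zNorm_mono fun i s => ?_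
  unfold en
  by_cases hi : i ∈ S
  · rw [cut_of_mem hi]
  · rw [cut_of_notMem hi]; simp

lemma Rep.cut {γ a : ι → ℝ → ℂ} (h : Rep γ a) (S : Set ι) : Rep (cut S γ) (cut S a) where
  measurable i := by
    by_cases hi : i ∈ S
    · rw [cut_of_mem hi]; exact h.measurable i
    · rw [cut_of_notMem hi]; exact measurable_const
  finite := ne_top_of_le_ne_top h.finite (zNorm_cut_le S γ)
  eq t ht i := by
    by_cases hi : i ∈ S
    · rw [cut_of_mem hi, cut_of_mem hi]; exact h.eq t ht i
    · rw [cut_of_notMem hi, cut_of_notMem hi]; simp [hat]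

lemma tendsto_tsum_indicator_compl {f : ι → ℝ≥0∞} (hf : ∑' i, f i ≠ ⊤) :
    Filter.Tendsto (fun F : Finset ι => ∑' i, (F : Set ι)ᶜ.indicator f i) Filter.atTop (𝓝 0) := by
  convert ENNReal.tendsto_tsum_compl_atTop_zero hf using 2 with F
  rw [← tsum_subtype]
  rfl

lemma tendsto_zNorm_cut {γ : ι → ℝ → ℂ} (h : zNorm (en γ) ≠ ⊤) :
    Filter.Tendsto (fun F : Finset ι => zNorm (en (cut (F : Set ι)ᶜ γ))) Filter.atTop (𝓝 0) := by
  have h1 : hNorm (en γ) ≠ ⊤ := ne_top_of_le_ne_top h (hNorm_le_zNorm _)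
  have h2 : sNorm (en γ) ≠ ⊤ := ne_top_of_le_ne_top h (sNorm_le_zNorm _)
  have := (tendsto_tsum_indicator_compl h1).add (tendsto_tsum_indicator_compl h2)
  rw [add_zero] at this
  convert this using 2 with F
  unfold zNorm hNorm sNorm
  congr 1 <;> refine tsum_congr fun i => ?_
  · by_cases hi : i ∈ (F : Set ι)ᶜ
    · rw [indicator_of_mem hi]; unfold en; rw [cut_of_mem hi]
    · rw [indicator_of_notMem hi]; unfold en; rw [cut_of_notMem hi]; simp
  · by_cases hi : i ∈ (F : Set ι)ᶜ
    · rw [indicator_of_mem hi]; unfold en; rw [cut_of_mem hi]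
    · rw [indicator_of_notMem hi]; unfold en; rw [cut_of_notMem hi]; simp

namespace QSys

variable {q : QSys ι E} {ε : ℝ≥0∞}

lemma duh_trunc_cut (S : Set ι) (a : ι → ℝ → ℂ) (i : ι) (t : ℝ) :
    (q.trunc S).duh a a i t = cut S (q.duh (cut S a) (cut S a)) i t := duh_trunc S a i t

/-- The error made by truncating the system to `S`. -/
lemma Small.exists_trunc_error [Countable E] (h : q.Small ε) (hε : ε ≠ ⊤) {γ a : ι → ℝ → ℂ}
    (hr : Rep γ a) {c : ι → ℂ} (hc : ∑' i, ‖c i‖ₑ ^ 2 ≠ ⊤) (S : Set ι) :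
    ∃ X, Rep X (fun i t => cut Sᶜ (fun i _ => c i) i t + (q.duh a a i t - (q.trunc S).duh a a i t)) ∧
      zNorm (en X) ≤ 2 * zNorm (en (cut Sᶜ fun i s => c i * decayProfile s)) +
        2 * (2 * zNorm (en (cut Sᶜ (q.op γ γ))) +
          2 * (2 * (opConst * ε * (zNorm (en (cut Sᶜ γ)) * zNorm (en γ))) +
            2 * (opConst * ε * (zNorm (en γ) * zNorm (en (cut Sᶜ γ)))))) := by
  have r1 := (Rep.const hc).cut Sᶜ
  have r2 := (h.rep_op hε hr hr).cut Sᶜ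
  have r3 := h.rep_op hε (hr.cut Sᶜ) hr
  have r4 := h.rep_op hε (hr.cut S) (hr.cut Sᶜ)
  -- The error has three sources: the data outside S, the output outside S, and, for outputs in S,
  -- the change of the inputs from `a` to its restriction. Each is linear in a tail.
  refine ⟨_, (r1.add (r2.add ((r3.add r4).cut S))).congr fun t ht i => ?_, ?_⟩
  · congr 1
    rw [duh_trunc_cut]
    have hd : Rep (cut Sᶜ γ) (fun i t => a i t - cut S a i t) :=
      (hr.cut Sᶜ).congr fun t _ i => (sub_cut S a i t).symm
    have e := h.duh_sub_duh hr (hr.cut S) hd i ht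
    have e1 : (fun i t => a i t - cut S a i t) = cut Sᶜ a := by
      ext i t; exact sub_cut S a i t
    rw [e1] at e
    by_cases hi : i ∈ S
    · rw [cut_of_notMem (by simpa using hi), cut_of_mem hi, cut_of_mem hi, e]
      simp
    · rw [cut_of_mem (by simpa using hi), cut_of_notMem hi, cut_of_notMem hi]
      simp
  · refine (zNorm_en_add_le r1.measurable).trans ?_
    gcongr
    refine (zNorm_en_add_le r2.measurable).trans ?_
    gcongr
    refine (zNorm_cut_le S _).trans ((zNorm_en_add_le r3.measurable).trans ?_)
    gcongr
    · exact h.zNorm_op_le (hr.cut Sᶜ).measurable hr.measurable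
    · refine (h.zNorm_op_le (hr.cut S).measurable (hr.cut Sᶜ).measurable).trans ?_
      gcongr
      exact zNorm_cut_le S γ

/-- The energy of a real solution does not exceed the energy of its data. -/
theorem Small.energy_le [Countable E] (h : q.Small ε) (hε : ε ≠ ⊤) (σ : q.Symm)
    (hcons : q.Conservative σ) {ρ : ℝ≥0∞} (hρt : ρ ≠ ⊤) (hρ : dataConst * ε * ρ ≤ 1)
    {c : ι → ℂ} (hc : ∑' i, ‖c i‖ₑ ^ 2 ≤ ρ) (hcr : ∀ i, c (σ.bar i) = conj (c i))
    {γ a : ι → ℝ → ℂ} (hr : Rep γ a)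
    (hb : zNorm (en γ) ≤ 10 * (profConst decayProfile * ρ))
    (heq : ∀ t ∈ Icc (0 : ℝ) 1, ∀ i, a i t = c i + q.duh a a i t) {t : ℝ}
    (ht : t ∈ Icc (0 : ℝ) 1) : ∑' i, ‖a i t‖ₑ ^ 2 ≤ ∑' i, ‖c i‖ₑ ^ 2 := by
  classical
  have hct : ∑' i, ‖c i‖ₑ ^ 2 ≠ ⊤ := ne_top_of_le_ne_top hρt hc
  -- Solutions lie in the ball of squared norm 10ρ₀, so stability asks for the constant 16 · 10 =
  -- 160, within the 256 of `dataConst`.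
  have hρ' : 16 * (opConst * ε * (10 * (profConst decayProfile * ρ))) ≤ 1 := by
    refine le_trans ?_ hρ
    unfold dataConst
    calc _ = 160 * (opConst * profConst decayProfile * ε * ρ) := by ring
      _ ≤ 256 * (opConst * profConst decayProfile * ε * ρ) := by gcongr; norm_num
      _ = _ := by ring
  -- Adding the conjugate indices makes the truncated system inherit the conjugation symmetry,
  -- without which its energy is not conserved.
  set T : Finset ι → Finset ι := fun F => F ∪ F.image σ.bar with hT
  have hTbar : ∀ F i, σ.bar i ∈ (T F : Set ι) ↔ i ∈ (T F : Set ι) := by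
    intro F i
    have aux : ∀ i, i ∈ (T F : Set ι) → σ.bar i ∈ (T F : Set ι) := by
      intro i hi
      simp only [hT, Finset.coe_union, Finset.coe_image, mem_union, mem_image, Finset.mem_coe] at hi ⊢
      rcases hi with hi | ⟨j, hj, rfl⟩
      · exact Or.inr ⟨i, hi, rfl⟩
      · left; rwa [σ.bar_bar]
    exact ⟨fun hi => by simpa [σ.bar_bar] using aux _ hi, aux i⟩
  have sol : ∀ F : Finset ι, ∃ b : ι → ℝ → ℂ, (∑' i, ‖b i t‖ₑ ^ 2 ≤ ∑' i, ‖c i‖ₑ ^ 2) ∧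
      ∑' i, ‖a i t - b i t‖ₑ ^ 2 ≤
        36 * (2 * zNorm (en (cut (F : Set ι)ᶜ fun i s => c i * decayProfile s)) +
        2 * (2 * zNorm (en (cut (F : Set ι)ᶜ (q.op γ γ))) +
          2 * (2 * (opConst * ε * (zNorm (en (cut (F : Set ι)ᶜ γ)) * zNorm (en γ))) +
            2 * (opConst * ε * (zNorm (en γ) * zNorm (en (cut (F : Set ι)ᶜ γ))))))) := by
    intro F
    set S : Set ι := (T F : Set ι) with hS
    have hsub : Sᶜ ⊆ (F : Set ι)ᶜ := by
      refine compl_subset_compl.2 ?_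
      simp [hS, hT]
    have hle : ∑' i, ‖S.indicator c i‖ₑ ^ 2 ≤ ∑' i, ‖c i‖ₑ ^ 2 := by
      refine ENNReal.tsum_le_tsum fun i => ?_
      gcongr
      rw [enorm_indicator_eq_indicator_enorm]
      exact indicator_le_self _ _ _
    obtain ⟨β, b, hβ, hβb, hbeq⟩ := (h.trunc S).exists_solution hε hρt hρ (hle.trans hc)
    have hreal : ∀ t ∈ Icc (0 : ℝ) 1, ∀ i, b (σ.bar i) t = conj (b i t) := by
      intro t ht i
      refine (h.trunc S).real_of_real hε (σ.trunc (hTbar F)) hρ' hβ hβb (fun i => ?_) hbeq ht i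
      change S.indicator c (σ.bar i) = _
      by_cases hi : i ∈ S
      · rw [indicator_of_mem ((hTbar F i).2 hi), indicator_of_mem hi, hcr]
      · rw [indicator_of_notMem (fun h => hi ((hTbar F i).1 h)), indicator_of_notMem hi, map_zero]
    have hoff : ∀ t ∈ Icc (0 : ℝ) 1, ∀ i ∉ T F, b i t = 0 := by
      intro t ht i hi
      have hi' : i ∉ S := hi
      rw [hbeq t ht, duh_trunc_cut, indicator_of_notMem hi', cut_of_notMem hi']
      simp
    have en1 := (h.trunc S).energy_eq_of_finite (hcons.trunc (hTbar F)) hβ hbeq hoff hreal ht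
    refine ⟨b, ?_, ?_⟩
    · refine le_trans (le_of_eq ?_) hle
      rw [tsum_eq_sum (s := T F) (fun i hi => by rw [hoff t ht i hi]; simp),
        tsum_eq_sum (s := T F) (fun i hi => by
          rw [indicator_of_notMem (show i ∉ S from hi)]; simp)]
      have e3 : ∀ z : ℂ, ‖z‖ₑ ^ 2 = ENNReal.ofReal (‖z‖ ^ 2) := fun z => by
        rw [← ofReal_norm, ENNReal.ofReal_pow (norm_nonneg _)]
      simp_rw [e3]
      rw [← ENNReal.ofReal_sum_of_nonneg (fun _ _ => by positivity),
        ← ENNReal.ofReal_sum_of_nonneg (fun _ _ => by positivity), en1]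
    -- Here `a` is viewed as a solution of the truncated system up to the truncation error, and
    -- stability compares it with the exact truncated solution `b`.
    · obtain ⟨X, hX, hXb⟩ := h.exists_trunc_error hε hr hct S
      refine ((h.trunc S).stability hε hρ' hr hβ hb hβb hX (fun t ht i => ?_) ht).trans ?_
      · rw [heq t ht, hbeq t ht]
        have : cut Sᶜ (fun i _ => c i) i t = c i - S.indicator c i := by
          by_cases hi : i ∈ S
          · rw [cut_of_notMem (by simpa using hi), indicator_of_mem hi]; simp
          · rw [cut_of_mem (by simpa using hi), indicator_of_notMem hi]; simp
        rw [this]; ring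
      · gcongr
        refine hXb.trans ?_
        gcongr 2 * ?_ + 2 * (2 * ?_ + 2 * (2 * (_ * (?_ * _)) + 2 * (_ * (_ * ?_))))
        all_goals exact zNorm_cut_mono hsub _
  choose b hbe hbd using sol
  have l1 := tendsto_zNorm_cut (Rep.const hct).finite
  have l2 := tendsto_zNorm_cut (h.rep_op hε hr hr).finite
  have l3 := tendsto_zNorm_cut hr.finite
  have hzf := hr.finite
  have hop := opConst_ne_top
  have lim : Filter.Tendsto (fun F : Finset ι => 36 * (2 * zNorm (en (cut (F : Set ι)ᶜ fun i s => c i * decayProfile s)) +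
        2 * (2 * zNorm (en (cut (F : Set ι)ᶜ (q.op γ γ))) +
          2 * (2 * (opConst * ε * (zNorm (en (cut (F : Set ι)ᶜ γ)) * zNorm (en γ))) +
            2 * (opConst * ε * (zNorm (en γ) * zNorm (en (cut (F : Set ι)ᶜ γ)))))))) Filter.atTop (𝓝 0) := by
    have m1 := ENNReal.Tendsto.const_mul (a := opConst * ε)
      (ENNReal.Tendsto.mul_const (b := zNorm (en γ)) l3 (Or.inr hzf))
      (Or.inr (by finiteness))
    have m2 := ENNReal.Tendsto.const_mul (a := opConst * ε)
      (ENNReal.Tendsto.const_mul (a := zNorm (en γ)) l3 (Or.inr hzf))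
      (Or.inr (by finiteness))
    have two : ∀ {f : Finset ι → ℝ≥0∞} {x : ℝ≥0∞}, Filter.Tendsto f Filter.atTop (𝓝 x) →
        Filter.Tendsto (fun F => 2 * f F) Filter.atTop (𝓝 (2 * x)) := fun hf =>
      ENNReal.Tendsto.const_mul hf (Or.inr (by finiteness))
    have := ENNReal.Tendsto.const_mul (a := 36) ((two l1).add
      (two ((two l2).add (two ((two m1).add (two m2)))))) (Or.inr (by finiteness))
    simpa using this
  have hpt : ∀ i, Filter.Tendsto (fun F => b F i t) Filter.atTop (𝓝 (a i t)) := by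
    intro i
    rw [tendsto_iff_edist_tendsto_0]
    have h2 : Filter.Tendsto (fun F => ‖a i t - b F i t‖ₑ ^ 2) Filter.atTop (𝓝 0) :=
      tendsto_of_tendsto_of_tendsto_of_le_of_le tendsto_const_nhds lim (fun _ => zero_le) fun F =>
        (ENNReal.le_tsum (f := fun i => ‖a i t - b F i t‖ₑ ^ 2) i).trans (hbd F)
    have h3 := h2.ennrpow_const (1 / 2)
    rw [ENNReal.zero_rpow_of_pos (by norm_num)] at h3
    refine h3.congr fun F => ?_
    rw [edist_comm, edist_eq_enorm_sub, ← ENNReal.rpow_natCast, ← ENNReal.rpow_mul]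
    norm_num
  -- Lower semicontinuity: each finite partial energy is a limit of partial energies of truncated
  -- solutions, and those are bounded by the energy of the data.
  rw [ENNReal.tsum_eq_iSup_sum]
  refine iSup_le fun F => ?_
  have hlim : Filter.Tendsto (fun G => ∑ i ∈ F, ‖b G i t‖ₑ ^ 2) Filter.atTop
      (𝓝 (∑ i ∈ F, ‖a i t‖ₑ ^ 2)) :=
    tendsto_finsetSum _ fun i _ => ((ENNReal.continuous_pow 2).tendsto _).comp (hpt i).enorm
  exact le_of_tendsto' hlim fun G => (ENNReal.sum_le_tsum F).trans (hbe G)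

end QSys

end DSW

/-! ### Lattice sums of brackets of polynomials -/

namespace DSW

lemma rpow_neg_le_mul_rpow_neg {K y z : ℝ≥0∞} {s : ℝ} (hs : 0 ≤ s) (hK : K ≠ 0) (hK' : K ≠ ⊤)
    (h : z ≤ K * y) : y ^ (-s) ≤ K ^ s * z ^ (-s) := by
  have h1 : z ^ s ≤ K ^ s * y ^ s := by
    rw [← ENNReal.mul_rpow_of_nonneg _ _ hs]
    exact ENNReal.rpow_le_rpow h hs
  have k0 : K ^ s ≠ 0 := by simp [ENNReal.rpow_eq_zero_iff, hK, hK']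
  have k1 : K ^ s ≠ ⊤ := ENNReal.rpow_ne_top_of_nonneg hs hK'
  rw [ENNReal.rpow_neg, ENNReal.rpow_neg]
  calc (y ^ s)⁻¹ = K ^ s * (K ^ s * y ^ s)⁻¹ := by
        rw [ENNReal.mul_inv (Or.inl k0) (Or.inl k1), ← mul_assoc, ENNReal.mul_inv_cancel k0 k1,
          one_mul]
    _ ≤ _ := by gcongr

/-- The sum `∑ ⟨l⟩^{-5/4}` over the integers. -/
noncomputable def intMass : ℝ≥0∞ := ∑' l : ℤ, jb l ^ (-(5 / 4) : ℝ)

lemma intMass_ne_top : intMass ≠ ⊤ := by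
  unfold intMass
  simp_rw [jb_rpow]
  refine Summable.tsum_ofReal_ne_top ?_
  refine (Real.summable_abs_int_rpow (b := 5 / 4) (by norm_num)).of_norm_bounded_eventually ?_
  filter_upwards [(Set.finite_singleton (0 : ℤ)).compl_mem_cofinite] with l hl
  have hl' : (l : ℝ) ≠ 0 := by exact_mod_cast hl
  rw [Real.norm_of_nonneg (by positivity)]
  exact Real.rpow_le_rpow_of_nonpos (abs_pos.2 hl') (by linarith) (by norm_num)

/-- Shifting l by the integer part reduces to r in [0, 1), where ⟨l⟩ ≤ 2⟨l - r⟩. -/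
lemma tsum_jb_sub_le (r : ℝ) :
    ∑' l : ℤ, jb (l - r) ^ (-(5 / 4) : ℝ) ≤ 2 ^ (5 / 4 : ℝ) * intMass := by
  rw [intMass, ← ENNReal.tsum_mul_left, ← (Equiv.addRight ⌊r⌋).tsum_eq]
  refine ENNReal.tsum_le_tsum fun l => ?_
  refine rpow_neg_le_mul_rpow_neg (by norm_num) (by norm_num) (by norm_num) ?_
  rw [jb, jb, ← ENNReal.ofReal_ofNat, ← ENNReal.ofReal_mul (by norm_num)]
  refine ENNReal.ofReal_le_ofReal ?_
  have h1 := Int.fract_nonneg r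
  have h2 := (Int.fract_lt_one r).le
  have h3 : (((Equiv.addRight ⌊r⌋) l : ℤ) : ℝ) - r = l - Int.fract r := by
    rw [Equiv.coe_addRight, Int.fract]; push_cast; ring
  rw [h3]
  have h4 : |(l : ℝ)| ≤ |(l : ℝ) - Int.fract r| + |Int.fract r| := by
    have := abs_add_le ((l : ℝ) - Int.fract r) (Int.fract r)
    simpa using this
  rw [abs_of_nonneg h1] at h4
  linarith [abs_nonneg ((l : ℝ) - Int.fract r)]

/-- A function comparable from below to the square of the distance to three points. -/
lemma tsum_jb_rpow_le {K : ℝ} (hK : 0 < K) {p : ℝ → ℝ} {r₁ r₂ r₃ : ℝ}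
    (h : ∀ x, (1 + |x - r₁|) ^ 2 ≤ K * (1 + |p x|) ∨ (1 + |x - r₂|) ^ 2 ≤ K * (1 + |p x|) ∨
      (1 + |x - r₃|) ^ 2 ≤ K * (1 + |p x|)) :
    ∑' l : ℤ, jb (p l) ^ (-(5 / 8) : ℝ) ≤
      ENNReal.ofReal K ^ (5 / 8 : ℝ) * (3 * (2 ^ (5 / 4 : ℝ) * intMass)) := by
  have key : ∀ x r, (1 + |x - r|) ^ 2 ≤ K * (1 + |p x|) →
      jb (p x) ^ (-(5 / 8) : ℝ) ≤ ENNReal.ofReal K ^ (5 / 8 : ℝ) * jb (x - r) ^ (-(5 / 4) : ℝ) := by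
    intro x r hx
    have h1 : jb (x - r) ^ (2 : ℝ) ≤ ENNReal.ofReal K * jb (p x) := by
      rw [jb_rpow, jb, ← ENNReal.ofReal_mul hK.le]
      exact ENNReal.ofReal_le_ofReal (by exact_mod_cast hx)
    have h2 := rpow_neg_le_mul_rpow_neg (s := 5 / 8) (by norm_num) (by simpa using hK)
      ENNReal.ofReal_ne_top h1
    rw [← ENNReal.rpow_mul] at h2
    convert h2 using 3
    norm_num
  calc ∑' l : ℤ, jb (p l) ^ (-(5 / 8) : ℝ)
      ≤ ∑' l : ℤ, ENNReal.ofReal K ^ (5 / 8 : ℝ) * (jb (l - r₁) ^ (-(5 / 4) : ℝ) +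
          jb (l - r₂) ^ (-(5 / 4) : ℝ) + jb (l - r₃) ^ (-(5 / 4) : ℝ)) := by
        refine ENNReal.tsum_le_tsum fun l => ?_
        rcases h l with h | h | h
        · refine (key _ _ h).trans ?_
          gcongr
          exact le_self_add.trans le_self_add
        · refine (key _ _ h).trans ?_
          gcongr
          exact le_add_self.trans le_self_add
        · refine (key _ _ h).trans ?_
          gcongr
          exact le_add_self
    _ ≤ _ := by
        rw [ENNReal.tsum_mul_left, ENNReal.tsum_add, ENNReal.tsum_add]
        gcongr
        calc _ ≤ 2 ^ (5 / 4 : ℝ) * intMass + 2 ^ (5 / 4 : ℝ) * intMass +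
              2 ^ (5 / 4 : ℝ) * intMass := by
              gcongr <;> exact tsum_jb_sub_le _
          _ = _ := by ring

/-- A monic quadratic polynomial is bounded below by the squared distance to two points. -/
lemma exists_sq_le_abs_quadratic (b c : ℝ) :
    ∃ r₁ r₂ : ℝ, ∀ x : ℝ, (x - r₁) ^ 2 ≤ |x ^ 2 + b * x + c| ∨ (x - r₂) ^ 2 ≤ |x ^ 2 + b * x + c| := by
  rcases le_total 0 (c - b ^ 2 / 4) with h | h
  · refine ⟨-b / 2, -b / 2, fun x => Or.inl ?_⟩
    refine le_trans ?_ (le_abs_self _)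
    nlinarith
  · obtain ⟨d, hd0, hd⟩ : ∃ d : ℝ, 0 ≤ d ∧ d ^ 2 = b ^ 2 / 4 - c :=
      ⟨√(b ^ 2 / 4 - c), Real.sqrt_nonneg _, Real.sq_sqrt (by linarith)⟩
    refine ⟨-b / 2 - d, -b / 2 + d, fun x => ?_⟩
    have e : x ^ 2 + b * x + c = (x - (-b / 2 - d)) * (x - (-b / 2 + d)) := by
      nlinarith
    rw [e, abs_mul, ← sq_abs, ← sq_abs (x - (-b / 2 + d))]
    rcases le_total |x - (-b / 2 - d)| |x - (-b / 2 + d)| with h | h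
    · left; nlinarith [abs_nonneg (x - (-b / 2 - d))]
    · right; nlinarith [abs_nonneg (x - (-b / 2 + d))]

lemma exists_root_cubic (p s : ℝ) : ∃ r : ℝ, r ^ 3 - p * r - s = 0 := by
  have hc : Continuous fun r : ℝ => r ^ 3 - p * r - s := by fun_prop
  set N : ℝ := 1 + |p| + |s| with hN
  have h1 : 0 ≤ N ^ 3 - p * N - s := by
    nlinarith [le_abs_self p, le_abs_self s, abs_nonneg p, abs_nonneg s, sq_nonneg N,
      mul_nonneg (abs_nonneg p) (abs_nonneg s), mul_nonneg (abs_nonneg p) (abs_nonneg p),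
      mul_nonneg (abs_nonneg s) (abs_nonneg s), mul_le_mul_of_nonneg_right (le_abs_self p)
        (show (0 : ℝ) ≤ N by positivity), mul_nonneg (show (0 : ℝ) ≤ N by positivity)
        (mul_nonneg (abs_nonneg p) (show (0 : ℝ) ≤ N by positivity))]
  have h2 : (-N) ^ 3 - p * (-N) - s ≤ 0 := by
    nlinarith [le_abs_self p, neg_abs_le s, abs_nonneg p, abs_nonneg s, sq_nonneg N,
      mul_nonneg (abs_nonneg p) (abs_nonneg s), mul_nonneg (abs_nonneg p) (abs_nonneg p),
      mul_nonneg (abs_nonneg s) (abs_nonneg s), mul_le_mul_of_nonneg_right (le_abs_self p)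
        (show (0 : ℝ) ≤ N by positivity), mul_nonneg (show (0 : ℝ) ≤ N by positivity)
        (mul_nonneg (abs_nonneg p) (show (0 : ℝ) ≤ N by positivity))]
  exact mem_range_of_exists_le_of_exists_ge hc ⟨-N, h2⟩ ⟨N, h1⟩

/-- Only quadratic growth is kept, through d² ≤ 1 + d³, so cubics and quadratics share the same
criterion `tsum_jb_rpow_le`. -/
lemma sq_one_add_le_of_cubic {a d y : ℝ} (ha : 0 < a) (hd : 0 ≤ d) (h : a * d ^ 3 ≤ y) :
    (1 + d) ^ 2 ≤ (8 + 4 / a) * (1 + y) := by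
  have h1 : d ^ 3 ≤ y / a := by rw [le_div_iff₀ ha]; linarith
  have h2 : d ^ 2 ≤ 1 + d ^ 3 := by
    rcases le_total d 1 with h | h
    · nlinarith [pow_nonneg hd 3]
    · nlinarith [sq_nonneg d]
  have hy : 0 ≤ y := le_trans (by positivity) h
  have h3 : (8 + 4 / a) * (1 + y) = 8 + 8 * y + 4 / a + 4 * (y / a) := by ring
  have : 0 < 4 / a := by positivity
  nlinarith [sq_nonneg (1 - d)]

lemma sq_one_add_le_of_quadratic {a d y : ℝ} (ha : 0 < a) (h : a * d ^ 2 ≤ y) :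
    (1 + d) ^ 2 ≤ (8 + 4 / a) * (1 + y) := by
  have h1 : d ^ 2 ≤ y / a := by rw [le_div_iff₀ ha]; linarith
  have hy : 0 ≤ y := le_trans (by positivity) h
  have h3 : (8 + 4 / a) * (1 + y) = 8 + 8 * y + 4 / a + 4 * (y / a) := by ring
  have : 0 < 4 / a := by positivity
  nlinarith [sq_nonneg (1 - d)]

/-- The bound for the lattice sums of `⟨p⟩^{-5/8}`, where `p` is a cubic or quadratic polynomial
with leading coefficient at least `a`. -/
noncomputable def latticeConst (a : ℝ) : ℝ≥0∞ :=
  ENNReal.ofReal (8 + 4 / a) ^ (5 / 8 : ℝ) * (3 * (2 ^ (5 / 4 : ℝ) * intMass))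

lemma latticeConst_ne_top (a : ℝ) : latticeConst a ≠ ⊤ := by
  unfold latticeConst
  have := intMass_ne_top
  finiteness

/-- A cubic has a real root r; dividing by x - r leaves a quadratic bounded below by a squared
distance. So the cubic is at least `a` times the cube of the distance to one of three points. The
bound depends on `a` only, not on `b` or `s`. -/
lemma tsum_jb_cubic_le {a : ℝ} (ha : 0 < a) (b s : ℝ) :
    ∑' l : ℤ, jb (a * (l : ℝ) ^ 3 - b * l - s) ^ (-(5 / 8) : ℝ) ≤ latticeConst a := by
  obtain ⟨r, hr⟩ := exists_root_cubic (b / a) (s / a)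
  obtain ⟨r₁, r₂, hQ⟩ := exists_sq_le_abs_quadratic r (r ^ 2 - b / a)
  refine tsum_jb_rpow_le (p := fun x => a * x ^ 3 - b * x - s) (by positivity) (r₁ := r) (r₂ := r₁)
    (r₃ := r₂) fun x => ?_
  have e : a * x ^ 3 - b * x - s = a * ((x - r) * (x ^ 2 + r * x + (r ^ 2 - b / a))) := by
    have : a * x ^ 3 - b * x - s = a * (x ^ 3 - b / a * x - s / a) := by field_simp
    rw [this]
    congr 1
    linear_combination hr
  have main : ∀ d : ℝ, 0 ≤ d → d ≤ |x - r| → d ^ 2 ≤ |x ^ 2 + r * x + (r ^ 2 - b / a)| →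
      (1 + d) ^ 2 ≤ (8 + 4 / a) * (1 + |a * x ^ 3 - b * x - s|) := by
    intro d hd h1 h2
    refine sq_one_add_le_of_cubic ha hd ?_
    rw [e, abs_mul, abs_mul, abs_of_pos ha]
    calc a * d ^ 3 = a * (d * d ^ 2) := by ring
      _ ≤ _ := by gcongr
  have main' : ∀ r' : ℝ, (x - r') ^ 2 ≤ |x ^ 2 + r * x + (r ^ 2 - b / a)| →
      (1 + |x - r|) ^ 2 ≤ (8 + 4 / a) * (1 + |a * x ^ 3 - b * x - s|) ∨
      (1 + |x - r'|) ^ 2 ≤ (8 + 4 / a) * (1 + |a * x ^ 3 - b * x - s|) := by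
    intro r' h
    rcases le_total |x - r| |x - r'| with h' | h'
    · left
      refine main _ (abs_nonneg _) le_rfl (le_trans ?_ h)
      rw [← sq_abs (x - r')]
      gcongr
    · right
      exact main _ (abs_nonneg _) h' (by rwa [sq_abs])
  rcases hQ x with h | h
  · rcases main' _ h with h | h
    · exact Or.inl h
    · exact Or.inr (Or.inl h)
  · rcases main' _ h with h | h
    · exact Or.inl h
    · exact Or.inr (Or.inr h)

lemma tsum_jb_quadratic_le {a A : ℝ} (ha : 0 < a) (hA : a ≤ |A|) (b c : ℝ) :
    ∑' l : ℤ, jb (A * ((l : ℝ) ^ 2 + b * l + c)) ^ (-(5 / 8) : ℝ) ≤ latticeConst a := by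
  obtain ⟨r₁, r₂, hQ⟩ := exists_sq_le_abs_quadratic b c
  refine tsum_jb_rpow_le (p := fun x => A * (x ^ 2 + b * x + c)) (by positivity) (r₁ := r₁)
    (r₂ := r₂) (r₃ := r₂) fun x => ?_
  have main : ∀ r, (x - r) ^ 2 ≤ |x ^ 2 + b * x + c| →
      (1 + |x - r|) ^ 2 ≤ (8 + 4 / a) * (1 + |A * (x ^ 2 + b * x + c)|) := by
    intro r h
    refine sq_one_add_le_of_quadratic ha ?_
    rw [abs_mul, sq_abs]
    gcongr
  rcases hQ x with h | h
  · exact Or.inl (main _ h)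
  · exact Or.inr (Or.inl (main _ h))

end DSW

/-! ### The Drinfeld–Sokolov–Wilson system and its resonance function -/

namespace DSW

/-- The dispersion relation `ξ³ - m ξ` at the frequency `ξ = h k`. -/
def disp (h m : ℝ) (k : ℤ) : ℝ := (h * k) ^ 3 - m * (h * k)

lemma disp_neg (h m : ℝ) (k : ℤ) : disp h m (-k) = -disp h m k := by
  unfold disp; push_cast; ring

/-- The Drinfeld–Sokolov–Wilson system for the Fourier coefficients in the interaction picture,
with time scaled by `lam`. The index `inl k` stands for the `k`-th coefficient of `u`, the index
`inr n` for the `n`-th coefficient of `v`. -/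
noncomputable def dswSys (h m lam : ℝ) : QSys (ℤ ⊕ ℤ) ((ℤ × ℤ) ⊕ (ℤ × ℤ)) where
  out := Sum.elim (fun p => .inl p.1) (fun p => .inr (p.1 + p.2))
  inl := Sum.elim (fun p => .inl (p.1 - p.2)) (fun p => .inl p.1)
  inr := Sum.elim (fun p => .inr p.2) (fun p => .inl p.2)
  -- The interaction with the zero mode of v is removed: the mean sits in the dispersion relation.
  -- It would have Φ = 0 and an unbounded multiplier.
  M := Sum.elim (fun p => if p.2 = 0 then 0 else -Complex.I * (((h * p.1) / lam : ℝ) : ℂ))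
    (fun p => -Complex.I * (((h * (p.1 + p.2)) / (2 * lam) : ℝ) : ℂ))
  Φ := Sum.elim (fun p => (disp h m (p.1 - p.2) - disp h m p.1) / lam)
    (fun p => (disp h m p.1 + disp h m p.2) / lam)

lemma one_le_abs_int_cast {n : ℤ} (hn : n ≠ 0) : (1 : ℝ) ≤ |(n : ℝ)| := by
  exact_mod_cast Int.one_le_abs hn

/-- Since |n| ≥ 1, the phase D bounds h|Q - m|, so Q ≤ R + |D|/h. A phase is therefore small only
for output frequencies bounded in terms of R and h. -/
lemma sq_le_of_resonance {h R x D Q : ℝ} (hh : 0 < h) {n : ℤ} (hn : n ≠ 0) {m : ℝ} (hm : |m| ≤ R)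
    (hQ : x ^ 2 / 4 ≤ Q) (hD : |D| = h * |(n : ℝ)| * |Q - m|) :
    x ^ 2 ≤ 4 * (1 / h + R) * (1 + |D|) := by
  have h1 : Q - m ≤ |Q - m| := le_abs_self _
  have h2 : m ≤ R := (le_abs_self m).trans hm
  have hR : 0 ≤ R := (abs_nonneg m).trans hm
  have h3 : h * |Q - m| ≤ |D| := by
    rw [hD]
    have := one_le_abs_int_cast hn
    have : 0 ≤ h * |Q - m| := by positivity
    nlinarith
  have h4 : |Q - m| ≤ 1 / h * |D| := by
    rw [div_mul_eq_mul_div, one_mul, le_div_iff₀ hh]; linarith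
  have h5 : 0 ≤ 1 / h := by positivity
  have h6 : 0 ≤ R * |D| := by positivity
  nlinarith

lemma tsum_sum_elim (G₁ G₂ : ℤ → ℝ≥0∞) :
    ∑' x, Sum.elim G₁ G₂ x = (∑' l, G₁ l) + ∑' l, G₂ l := by
  rw [Summable.tsum_sum (f := Sum.elim G₁ G₂) ENNReal.summable ENNReal.summable]
  rfl

/-- With one index of an interaction fixed, a second one determines it. The sum over the fibre is
thus dominated by a sum over all frequencies of u and of v. -/
lemma tsum_fiber_le_sum {ι E : Type*} {π : E → ι} {i : ι} {f : E → ℝ≥0∞} {ψ : E → ℤ ⊕ ℤ}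
    (hinj : Function.Injective fun e => (π e, ψ e)) {G₁ G₂ : ℤ → ℝ≥0∞} {B : ℝ≥0∞}
    (hf : ∀ e, π e = i → f e ≤ Sum.elim G₁ G₂ (ψ e)) (h₁ : ∑' l, G₁ l ≤ B) (h₂ : ∑' l, G₂ l ≤ B) :
    ∑' e : π ⁻¹' {i}, f e ≤ 2 * B := by
  calc ∑' e : π ⁻¹' {i}, f e ≤ ∑' e : π ⁻¹' {i}, Sum.elim G₁ G₂ (ψ e) :=
        ENNReal.tsum_le_tsum fun e => hf e e.2
    _ ≤ ∑' x, Sum.elim G₁ G₂ x := by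
        refine ENNReal.tsum_comp_le_tsum_of_injective (f := fun e : π ⁻¹' {i} => ψ e) ?_ _
        intro a b hab
        have ha : π a = i := a.2
        have hb : π b = i := b.2
        exact Subtype.ext (hinj (by simp only [ha, hb]; simpa using hab))
    _ ≤ B + B := by rw [tsum_sum_elim]; gcongr
    _ = 2 * B := by ring

section Small

variable {h m lam R : ℝ} (hh : 0 < h) (hlam : 1 ≤ lam) (hm : |m| ≤ R)

include hh hlam hm

/-- The factorisations of a³ - b³ and a³ + b³. In both cases the quadratic factor is at least a
quarter of the square of the output frequency: a² + ab + b² ≥ a²/4 and a² - ab + b² ≥ (a + b)²/4.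
Slowing time down by lam ≥ 1 divides the constant by lam. -/
lemma dswSys_norm_M_sq_le (e : (ℤ × ℤ) ⊕ (ℤ × ℤ)) :
    ‖(dswSys h m lam).M e‖ ^ 2 ≤ 4 * (1 / h + R) / lam * (1 + |(dswSys h m lam).Φ e|) := by
  have hR : 0 ≤ R := (abs_nonneg m).trans hm
  have l0 : 0 < lam := by linarith
  have scale : ∀ x D : ℝ, x ^ 2 ≤ 4 * (1 / h + R) * (1 + |D|) →
      (|x| / lam) ^ 2 ≤ 4 * (1 / h + R) / lam * (1 + |D / lam|) := by
    intro x D hx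
    rw [abs_div, abs_of_pos l0, div_pow, sq_abs]
    calc x ^ 2 / lam ^ 2 ≤ 4 * (1 / h + R) * (1 + |D|) / lam ^ 2 := by gcongr
      _ ≤ 4 * (1 / h + R) * (lam + |D|) / lam ^ 2 := by gcongr
      _ = _ := by field_simp
  rcases e with ⟨k, n⟩ | ⟨k, l⟩
  · by_cases hn : n = 0
    · simp only [dswSys, Sum.elim_inl, hn, if_true, norm_zero, zero_pow two_ne_zero]
      positivity
    · simp only [dswSys, Sum.elim_inl, hn, if_false, norm_mul, norm_neg, Complex.norm_I, one_mul,
        Complex.norm_real, Real.norm_eq_abs, abs_div, abs_of_pos l0]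
      have := scale (h * k) (disp h m (k - n) - disp h m k) (sq_le_of_resonance hh hn hm
        (Q := (h * k) ^ 2 + (h * k) * (h * (k - n)) + (h * (k - n)) ^ 2) (by
          nlinarith [sq_nonneg (h * (k - n) + h * k / 2 : ℝ), sq_nonneg (h * k : ℝ)]) (by
          rw [show disp h m (k - n) - disp h m k = -(h * n * ((h * k) ^ 2 + (h * k) * (h * (k - n)) +
            (h * (k - n)) ^ 2 - m)) by unfold disp; push_cast; ring, abs_neg, abs_mul, abs_mul,
            abs_of_pos hh]))
      simpa [abs_div, abs_of_pos l0] using this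
  · by_cases hn : k + l = 0
    · have : (k : ℝ) + l = 0 := by exact_mod_cast hn
      simp only [dswSys, Sum.elim_inr, this]
      simp only [mul_zero, zero_div, Complex.ofReal_zero, norm_zero, zero_pow two_ne_zero]
      positivity
    · simp only [dswSys, Sum.elim_inr, norm_mul, norm_neg, Complex.norm_I, one_mul,
        Complex.norm_real, Real.norm_eq_abs]
      have := scale (h * (k + l)) (disp h m k + disp h m l) (sq_le_of_resonance hh hn hm
        (Q := (h * k) ^ 2 - (h * k) * (h * l) + (h * l) ^ 2) (by
          nlinarith [sq_nonneg (h * k - h * l : ℝ)]) (by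
          rw [show disp h m k + disp h m l = h * ((k + l : ℤ) : ℝ) * ((h * k) ^ 2 - (h * k) * (h * l)
            + (h * l) ^ 2 - m) by unfold disp; push_cast; ring, abs_mul, abs_mul,
            abs_of_pos hh]))
      refine le_trans ?_ this
      rw [abs_div, abs_of_pos (by positivity : 0 < 2 * lam)]
      have : |h * ((k : ℝ) + l)| / (2 * lam) ≤ |h * ((k : ℝ) + l)| / lam := by
        gcongr; linarith
      gcongr

/-- The smallness constant of the system with rescaled time. -/
noncomputable def dswEps (h R lam : ℝ) : ℝ≥0∞ :=
  2 * (ENNReal.ofReal (4 * (1 / h + R) / lam) * ENNReal.ofReal lam ^ (5 / 8 : ℝ) *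
    latticeConst (h ^ 3))

omit hh hlam hm in
lemma dswEps_ne_top : dswEps h R lam ≠ ⊤ := by
  unfold dswEps
  have := latticeConst_ne_top (h ^ 3)
  finiteness

/-- The gain contributes 1/lam. Undoing the scaling inside the bracket costs lam^{5/8}, because ⟨lam
x⟩ ≤ lam⟨x⟩ for lam ≥ 1. The net power is lam^{-3/8}. -/
lemma dswSys_gain_mul_le (e : (ℤ × ℤ) ⊕ (ℤ × ℤ)) (s : ℝ) :
    (dswSys h m lam).gain e * jb ((dswSys h m lam).Φ e - s) ^ (-(5 / 8) : ℝ) ≤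
      ENNReal.ofReal (4 * (1 / h + R) / lam) * ENNReal.ofReal lam ^ (5 / 8 : ℝ) *
        jb (lam * (dswSys h m lam).Φ e - lam * s) ^ (-(5 / 8) : ℝ) := by
  have l0 : 0 < lam := by linarith
  have hR : 0 ≤ R := (abs_nonneg m).trans hm
  rw [mul_assoc]
  gcongr
  · unfold QSys.gain
    rw [ENNReal.rpow_neg_one]
    rw [ENNReal.mul_inv_le_iff (jb_ne_zero _) (jb_ne_top _), jb, ← ENNReal.ofReal_mul (by positivity),
      ← ofReal_norm, ← ENNReal.ofReal_pow (norm_nonneg _)]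
    exact ENNReal.ofReal_le_ofReal (dswSys_norm_M_sq_le hh hlam hm e)
  · refine rpow_neg_le_mul_rpow_neg (by norm_num) (by simpa using l0) ENNReal.ofReal_ne_top ?_
    rw [jb, jb, ← ENNReal.ofReal_mul l0.le]
    refine ENNReal.ofReal_le_ofReal ?_
    rw [← mul_sub, abs_mul, abs_of_pos l0]
    nlinarith [abs_nonneg ((dswSys h m lam).Φ e - s)]

omit hm hlam in
lemma disp_sub_disp (n k : ℤ) : disp h m k - disp h m (k - n) =
    3 * h ^ 3 * n * ((k : ℝ) ^ 2 + -n * k + ((n : ℝ) ^ 2 / 3 - m / (3 * h ^ 2))) := by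
  unfold disp
  push_cast
  field_simp
  ring

omit hlam hm in
lemma tsum_jb_disp_le (s : ℝ) : ∑' l, jb (disp h m l - s) ^ (-(5 / 8) : ℝ) ≤ latticeConst (h ^ 3) := by
  refine le_trans (le_of_eq (tsum_congr fun l => ?_)) (tsum_jb_cubic_le (pow_pos hh 3) (m * h) s)
  unfold disp
  ring_nf

-- In the difference of dispersion relations at distance n the cubes cancel and leave a quadratic
-- with leading coefficient 3h³n, which is at least h³ in size because n is a nonzero integer.
omit hlam hm in
lemma tsum_jb_disp_sub_disp_le {n : ℤ} (hn : n ≠ 0) (s : ℝ) :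
    ∑' k, jb (disp h m k - disp h m (k - n) - s) ^ (-(5 / 8) : ℝ) ≤ latticeConst (h ^ 3) := by
  have hn' : (n : ℝ) ≠ 0 := by exact_mod_cast hn
  refine le_trans (le_of_eq (tsum_congr fun k => ?_)) (tsum_jb_quadratic_le (pow_pos hh 3)
    (A := 3 * h ^ 3 * n) ?_ (-n) ((n : ℝ) ^ 2 / 3 - m / (3 * h ^ 2) - s / (3 * h ^ 3 * n)))
  · rw [disp_sub_disp hh]
    congr 2
    field_simp
    ring
  · rw [abs_mul, abs_of_pos (by positivity : 0 < 3 * h ^ 3)]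
    have := one_le_abs_int_cast hn
    have : 0 < h ^ 3 := by positivity
    nlinarith

/-- If the fixed index is a frequency of u, the phase is a cubic in the free frequency; if it is a
frequency n of v, as output or as input, the phase is a quadratic, degenerate only for n = 0. There
the multiplier vanishes: by convention for the input, through the derivative for the output. -/
lemma dswSys_small : (dswSys h m lam).Small (dswEps h R lam) := by
  have l0 : lam ≠ 0 := by linarith
  have hinl : Function.Injective fun e => ((dswSys h m lam).out e, (dswSys h m lam).inl e) := by
    rintro (⟨k, n⟩ | ⟨k, n⟩) (⟨k', n'⟩ | ⟨k', n'⟩) hab <;>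
      simp only [dswSys, Sum.elim_inl, Sum.elim_inr, Prod.mk.injEq, Sum.inl.injEq, Sum.inr.injEq,
        reduceCtorEq, false_and] at hab ⊢ <;> omega
  have hinr : Function.Injective fun e => ((dswSys h m lam).out e, (dswSys h m lam).inr e) := by
    rintro (⟨k, n⟩ | ⟨k, n⟩) (⟨k', n'⟩ | ⟨k', n'⟩) hab <;>
      simp only [dswSys, Sum.elim_inl, Sum.elim_inr, Prod.mk.injEq, Sum.inl.injEq, Sum.inr.injEq,
        reduceCtorEq, false_and] at hab ⊢ <;> omega
  have hin : Function.Injective fun e => ((dswSys h m lam).inl e, (dswSys h m lam).inr e) := by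
    rintro (⟨k, n⟩ | ⟨k, n⟩) (⟨k', n'⟩ | ⟨k', n'⟩) hab <;>
      simp only [dswSys, Sum.elim_inl, Sum.elim_inr, Prod.mk.injEq, Sum.inl.injEq, Sum.inr.injEq,
        reduceCtorEq, and_false] at hab ⊢ <;> omega
  set D := ENNReal.ofReal (4 * (1 / h + R) / lam) * ENNReal.ofReal lam ^ (5 / 8 : ℝ) with hD
  have hterm := dswSys_gain_mul_le hh hlam hm
  have hzero : ∀ e s, (dswSys h m lam).M e = 0 →
      (dswSys h m lam).gain e * jb ((dswSys h m lam).Φ e - s) ^ (-(5 / 8) : ℝ) = 0 := by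
    intro e s he
    simp [QSys.gain, he]
  have hM0 : ∀ k, (dswSys h m lam).M (.inl (k, 0)) = 0 := fun k => by simp [dswSys]
  have hM0' : ∀ k l, k + l = 0 → (dswSys h m lam).M (.inr (k, l)) = 0 := fun k l hkl => by
    have : (k : ℝ) + l = 0 := by exact_mod_cast hkl
    simp only [dswSys, Sum.elim_inr, this, mul_zero, zero_div, Complex.ofReal_zero]
  have hΦ : ∀ k n, lam * (dswSys h m lam).Φ (.inl (k, n)) = disp h m (k - n) - disp h m k :=
    fun k n => mul_div_cancel₀ _ l0
  have hΦ' : ∀ k n, lam * (dswSys h m lam).Φ (.inr (k, n)) = disp h m k + disp h m n :=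
    fun k n => mul_div_cancel₀ _ l0
  have hcub : ∀ s, ∑' l, D * jb (disp h m l - s) ^ (-(5 / 8) : ℝ) ≤ D * latticeConst (h ^ 3) := by
    intro s
    rw [ENNReal.tsum_mul_left]
    gcongr
    exact tsum_jb_disp_le hh s
  have hquad : ∀ (n : ℤ) s, ∑' k, (if n = 0 then 0 else
      D * jb (disp h m k - disp h m (k - n) - s) ^ (-(5 / 8) : ℝ)) ≤ D * latticeConst (h ^ 3) := by
    intro n s
    split_ifs with hn
    · simp
    · rw [ENNReal.tsum_mul_left]
      gcongr
      exact tsum_jb_disp_sub_disp_le hh hn s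
  have hnil : ∑' _ : ℤ, (0 : ℝ≥0∞) ≤ D * latticeConst (h ^ 3) := by simp
  refine ⟨hin, hinl, hinr, fun i s => ?_, fun i s => ?_, fun i s => ?_, fun i => ?_⟩
  · rcases i with k | n
    · refine tsum_fiber_le_sum (f := fun e => (dswSys h m lam).gain e *
        jb ((dswSys h m lam).Φ e - s) ^ (-(5 / 8) : ℝ)) (G₁ := fun l => D * jb (disp h m l - (disp h m k + lam * s)) ^
        (-(5 / 8) : ℝ)) (G₂ := fun _ => 0) hinl (fun e he => ?_) (hcub _) hnil
      rcases e with ⟨k', n⟩ | ⟨k', n⟩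
      · obtain rfl : k' = k := by simpa [dswSys] using he
        refine (hterm _ s).trans (le_of_eq ?_)
        rw [hΦ]
        simp only [dswSys, Sum.elim_inl]
        congr 3
        ring
      · simp [dswSys] at he
    · refine tsum_fiber_le_sum (f := fun e => (dswSys h m lam).gain e *
        jb ((dswSys h m lam).Φ e - s) ^ (-(5 / 8) : ℝ)) (G₁ := fun k => if n = 0 then 0 else
        D * jb (disp h m k - disp h m (k - n) - lam * s) ^ (-(5 / 8) : ℝ)) (G₂ := fun _ => 0)
        hinl (fun e he => ?_) (hquad n (lam * s)) hnil
      rcases e with ⟨k', n'⟩ | ⟨k, l⟩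
      · simp [dswSys] at he
      · have hn : k + l = n := by simpa [dswSys] using he
        by_cases hn0 : n = 0
        · rw [hzero _ _ (hM0' _ _ (hn.trans hn0))]
          exact zero_le
        · refine (hterm _ s).trans (le_of_eq ?_)
          rw [hΦ', show l = -(k - n) by omega, disp_neg]
          simp only [dswSys, Sum.elim_inr, Sum.elim_inl, if_neg hn0]
          congr 3
  · rcases i with l | n
    · refine tsum_fiber_le_sum (f := fun e => (dswSys h m lam).gain e *
        jb ((dswSys h m lam).Φ e - s) ^ (-(5 / 8) : ℝ)) (ψ := Sum.elim (fun p : ℤ × ℤ => .inl p.1) (fun p : ℤ × ℤ => .inr p.2))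
        (G₁ := fun k => D * jb (disp h m k - (disp h m l - lam * s)) ^ (-(5 / 8) : ℝ))
        (G₂ := fun k => D * jb (disp h m k - (-disp h m l + lam * s)) ^ (-(5 / 8) : ℝ)) ?_
        (fun e he => ?_) (hcub _) (hcub _)
      · rintro (⟨k, n⟩ | ⟨k, n⟩) (⟨k', n'⟩ | ⟨k', n'⟩) hab <;>
          simp only [dswSys, Sum.elim_inl, Sum.elim_inr, Prod.mk.injEq, Sum.inl.injEq, Sum.inr.injEq,
            reduceCtorEq, and_false] at hab ⊢ <;> omega
      · rcases e with ⟨k, n⟩ | ⟨k, n⟩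
        · have hl : k - n = l := by simpa [dswSys] using he
          refine (hterm _ s).trans (le_of_eq ?_)
          rw [hΦ, hl, ← jb_neg]
          simp only [Sum.elim_inl]
          congr 3
          ring
        · obtain rfl : k = l := by simpa [dswSys] using he
          refine (hterm _ s).trans (le_of_eq ?_)
          rw [hΦ']
          simp only [Sum.elim_inr]
          congr 3
          ring
    · refine tsum_fiber_le_sum (f := fun e => (dswSys h m lam).gain e *
        jb ((dswSys h m lam).Φ e - s) ^ (-(5 / 8) : ℝ)) (G₁ := fun _ => 0) (G₂ := fun _ => 0) (hin) (fun e he => ?_) hnil hnil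
      rcases e with ⟨k, n⟩ | ⟨k, n⟩ <;> simp [dswSys] at he
  · rcases i with l | n
    · refine tsum_fiber_le_sum (f := fun e => (dswSys h m lam).gain e *
        jb ((dswSys h m lam).Φ e - s) ^ (-(5 / 8) : ℝ)) (ψ := Sum.elim (fun p : ℤ × ℤ => .inl p.1) (fun p : ℤ × ℤ => .inr p.1))
        (G₁ := fun _ => 0)
        (G₂ := fun k => D * jb (disp h m k - (-disp h m l + lam * s)) ^ (-(5 / 8) : ℝ)) ?_
        (fun e he => ?_) hnil (hcub _)
      · rintro (⟨k, n⟩ | ⟨k, n⟩) (⟨k', n'⟩ | ⟨k', n'⟩) hab <;>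
          simp only [dswSys, Sum.elim_inl, Sum.elim_inr, Prod.mk.injEq, Sum.inl.injEq, Sum.inr.injEq,
            reduceCtorEq, and_false] at hab ⊢ <;> omega
      · rcases e with ⟨k, n⟩ | ⟨k, n⟩
        · simp [dswSys] at he
        · obtain rfl : n = l := by simpa [dswSys] using he
          refine (hterm _ s).trans (le_of_eq ?_)
          rw [hΦ']
          simp only [Sum.elim_inr]
          congr 3
          ring
    · refine tsum_fiber_le_sum (f := fun e => (dswSys h m lam).gain e *
        jb ((dswSys h m lam).Φ e - s) ^ (-(5 / 8) : ℝ)) (ψ := Sum.elim (fun p : ℤ × ℤ => .inl p.1) (fun p : ℤ × ℤ => .inr p.1))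
        (G₁ := fun k => if n = 0 then 0 else
          D * jb (disp h m k - disp h m (k - n) - -(lam * s)) ^ (-(5 / 8) : ℝ))
        (G₂ := fun _ => 0) ?_ (fun e he => ?_) (hquad n _) hnil
      · rintro (⟨k, n⟩ | ⟨k, n⟩) (⟨k', n'⟩ | ⟨k', n'⟩) hab <;>
          simp only [dswSys, Sum.elim_inl, Sum.elim_inr, Prod.mk.injEq, Sum.inl.injEq, Sum.inr.injEq,
            reduceCtorEq, and_false] at hab ⊢ <;> omega
      · rcases e with ⟨k, n'⟩ | ⟨k, l⟩
        · obtain rfl : n' = n := by simpa [dswSys] using he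
          by_cases hn0 : n' = 0
          · subst hn0
            rw [hzero _ _ (hM0 k)]
            exact zero_le
          · refine (hterm _ s).trans (le_of_eq ?_)
            rw [hΦ, ← jb_neg]
            simp only [Sum.elim_inl, if_neg hn0]
            congr 3
            ring
        · simp [dswSys] at he
  · rcases i with k | n
    · refine ⟨|h * k / lam|, fun e he => ?_⟩
      rcases e with ⟨k', n⟩ | ⟨k', n⟩
      · obtain rfl : k' = k := by simpa [dswSys] using he
        simp only [dswSys, Sum.elim_inl]
        split_ifs
        · simp
        · rw [norm_mul, norm_neg, Complex.norm_I, one_mul, Complex.norm_real, Real.norm_eq_abs]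
      · simp [dswSys] at he
    · refine ⟨|h * n / (2 * lam)|, fun e he => ?_⟩
      rcases e with ⟨k, l⟩ | ⟨k, l⟩
      · simp [dswSys] at he
      · have hn : k + l = n := by simpa [dswSys] using he
        simp only [dswSys, Sum.elim_inr]
        rw [norm_mul, norm_neg, Complex.norm_I, one_mul, Complex.norm_real, Real.norm_eq_abs, ← hn]
        push_cast
        exact le_rfl

end Small

/-- Real solutions are preserved: the frequencies `k` and `-k` are conjugate. -/
noncomputable def dswSymm (h m lam : ℝ) : (dswSys h m lam).Symm where
  bar := Sum.map Neg.neg Neg.neg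
  ebar := Sum.map Neg.neg Neg.neg
  bar_bar := by rintro (k | k) <;> simp
  ebar_ebar := by rintro (k | k) <;> simp
  out_ebar := by rintro (k | k) <;> simp [dswSys]; ring
  inl_ebar := by rintro (k | k) <;> simp [dswSys]; ring
  inr_ebar := by rintro (k | k) <;> simp [dswSys]
  M_ebar := by
    rintro (⟨k, n⟩ | ⟨k, n⟩)
    · simp only [dswSys, Sum.map_inl, Sum.elim_inl, Prod.neg_mk, neg_eq_zero]
      split_ifs
      · simp
      · rw [map_mul, map_neg, Complex.conj_I, Complex.conj_ofReal]
        push_cast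
        ring
    · simp only [dswSys, Sum.map_inr, Sum.elim_inr, Prod.neg_mk]
      rw [map_mul, map_neg, Complex.conj_I, Complex.conj_ofReal]
      push_cast
      ring
  Φ_ebar := by
    rintro (⟨k, n⟩ | ⟨k, n⟩)
    · simp only [dswSys, Sum.map_inl, Sum.elim_inl, Prod.neg_mk, disp_neg,
        show -k - -n = -(k - n) by ring]
      ring
    · simp only [dswSys, Sum.map_inr, Sum.elim_inr, Prod.neg_mk, disp_neg]
      ring

end DSW

/-! ### Smallness for slow time, and conservation of energy -/

namespace DSW

lemma eventually_dswEps_mul_le (h R : ℝ) {B : ℝ≥0∞} (hB : B ≠ ⊤) :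
    ∀ᶠ lam in Filter.atTop, dswEps h R lam * B ≤ 1 := by
  have h1 : Filter.Tendsto (fun lam : ℝ => ENNReal.ofReal (4 * (1 / h + R) * lam ^ (-(3 / 8) : ℝ)))
      Filter.atTop (𝓝 0) := by
    have := (tendsto_rpow_neg_atTop (y := 3 / 8) (by norm_num)).const_mul (4 * (1 / h + R))
    rw [mul_zero] at this
    simpa using ENNReal.tendsto_ofReal this
  have h2 : Filter.Tendsto (fun lam : ℝ => dswEps h R lam * B) Filter.atTop (𝓝 0) := by
    have h3 := ENNReal.Tendsto.mul_const (b := B) (ENNReal.Tendsto.const_mul (a := 2)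
      (ENNReal.Tendsto.mul_const (b := latticeConst (h ^ 3)) h1
      (Or.inr (latticeConst_ne_top _))) (Or.inr (by finiteness))) (Or.inr hB)
    rw [zero_mul, mul_zero, zero_mul] at h3
    refine h3.congr' ?_
    filter_upwards [Filter.eventually_gt_atTop 0] with lam hlam
    unfold dswEps
    congr 3
    rw [ENNReal.ofReal_rpow_of_pos hlam, ← ENNReal.ofReal_mul' (by positivity)]
    congr 1
    rw [div_mul_eq_mul_div, mul_div_assoc]
    congr 1
    rw [show (-(3 / 8) : ℝ) = 5 / 8 - 1 by norm_num, Real.rpow_sub_one hlam.ne']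
  exact h2.eventually_le_const zero_lt_one

/-- The change of variables which matches the two kinds of interactions. -/
def pairEquiv : ℤ × ℤ ≃ ℤ × ℤ where
  toFun p := (-p.1, p.1 - p.2)
  invFun p := (-p.1, -p.1 - p.2)
  left_inv p := by ext <;> simp
  right_inv p := by ext <;> simp

/-- The involution which exchanges the two frequencies of `u`. -/
def exchangeEquiv : ℤ × ℤ ≃ ℤ × ℤ where
  toFun p := (p.1 - p.2, -p.2)
  invFun p := (p.1 - p.2, -p.2)
  left_inv p := by ext <;> simp
  right_inv p := by ext <;> simp

lemma tsum_sum_eq_tsum_add {α : Type*} {f : α ⊕ α → ℂ} (hs : Summable f) (σ : α ≃ α) :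
    ∑' e, f e = ∑' p, (f (.inl p) + f (.inr (σ p))) := by
  have h1 := hs.comp_injective Sum.inl_injective
  have h2 := hs.comp_injective Sum.inr_injective
  rw [Summable.tsum_sum h1 h2, ← σ.tsum_eq (fun p => f (.inr p))]
  exact (h1.tsum_add (h2.comp_injective σ.injective)).symm

/-- The cancellation of ∫ u (uv)_x against ∫ v u u_x in Fourier variables. Each u-interaction (k, n)
is paired with the v-interaction (-k, k - n), which involves the same three coefficients of a real
state and has the same phase. -/
lemma dswSys_conservative {h m lam R : ℝ} (hh : 0 < h) (hlam : 1 ≤ lam) (hm : |m| ≤ R) :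
    (dswSys h m lam).Conservative (dswSymm h m lam) := by
  intro z hz hreal t
  have hs := QSys.summable_energy (dswSys_small hh hlam hm).inj_in hz t
  rw [tsum_sum_eq_tsum_add hs pairEquiv]
  -- The multipliers of a pair add up to a multiple of k - n/2, the average of the two frequencies k
  -- and k - n of u; this is symmetric under their exchange.
  set Z : ℤ × ℤ → ℂ := fun p => if p.2 = 0 then 0 else
    -Complex.I * ((h * (2 * p.1 - p.2) / (2 * lam) : ℝ) : ℂ) *
    (conj (z (.inl p.1)) * z (.inl (p.1 - p.2)) * z (.inr p.2) *
      Complex.exp (Complex.I * (((disp h m (p.1 - p.2) - disp h m p.1) / lam : ℝ) : ℂ) * t)) with hZ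
  have hbl : ∀ k : ℤ, z (.inl (-k)) = conj (z (.inl k)) := fun k => hreal (.inl k)
  have hbr : ∀ k : ℤ, z (.inr (-k)) = conj (z (.inr k)) := fun k => hreal (.inr k)
  have key : ∀ p : ℤ × ℤ, conj (z ((dswSys h m lam).out (.inl p))) * ((dswSys h m lam).M (.inl p) *
      Complex.exp (Complex.I * ((dswSys h m lam).Φ (.inl p) : ℂ) * (t : ℂ)) *
      (z ((dswSys h m lam).inl (.inl p)) * z ((dswSys h m lam).inr (.inl p)))) +
      conj (z ((dswSys h m lam).out (.inr (pairEquiv p)))) * ((dswSys h m lam).M (.inr (pairEquiv p)) *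
      Complex.exp (Complex.I * ((dswSys h m lam).Φ (.inr (pairEquiv p)) : ℂ) * (t : ℂ)) *
      (z ((dswSys h m lam).inl (.inr (pairEquiv p))) *
        z ((dswSys h m lam).inr (.inr (pairEquiv p))))) = Z p := by
    rintro ⟨k, n⟩
    simp only [hZ, dswSys, Sum.elim_inl, Sum.elim_inr, pairEquiv, Equiv.coe_fn_mk, hbl, disp_neg]
    rw [show -k + (k - n) = -n by ring, hbr, Complex.conj_conj,
      show -disp h m k + disp h m (k - n) = disp h m (k - n) - disp h m k by ring]
    by_cases hn : n = 0
    · simp [hn]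
    · rw [if_neg hn, if_neg hn]
      push_cast
      field_simp
      ring
  -- Exchanging k and k - n conjugates everything in `Z` except the factor -i, whose sign flips. The
  -- sum is therefore purely imaginary.
  have hT : ∑' p, Z p = -conj (∑' p, Z p) := by
    rw [Complex.conj_tsum, ← tsum_neg, ← exchangeEquiv.tsum_eq]
    refine tsum_congr fun p => ?_
    obtain ⟨k, n⟩ := p
    simp only [hZ, exchangeEquiv, Equiv.coe_fn_mk, neg_eq_zero]
    by_cases hn : n = 0
    · simp [hn]
    · rw [if_neg hn, if_neg hn]
      simp only [map_mul, map_neg, Complex.conj_I, Complex.conj_ofReal, ← Complex.exp_conj,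
        Complex.conj_conj, hbr, sub_neg_eq_add, sub_add_cancel]
      rw [show Complex.I * (((disp h m k - disp h m (k - n)) / lam : ℝ) : ℂ) * t =
        -Complex.I * (((disp h m (k - n) - disp h m k) / lam : ℝ) : ℂ) * t by push_cast; ring]
      push_cast
      ring
  rw [tsum_congr key]
  have := congrArg Complex.re hT
  simp only [Complex.neg_re, Complex.conj_re] at this
  linarith

end DSW

/-! ### Fourier coefficients of real square integrable functions -/

namespace DSW

variable {L : ℝ} [Fact (0 < L)]

local notation "μL" => AddCircle.haarAddCircle (T := L)

/-- The Fourier coefficients of a real-valued square integrable function. -/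
noncomputable def coef (f : L2 L) (k : ℤ) : ℂ := fourierCoeff (fun x => (f x : ℂ)) k

/-- A real-valued square integrable function as a complex-valued one. -/
noncomputable def toComplex (f : L2 L) : Lp ℂ 2 μL := Complex.ofRealCLM.compLp f

lemma coeFn_toComplex (f : L2 L) : toComplex f =ᵐ[μL] fun x => (f x : ℂ) :=
  Complex.ofRealCLM.coeFn_compLp f

lemma fourierCoeff_toComplex (f : L2 L) (k : ℤ) : fourierCoeff (toComplex f) k = coef f k := by
  rw [fourierCoeff_congr_ae (coeFn_toComplex f), coef]

lemma integrable_L2 (f : L2 L) : Integrable f μL := (Lp.memLp f).integrable (by norm_num)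

lemma integrable_ofReal_L2 (f : L2 L) : Integrable (fun x => (f x : ℂ)) μL :=
  (integrable_L2 f).ofReal

lemma hasSum_sq_coef (f : L2 L) : HasSum (fun k => ‖coef f k‖ ^ 2) (‖f‖ ^ 2) := by
  have h := hasSum_sq_fourierCoeff (toComplex f)
  simp_rw [fourierCoeff_toComplex] at h
  convert h using 1
  rw [← real_inner_self_eq_norm_sq, L2.inner_def]
  refine integral_congr_ae ?_
  filter_upwards [coeFn_toComplex f] with x hx
  rw [hx, Complex.norm_real]
  simp [sq]

lemma tsum_enorm_coef (f : L2 L) : ∑' k, ‖coef f k‖ₑ ^ 2 = ENNReal.ofReal (‖f‖ ^ 2) := by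
  have h := hasSum_sq_coef f
  rw [← h.tsum_eq, ENNReal.ofReal_tsum_of_nonneg (fun _ => by positivity) h.summable]
  refine tsum_congr fun k => ?_
  rw [← ofReal_norm, ENNReal.ofReal_pow (norm_nonneg _)]

lemma norm_coef_le (f : L2 L) (k : ℤ) : ‖coef f k‖ ≤ ‖f‖ :=
  abs_le_of_sq_le_sq' (((hasSum_sq_coef f).summable.le_tsum k fun _ _ => by positivity).trans_eq
    (hasSum_sq_coef f).tsum_eq) (norm_nonneg _) |>.2

lemma coef_add (f g : L2 L) (k : ℤ) : coef (f + g) k = coef f k + coef g k := by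
  have h : (fun x => ((f + g : L2 L) x : ℂ)) =ᵐ[μL] (fun x => (f x : ℂ)) + fun x => (g x : ℂ) := by
    filter_upwards [Lp.coeFn_add f g] with x hx
    rw [hx, Pi.add_apply, Pi.add_apply, Complex.ofReal_add]
  unfold coef
  rw [fourierCoeff_congr_ae h, fourierCoeff.add (integrable_ofReal_L2 f) (integrable_ofReal_L2 g)]
  rfl

lemma coef_smul (c : ℝ) (f : L2 L) (k : ℤ) : coef (c • f) k = c * coef f k := by
  have h : (fun x => ((c • f : L2 L) x : ℂ)) =ᵐ[μL] fun x => (c : ℂ) * (f x : ℂ) := by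
    filter_upwards [Lp.coeFn_smul c f] with x hx
    simp [hx]
  unfold coef
  rw [fourierCoeff_congr_ae h, fourierCoeff.const_mul]

lemma coef_sub (f g : L2 L) (k : ℤ) : coef (f - g) k = coef f k - coef g k := by
  rw [sub_eq_add_neg, coef_add, ← neg_one_smul ℝ g, coef_smul]
  push_cast
  ring

lemma coef_injective {f g : L2 L} (h : ∀ k, coef f k = coef g k) : f = g := by
  have h1 := hasSum_sq_coef (f - g)
  simp only [coef_sub, h, sub_self, norm_zero, zero_pow two_ne_zero] at h1
  have := h1.unique hasSum_zero
  exact sub_eq_zero.1 (norm_eq_zero.1 (pow_eq_zero_iff two_ne_zero |>.1 this))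

/-- The Fourier coefficients depend continuously on the function. -/
noncomputable def coefCLM (k : ℤ) : L2 L →L[ℝ] ℂ :=
  LinearMap.mkContinuous
    { toFun := fun f => coef f k
      map_add' := fun f g => coef_add f g k
      map_smul' := fun c f => by simp [coef_smul] } 1 fun f => by
        simpa using norm_coef_le f k

lemma continuous_coef (k : ℤ) : Continuous fun f : L2 L => coef f k := (coefCLM k).continuous

lemma fourierCoeff_ofReal_neg (w : AddCircle L → ℝ) (k : ℤ) :
    fourierCoeff (fun x => (w x : ℂ)) (-k) = conj (fourierCoeff (fun x => (w x : ℂ)) k) := by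
  unfold fourierCoeff
  rw [← integral_conj]
  refine integral_congr_ae (ae_of_all _ fun x => ?_)
  simp only [smul_eq_mul, map_mul, Complex.conj_ofReal, ← fourier_neg]

lemma coef_neg (f : L2 L) (k : ℤ) : coef f (-k) = conj (coef f k) := fourierCoeff_ofReal_neg _ k

lemma coef_zero_eq_mean (f : L2 L) : coef f 0 = (mean f : ℂ) := by
  unfold coef mean fourierCoeff
  simp only [neg_zero, fourier_zero, one_smul]
  exact integral_ofReal

/-- Riesz–Fischer gives a complex function; the symmetry of the coefficients ensures that taking its
real part does not change them. -/
lemma exists_coef_eq {c : ℤ → ℂ} (hc : ∑' k, ‖c k‖ₑ ^ 2 ≠ ⊤) (hreal : ∀ k, c (-k) = conj (c k)) :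
    ∃ f : L2 L, ∀ k, coef f k = c k := by
  have hs : Memℓp c 2 := by
    refine memℓp_gen ?_
    have h1 : Summable fun k => ‖c k‖ ^ 2 := by
      have h2 : ∑' k, ENNReal.ofReal (‖c k‖ ^ 2) ≠ ⊤ := by
        simpa only [ENNReal.ofReal_pow (norm_nonneg _), ofReal_norm] using hc
      have := ENNReal.summable_toReal h2
      simpa [ENNReal.toReal_ofReal] using this
    simpa using h1
  set F : Lp ℂ 2 μL := fourierBasis.repr.symm ⟨c, hs⟩ with hF
  have hFc : ∀ k, fourierCoeff F k = c k := fun k => by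
    rw [← fourierBasis_repr, hF, LinearIsometryEquiv.apply_symm_apply]
  refine ⟨Complex.reCLM.compLp F, fun k => ?_⟩
  have hInt : Integrable F μL := (Lp.memLp F).integrable (by norm_num)
  have h1 : (fun x => (((Complex.reCLM.compLp F : L2 L) x : ℝ) : ℂ)) =ᵐ[μL]
      (fun x => (1 / 2 : ℂ) * (F x + conj (F x))) := by
    filter_upwards [Complex.reCLM.coeFn_compLp F] with x hx
    rw [hx, Complex.add_conj]
    simp
  unfold coef
  rw [fourierCoeff_congr_ae h1, fourierCoeff.const_mul]
  have hInt' : Integrable (fun x => conj (F x)) μL := by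
    simpa using Complex.conjCLE.toContinuousLinearMap.integrable_comp hInt
  have h2 : fourierCoeff (fun x => F x + conj (F x)) k = fourierCoeff F k +
      fourierCoeff (fun x => conj (F x)) k := by
    have := fourierCoeff.add hInt hInt'
    exact congrFun this k
  have h3 : fourierCoeff (fun x => conj (F x)) k = conj (fourierCoeff F (-k)) := by
    unfold fourierCoeff
    rw [← integral_conj]
    refine integral_congr_ae (ae_of_all _ fun x => ?_)
    simp only [smul_eq_mul, map_mul, neg_neg, ← fourier_neg]
  rw [h2, h3, hFc, hFc, hreal, Complex.conj_conj]
  ring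

/-- The Fourier coefficients of a product of two square integrable functions. -/
noncomputable def prodCoef (f g : L2 L) (k : ℤ) : ℂ :=
  fourierCoeff (fun x => ((f x * g x : ℝ) : ℂ)) k

lemma integrable_mul_L2 (f g : L2 L) : Integrable (fun x => f x * g x) μL :=
  (Lp.memLp f).integrable_mul (Lp.memLp g)

lemma norm_prodCoef_le (f g : L2 L) (k : ℤ) : ‖prodCoef f g k‖ ≤ ‖f‖ * ‖g‖ := by
  have h1 : ‖prodCoef f g k‖ ≤ ∫ x, ‖f x‖ * ‖g x‖ ∂μL := by
    unfold prodCoef fourierCoeff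
    refine (norm_integral_le_integral_norm _).trans (le_of_eq ?_)
    refine integral_congr_ae (ae_of_all _ fun x => ?_)
    simp only [norm_smul, Complex.norm_real, norm_mul]
    rw [show ‖fourier (-k) x‖ = 1 from Circle.norm_coe _, one_mul]
  refine h1.trans ?_
  have h2 := real_inner_le_norm |f| |g|
  rw [norm_abs_eq_norm, norm_abs_eq_norm, L2.inner_def] at h2
  refine le_trans (le_of_eq ?_) h2
  refine integral_congr_ae ?_
  filter_upwards [Lp.coeFn_abs f, Lp.coeFn_abs g] with x hf hg
  simp [hf, hg, mul_comm]

lemma fourierCoeff_ofReal_add {w w' : AddCircle L → ℝ} (h : Integrable w μL) (h' : Integrable w' μL)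
    (k : ℤ) : fourierCoeff (fun x => ((w x + w' x : ℝ) : ℂ)) k =
      fourierCoeff (fun x => (w x : ℂ)) k + fourierCoeff (fun x => (w' x : ℂ)) k := by
  have := congrFun (fourierCoeff.add (h.ofReal (𝕜 := ℂ)) (h'.ofReal (𝕜 := ℂ))) k
  rw [Pi.add_apply] at this
  refine Eq.trans ?_ this
  congr 1
  ext x
  simp

/-- Its use is continuity: the Fourier coefficients of the nonlinearity are continuous in time along
continuous curves in L². -/
lemma isBoundedBilinearMap_prodCoef (k : ℤ) :
    IsBoundedBilinearMap ℝ fun p : L2 L × L2 L => prodCoef p.1 p.2 k where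
  add_left f f' g := by
    simp only [prodCoef]
    rw [← fourierCoeff_ofReal_add (integrable_mul_L2 f g) (integrable_mul_L2 f' g)]
    refine congrFun (fourierCoeff_congr_ae ?_) k
    filter_upwards [Lp.coeFn_add f f'] with x hx
    rw [hx, Pi.add_apply, add_mul]
  smul_left c f g := by
    simp only [prodCoef, Complex.real_smul]
    rw [← fourierCoeff.const_mul]
    refine congrFun (fourierCoeff_congr_ae ?_) k
    filter_upwards [Lp.coeFn_smul c f] with x hx
    rw [hx, Pi.smul_apply, smul_eq_mul, mul_assoc, Complex.ofReal_mul]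
  add_right f g g' := by
    simp only [prodCoef]
    rw [← fourierCoeff_ofReal_add (integrable_mul_L2 f g) (integrable_mul_L2 f g')]
    refine congrFun (fourierCoeff_congr_ae ?_) k
    filter_upwards [Lp.coeFn_add g g'] with x hx
    rw [hx, Pi.add_apply, mul_add]
  smul_right c f g := by
    simp only [prodCoef, Complex.real_smul]
    rw [← fourierCoeff.const_mul]
    refine congrFun (fourierCoeff_congr_ae ?_) k
    filter_upwards [Lp.coeFn_smul c g] with x hx
    rw [hx, Pi.smul_apply, smul_eq_mul, mul_left_comm, Complex.ofReal_mul]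
  bound := ⟨1, one_pos, fun f g => by simpa using norm_prodCoef_le f g k⟩

lemma continuous_prodCoef (k : ℤ) : Continuous fun p : L2 L × L2 L => prodCoef p.1 p.2 k :=
  (isBoundedBilinearMap_prodCoef k).continuous

lemma memLp_fourier_mul (f : L2 L) (n : ℤ) : MemLp (fun x => fourier n x * (f x : ℂ)) 2 μL := by
  refine MemLp.of_le (Lp.memLp f) ?_ (ae_of_all _ fun x => ?_)
  · exact (map_continuous (fourier n)).aestronglyMeasurable.mul
      (integrable_ofReal_L2 f).aestronglyMeasurable
  · rw [norm_mul, show ‖fourier n x‖ = 1 from Circle.norm_coe _, one_mul, Complex.norm_real]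

/-- The convolution formula for the coefficients of a product. -/
lemma hasSum_prodCoef (f g : L2 L) (n : ℤ) :
    HasSum (fun k => coef f (n - k) * coef g k) (prodCoef f g n) := by
  set F : Lp ℂ 2 μL := (memLp_fourier_mul f n).toLp _ with hF
  have hFae := (memLp_fourier_mul f n).coeFn_toLp
  -- Parseval for the pair e_n f and g. As f is real, conjugation turns the coefficients of e_n f
  -- into those of f at n - k.
  have h := (fourierBasis (T := L)).hasSum_inner_mul_inner F (toComplex g)
  have e1 : ∀ k, coef f (n - k) * coef g k =
      inner ℂ F (fourierBasis k) * inner ℂ (fourierBasis k) (toComplex g) := by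
    intro k
    rw [← fourierBasis.repr_apply_apply, fourierBasis_repr, fourierCoeff_toComplex]
    congr 1
    rw [← inner_conj_symm, ← fourierBasis.repr_apply_apply, fourierBasis_repr,
      fourierCoeff_congr_ae hFae, coef]
    unfold fourierCoeff
    rw [← integral_conj]
    refine integral_congr_ae (ae_of_all _ fun x => ?_)
    simp only [smul_eq_mul, map_mul, Complex.conj_ofReal]
    rw [← fourier_neg, ← fourier_neg, ← mul_assoc, ← fourier_add, neg_neg]
    congr 3
    ring
  have e2 : prodCoef f g n = inner ℂ F (toComplex g) := by
    rw [L2.inner_def]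
    unfold prodCoef fourierCoeff
    refine integral_congr_ae ?_
    filter_upwards [hFae, coeFn_toComplex g] with x h1 h2
    rw [hF, h1, h2]
    simp only [RCLike.inner_apply', map_mul, Complex.conj_ofReal, smul_eq_mul, ← fourier_neg]
    push_cast
    ring
  rw [e2, funext e1]
  exact h

end DSW

/-! ### Smooth test functions on the circle -/

namespace DSW

section CircleDeriv

variable {L : ℝ}

lemma circleDeriv_coe (n : ℕ) (φ : AddCircle L → ℝ) (y : ℝ) :
    circleDeriv n φ (y : AddCircle L) = iteratedDeriv n (fun y : ℝ => φ (y : AddCircle L)) y := by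
  unfold circleDeriv
  have := congrFun (iteratedDeriv_comp_const_add n (fun y : ℝ => φ (y : AddCircle L)) y) 0
  rw [add_zero] at this
  rw [← this]
  congr 1

lemma circleDeriv_succ (n : ℕ) (φ : AddCircle L → ℝ) :
    circleDeriv (n + 1) φ = circleDeriv 1 (circleDeriv n φ) := by
  ext x
  induction x using QuotientAddGroup.induction_on with
  | H y =>
    have h1 := circleDeriv_coe (n + 1) φ y
    have h2 := circleDeriv_coe 1 (circleDeriv n φ) y
    refine h1.trans (Eq.trans ?_ h2.symm)
    simp_rw [circleDeriv_coe]
    rw [iteratedDeriv_succ, iteratedDeriv_one]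

namespace SmoothOnCircle

variable {φ : AddCircle L → ℝ} (hφ : SmoothOnCircle φ)

include hφ

lemma circleDeriv_one : SmoothOnCircle (circleDeriv 1 φ) := by
  unfold SmoothOnCircle
  simp_rw [circleDeriv_coe, iteratedDeriv_one]
  exact hφ.iterate_deriv 1

lemma circleDeriv (n : ℕ) : SmoothOnCircle (circleDeriv n φ) := by
  induction n with
  | zero =>
    unfold SmoothOnCircle
    simp_rw [circleDeriv_coe, iteratedDeriv_zero]
    exact hφ
  | succ n ih => rw [circleDeriv_succ]; exact ih.circleDeriv_one

lemma hasDerivAt (y : ℝ) :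
    HasDerivAt (fun y : ℝ => φ (y : AddCircle L)) (DSW.circleDeriv 1 φ (y : AddCircle L)) y := by
  rw [circleDeriv_coe, iteratedDeriv_one]
  exact (hφ.differentiable (by simp)).differentiableAt.hasDerivAt

lemma continuous : Continuous φ :=
  (QuotientAddGroup.isQuotientMap_mk (AddSubgroup.zmultiples L)).continuous_iff.2
    (ContDiff.continuous hφ)

end SmoothOnCircle

end CircleDeriv

variable {L : ℝ} [Fact (0 < L)]

local notation "μL" => AddCircle.haarAddCircle (T := L)

/-- The frequency `2 π k / L`. -/
noncomputable def freq (L : ℝ) (k : ℤ) : ℝ := 2 * Real.pi / L * k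

omit [Fact (0 < L)] in
lemma freq_neg (k : ℤ) : freq L (-k) = -freq L k := by unfold freq; push_cast; ring

namespace SmoothOnCircle

variable {φ : AddCircle L → ℝ} (hφ : SmoothOnCircle φ)

include hφ

/-- Integration by parts over one period; the boundary terms cancel by periodicity. -/
lemma fourierCoeff_circleDeriv_one (k : ℤ) :
    fourierCoeff (fun x => (DSW.circleDeriv 1 φ x : ℂ)) k =
      Complex.I * freq L k * fourierCoeff (fun x => (φ x : ℂ)) k := by
  have hL : (0 : ℝ) < L := Fact.out
  have hLC : (L : ℂ) ≠ 0 := by exact_mod_cast hL.ne'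
  have hd : ∀ y : ℝ, HasDerivAt (fun y : ℝ => fourier (-k) (y : AddCircle L) * (φ y : ℂ))
      (-2 * Real.pi * Complex.I * k / L * fourier (-k) (y : AddCircle L) * (φ y : ℂ) +
        fourier (-k) (y : AddCircle L) * (DSW.circleDeriv 1 φ y : ℂ)) y := fun y =>
    (hasDerivAt_fourier_neg L k y).mul (hφ.hasDerivAt y).ofReal_comp
  have c1 : Continuous fun y : ℝ => fourier (-k) (y : AddCircle L) :=
    (map_continuous (fourier (-k))).comp (AddCircle.continuous_mk' L)
  have c2 : Continuous fun y : ℝ => (φ y : ℂ) :=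
    Complex.continuous_ofReal.comp (hφ.continuous.comp (AddCircle.continuous_mk' L))
  have c3 : Continuous fun y : ℝ => (DSW.circleDeriv 1 φ y : ℂ) :=
    Complex.continuous_ofReal.comp
      (hφ.circleDeriv_one.continuous.comp (AddCircle.continuous_mk' L))
  have hI := intervalIntegral.integral_eq_sub_of_hasDerivAt (a := 0) (b := 0 + L) (fun y _ => hd y)
    (Continuous.intervalIntegrable (by fun_prop) _ _)
  rw [AddCircle.coe_add_period, sub_self, intervalIntegral.integral_add
    (Continuous.intervalIntegrable (by fun_prop) _ _)
    (Continuous.intervalIntegrable (by fun_prop) _ _)] at hI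
  simp_rw [mul_assoc (-2 * (Real.pi : ℂ) * Complex.I * k / L)] at hI
  rw [intervalIntegral.integral_const_mul] at hI
  rw [fourierCoeff_eq_intervalIntegral _ k 0, fourierCoeff_eq_intervalIntegral _ k 0]
  simp only [smul_eq_mul, Complex.real_smul]
  rw [← sub_eq_zero] at hI ⊢
  have hI' : ∫ x in (0 : ℝ)..0 + L, fourier (-k) (x : AddCircle L) * (DSW.circleDeriv 1 φ x : ℂ) =
      -(-2 * (Real.pi : ℂ) * Complex.I * k / L *
        ∫ x in (0 : ℝ)..0 + L, fourier (-k) (x : AddCircle L) * (φ x : ℂ)) := by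
    linear_combination hI
  rw [hI']
  unfold freq
  push_cast
  ring

lemma fourierCoeff_circleDeriv (n : ℕ) (k : ℤ) :
    fourierCoeff (fun x => (DSW.circleDeriv n φ x : ℂ)) k =
      (Complex.I * freq L k) ^ n * fourierCoeff (fun x => (φ x : ℂ)) k := by
  induction n with
  | zero =>
    simp only [pow_zero, one_mul]
    congr 1
    ext x
    induction x using QuotientAddGroup.induction_on with
    | H y =>
      have := circleDeriv_coe 0 φ y
      rw [iteratedDeriv_zero] at this
      exact_mod_cast this
  | succ n ih =>
    rw [circleDeriv_succ, (hφ.circleDeriv n).fourierCoeff_circleDeriv_one, ih, pow_succ]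
    ring

omit hφ in
lemma exists_norm_fourierCoeff_le (φ : AddCircle L → ℝ) : ∃ C, ∀ k, ‖fourierCoeff (fun x => (φ x : ℂ)) k‖ ≤ C := by
  refine ⟨∫ x, ‖(φ x : ℂ)‖ ∂μL, fun k => ?_⟩
  unfold fourierCoeff
  refine (norm_integral_le_integral_norm _).trans (le_of_eq ?_)
  refine integral_congr_ae (ae_of_all _ fun x => ?_)
  simp only [norm_smul]
  rw [show ‖fourier (-k) x‖ = 1 from Circle.norm_coe _, one_mul]

lemma summable_fourierCoeff :
    Summable fun k => (1 + |freq L k| ^ 3) * ‖fourierCoeff (fun x => (φ x : ℂ)) k‖ := by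
  -- Five derivatives: three for the weight |ξ|³ required by u_xxx, two more for summability.
  obtain ⟨C, hC⟩ := exists_norm_fourierCoeff_le (DSW.circleDeriv 5 φ)
  simp_rw [hφ.fourierCoeff_circleDeriv] at hC
  have hL : (0 : ℝ) < L := Fact.out
  set h : ℝ := 2 * Real.pi / L with hh
  have h0 : 0 < h := by have := Real.pi_pos; positivity
  refine ((Real.summable_one_div_int_pow (p := 2)).2 (by norm_num)
    |>.mul_left (C * (1 + 1 / h ^ 3) / h ^ 2)).of_norm_bounded_eventually ?_
  filter_upwards [(Set.finite_singleton (0 : ℤ)).compl_mem_cofinite] with k hk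
  have hk' : k ≠ 0 := hk
  have h1 := one_le_abs_int_cast hk'
  set y := ‖fourierCoeff (fun x => (φ x : ℂ)) k‖ with hy
  have hC' : |freq L k| ^ 5 * y ≤ C := by
    have := hC k
    rwa [norm_mul, norm_pow, norm_mul, Complex.norm_I, one_mul, Complex.norm_real,
      Real.norm_eq_abs] at this
  have hx : |freq L k| = h * |(k : ℝ)| := by
    unfold freq
    rw [abs_mul, abs_of_pos h0]
  have y0 : 0 ≤ y := norm_nonneg _
  rw [Real.norm_of_nonneg (by positivity), hx, ← sq_abs (k : ℝ)]
  rw [hx] at hC'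
  set x := |(k : ℝ)| with hxk
  have x0 : 0 < x := by linarith
  have e1 : 1 + (h * x) ^ 3 ≤ (1 + 1 / h ^ 3) * (h * x) ^ 3 := by
    have : (1 + 1 / h ^ 3) * (h * x) ^ 3 = (h * x) ^ 3 + x ^ 3 := by field_simp
    rw [this]
    have : 1 ≤ x ^ 3 := one_le_pow₀ h1
    linarith
  calc (1 + (h * x) ^ 3) * y ≤ (1 + 1 / h ^ 3) * (h * x) ^ 3 * y := by gcongr
    _ = (1 + 1 / h ^ 3) * ((h * x) ^ 5 * y) / (h * x) ^ 2 := by field_simp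
    _ ≤ (1 + 1 / h ^ 3) * C / (h * x) ^ 2 := by gcongr
    _ = _ := by field_simp

/-- Parseval's formula for an integrable and a smooth function. -/
lemma hasSum_integral_mul {w : AddCircle L → ℝ} (hw : Integrable w μL) :
    HasSum (fun k => fourierCoeff (fun x => (φ x : ℂ)) k * fourierCoeff (fun x => (w x : ℂ)) (-k))
      ((∫ x, w x * φ x ∂μL : ℝ) : ℂ) := by
  set Φ : C(AddCircle L, ℂ) := ⟨fun x => (φ x : ℂ), Complex.continuous_ofReal.comp hφ.continuous⟩
    with hΦ
  have hs : Summable fun k => ‖fourierCoeff (fun x => (φ x : ℂ)) k‖ := by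
    refine Summable.of_nonneg_of_le (fun _ => norm_nonneg _) (fun k => ?_) hφ.summable_fourierCoeff
    have : 0 ≤ |freq L k| ^ 3 := by positivity
    nlinarith [norm_nonneg (fourierCoeff (fun x => (φ x : ℂ)) k)]
  have hs' : Summable (fourierCoeff Φ) := Summable.of_norm hs
  have hwC : Integrable (fun x => (w x : ℂ)) μL := hw.ofReal
  have hF := hasSum_integral_of_summable_integral_norm (μ := μL)
    (F := fun (k : ℤ) x => fourierCoeff Φ k * (fourier k x • (w x : ℂ)))
    (fun k => (hwC.fourier_smul k).const_mul _) (by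
      simp_rw [norm_mul, integral_const_mul]
      have : ∀ k : ℤ, ∫ x, ‖fourier k x • (w x : ℂ)‖ ∂μL = ∫ x, ‖w x‖ ∂μL := fun k => by
        refine integral_congr_ae (ae_of_all _ fun x => ?_)
        simp only [norm_smul]
        rw [show ‖fourier k x‖ = 1 from Circle.norm_coe _, one_mul, Complex.norm_real]
      simp_rw [this]
      exact hs.mul_right _)
  have e1 : ∀ k, fourierCoeff (fun x => (φ x : ℂ)) k * fourierCoeff (fun x => (w x : ℂ)) (-k) =
      ∫ x, fourierCoeff Φ k * (fourier k x • (w x : ℂ)) ∂μL := by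
    intro k
    rw [integral_const_mul]
    congr 1
    unfold fourierCoeff
    simp only [neg_neg]
  have e2 : ((∫ x, w x * φ x ∂μL : ℝ) : ℂ) =
      ∫ x, ∑' k, fourierCoeff Φ k * (fourier k x • (w x : ℂ)) ∂μL := by
    refine Eq.trans (integral_ofReal (𝕜 := ℂ)).symm ?_
    refine integral_congr_ae (ae_of_all _ fun x => ?_)
    have hx := has_pointwise_sum_fourier_series_of_summable hs' x
    have h2 := hx.mul_right (w x : ℂ)
    simp only [smul_eq_mul, mul_assoc] at h2 ⊢
    rw [h2.tsum_eq]
    simp [hΦ, mul_comm]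
  rw [e2, funext e1]
  exact hF

end SmoothOnCircle

end DSW

/-! ### The weak formulation and the equations for the Fourier coefficients -/

namespace DSW

variable {L : ℝ} [Fact (0 < L)]

local notation "μL" => AddCircle.haarAddCircle (T := L)

omit [Fact (0 < L)] in
lemma contDiff_fourier (j : ℤ) : ContDiff ℝ ∞ fun y : ℝ => fourier j (y : AddCircle L) := by
  simp_rw [fourier_coe_apply]
  have : ContDiff ℝ ∞ fun y : ℝ => (y : ℂ) := Complex.ofRealCLM.contDiff
  fun_prop

omit [Fact (0 < L)] in
lemma smoothOnCircle_re_fourier (j : ℤ) :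
    SmoothOnCircle fun x : AddCircle L => (fourier j x).re :=
  Complex.reCLM.contDiff.comp (contDiff_fourier j)

omit [Fact (0 < L)] in
lemma smoothOnCircle_im_fourier (j : ℤ) :
    SmoothOnCircle fun x : AddCircle L => (fourier j x).im :=
  Complex.imCLM.contDiff.comp (contDiff_fourier j)

lemma fourierCoeff_combination (a b : ℂ) (j k : ℤ) :
    fourierCoeff (fun x : AddCircle L => a * fourier j x + b * fourier (-j) x) k =
      a * Pi.single (M := fun _ => ℂ) j 1 k + b * Pi.single (M := fun _ => ℂ) (-j) 1 k := by
  have hi : ∀ n : ℤ, Integrable (fourier (T := L) n) μL := fun n =>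
    (map_continuous (fourier n)).integrable_of_hasCompactSupport (HasCompactSupport.of_compactSpace _)
  have := congrFun (fourierCoeff.add (f := fun x => a * fourier j x)
    (g := fun x => b * fourier (-j) x) ((hi j).const_mul a) ((hi (-j)).const_mul b)) k
  refine Eq.trans this ?_
  rw [Pi.add_apply, fourierCoeff.const_mul, fourierCoeff.const_mul, fourierCoeff_fourier,
    fourierCoeff_fourier]

lemma fourierCoeff_re_fourier (j k : ℤ) :
    fourierCoeff (fun x : AddCircle L => ((fourier j x).re : ℂ)) k =
      1 / 2 * Pi.single (M := fun _ => ℂ) j 1 k + 1 / 2 * Pi.single (M := fun _ => ℂ) (-j) 1 k := by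
  rw [← fourierCoeff_combination (L := L)]
  congr 1
  ext x
  rw [fourier_neg, Complex.re_eq_add_conj]
  ring

lemma fourierCoeff_im_fourier (j k : ℤ) :
    fourierCoeff (fun x : AddCircle L => ((fourier j x).im : ℂ)) k =
      1 / (2 * Complex.I) * Pi.single (M := fun _ => ℂ) j 1 k + -1 / (2 * Complex.I) * Pi.single (M := fun _ => ℂ) (-j) 1 k := by
  rw [← fourierCoeff_combination (L := L)]
  congr 1
  ext x
  rw [fourier_neg, Complex.im_eq_sub_conj]
  ring

lemma hasSum_combination (a b : ℂ) (j : ℤ) (Y : ℤ → ℂ) :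
    HasSum (fun k => (a * Pi.single (M := fun _ => ℂ) j 1 k +
        b * Pi.single (M := fun _ => ℂ) (-j) 1 k) * Y (-k))
      (a * Y (-j) + b * Y j) := by
  have h : ∀ (c : ℂ) (i : ℤ),
      HasSum (fun k => c * Pi.single (M := fun _ => ℂ) i 1 k * Y (-k)) (c * Y (-i)) := by
    intro c i
    have := hasSum_single (f := fun k => c * Pi.single (M := fun _ => ℂ) i 1 k * Y (-k)) i
      fun k hk => by rw [Pi.single_eq_of_ne hk]; simp
    simpa using this
  have := (h a j).add (h b (-j))
  rw [neg_neg] at this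
  simpa only [add_mul] using this

/-- An evolution equation in the sense of distributions is equivalent to the equations for the
Fourier coefficients. -/
lemma weak_iff {t : ℝ} {f : ℤ → ℝ → ℂ} (hf : ∀ k, ContinuousOn (f k) (uIcc 0 t)) {B : ℝ}
    (hB : ∀ s ∈ uIcc 0 t, ∀ k, ‖f k s‖ ≤ B * (1 + |freq L k| ^ 3)) {W W₀ : ℤ → ℂ}
    {P P₀ : (AddCircle L → ℝ) → ℝ} {N : (AddCircle L → ℝ) → ℝ → ℝ}
    (hP : ∀ φ, SmoothOnCircle φ →
      HasSum (fun k => fourierCoeff (fun x => (φ x : ℂ)) k * W (-k)) (P φ : ℂ))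
    (hP₀ : ∀ φ, SmoothOnCircle φ →
      HasSum (fun k => fourierCoeff (fun x => (φ x : ℂ)) k * W₀ (-k)) (P₀ φ : ℂ))
    (hN : ∀ φ, SmoothOnCircle φ → ∀ s ∈ uIcc 0 t,
      HasSum (fun k => fourierCoeff (fun x => (φ x : ℂ)) k * f (-k) s) (N φ s : ℂ)) :
    (∀ φ, SmoothOnCircle φ → P φ = P₀ φ + ∫ s in (0 : ℝ)..t, N φ s) ↔
      ∀ k, W k = W₀ k + ∫ s in (0 : ℝ)..t, f k s := by
  have hfi : ∀ k, IntervalIntegrable (f k) volume 0 t := fun k => (hf k).intervalIntegrable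
  constructor
  · intro H
    have main : ∀ (a b : ℂ) (j : ℤ) (φ : AddCircle L → ℝ), SmoothOnCircle φ →
        (∀ k, fourierCoeff (fun x => (φ x : ℂ)) k =
          a * Pi.single (M := fun _ => ℂ) j 1 k + b * Pi.single (M := fun _ => ℂ) (-j) 1 k) →
        a * W (-j) + b * W j = a * W₀ (-j) + b * W₀ j +
          (a * (∫ s in (0 : ℝ)..t, f (-j) s) + b * ∫ s in (0 : ℝ)..t, f j s) := by
      intro a b j φ hφ hc
      have h1 := hP φ hφ
      have h2 := hP₀ φ hφ
      have h3 := hN φ hφ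
      simp_rw [hc] at h1 h2 h3
      have e1 := h1.unique (hasSum_combination a b j W)
      have e2 := h2.unique (hasSum_combination a b j W₀)
      have e3 : ∀ s ∈ uIcc 0 t, (N φ s : ℂ) = a * f (-j) s + b * f j s := fun s hs =>
        (h3 s hs).unique (hasSum_combination a b j fun k => f k s)
      have e4 : ((∫ s in (0 : ℝ)..t, N φ s : ℝ) : ℂ) =
          a * (∫ s in (0 : ℝ)..t, f (-j) s) + b * ∫ s in (0 : ℝ)..t, f j s := by
        rw [← intervalIntegral.integral_ofReal, intervalIntegral.integral_congr e3,
          intervalIntegral.integral_add ((hfi _).const_mul _) ((hfi _).const_mul _),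
          intervalIntegral.integral_const_mul, intervalIntegral.integral_const_mul]
      rw [← e1, ← e2, ← e4, H φ hφ]
      push_cast
      rfl
    intro j
    -- Test functions are real, so only the real and imaginary parts of a character are available.
    -- They give the equations for W(-j) + W(j) and W(-j) - W(j).
    have r1 := main _ _ j _ (smoothOnCircle_re_fourier j) (fourierCoeff_re_fourier j)
    have r2 := main _ _ j _ (smoothOnCircle_im_fourier j) (fourierCoeff_im_fourier j)
    have hI : Complex.I ≠ 0 := Complex.I_ne_zero
    field_simp at r1 r2
    linear_combination (r1 - r2) / 2
  · intro H φ hφ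
    have hs := hφ.summable_fourierCoeff
    -- Dominated convergence: at most cubic growth of the coefficients in the frequency is beaten by
    -- the rapid decay of those of the test function.
    have sw : HasSum (fun k => ∫ s in (0 : ℝ)..t, fourierCoeff (fun x => (φ x : ℂ)) k * f (-k) s)
        (∫ s in (0 : ℝ)..t, (N φ s : ℂ)) := by
      refine intervalIntegral.hasSum_integral_of_dominated_convergence
        (fun k _ => B * ((1 + |freq L k| ^ 3) * ‖fourierCoeff (fun x => (φ x : ℂ)) k‖)) (fun k => ?_)
        (fun k => ae_of_all _ fun s hs => ?_) (ae_of_all _ fun s _ => hs.mul_left B)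
        intervalIntegrable_const (ae_of_all _ fun s hs' => hN φ hφ s (uIoc_subset_uIcc hs'))
      · exact (intervalIntegrable_iff.1 ((hfi (-k)).const_mul _)).aestronglyMeasurable
      · rw [norm_mul]
        have := hB s (uIoc_subset_uIcc hs) (-k)
        rw [freq_neg, abs_neg] at this
        nlinarith [norm_nonneg (fourierCoeff (fun x => (φ x : ℂ)) k)]
    have h3 : HasSum (fun k => fourierCoeff (fun x => (φ x : ℂ)) k * W (-k))
        ((P₀ φ : ℂ) + ∫ s in (0 : ℝ)..t, (N φ s : ℂ)) := by
      have e : ∀ k, fourierCoeff (fun x => (φ x : ℂ)) k * W (-k) =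
          fourierCoeff (fun x => (φ x : ℂ)) k * W₀ (-k) +
            ∫ s in (0 : ℝ)..t, fourierCoeff (fun x => (φ x : ℂ)) k * f (-k) s := fun k => by
        rw [H, mul_add, intervalIntegral.integral_const_mul]
      rw [funext e]
      exact (hP₀ φ hφ).add sw
    have h4 := (hP φ hφ).unique h3
    rw [intervalIntegral.integral_ofReal] at h4
    exact_mod_cast h4

/-- The Fourier coefficients of `-(u v)_x - u_xxx`. -/
noncomputable def fluxU (u v : L2 L) (k : ℤ) : ℂ :=
  -Complex.I * freq L k * prodCoef u v k + Complex.I * freq L k ^ 3 * coef u k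

/-- The Fourier coefficients of `-u u_x`. -/
noncomputable def fluxV (u : L2 L) (k : ℤ) : ℂ := -Complex.I * freq L k / 2 * prodCoef u u k

/-- The equations for the Fourier coefficients, integrated in time. -/
structure FourierSol (I : Set ℝ) (u v : ℝ → L2 L) : Prop where
  eq_u : ∀ t ∈ I, ∀ k, coef (u t) k = coef (u 0) k + ∫ s in (0 : ℝ)..t, fluxU (u s) (v s) k
  eq_v : ∀ t ∈ I, ∀ k, coef (v t) k = coef (v 0) k + ∫ s in (0 : ℝ)..t, fluxV (u s) k

lemma integrable_mul_circleDeriv {w : AddCircle L → ℝ} (hw : Integrable w μL) {φ : AddCircle L → ℝ}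
    (hφ : SmoothOnCircle φ) : Integrable (fun x => w x * φ x) μL := by
  obtain ⟨C, hC⟩ := isCompact_univ.exists_bound_of_continuousOn hφ.continuous.continuousOn
  exact hw.mul_bdd (c := C) hφ.continuous.aestronglyMeasurable (ae_of_all _ fun x => hC x (mem_univ x))

lemma hasSum_fluxU (u v : L2 L) {φ : AddCircle L → ℝ} (hφ : SmoothOnCircle φ) :
    HasSum (fun k => fourierCoeff (fun x => (φ x : ℂ)) k * fluxU u v (-k))
      ((∫ x, (u x * v x * circleDeriv 1 φ x + u x * circleDeriv 3 φ x) ∂μL : ℝ) : ℂ) := by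
  have h1 := (hφ.circleDeriv 1).hasSum_integral_mul (integrable_mul_L2 u v)
  have h2 := (hφ.circleDeriv 3).hasSum_integral_mul (integrable_L2 u)
  simp_rw [hφ.fourierCoeff_circleDeriv] at h1 h2
  rw [integral_add (integrable_mul_circleDeriv (integrable_mul_L2 u v) (hφ.circleDeriv 1))
    (integrable_mul_circleDeriv (integrable_L2 u) (hφ.circleDeriv 3))]
  push_cast
  have e : ∀ k, fourierCoeff (fun x => (φ x : ℂ)) k * fluxU u v (-k) =
      (Complex.I * freq L k) ^ 1 * fourierCoeff (fun x => (φ x : ℂ)) k *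
        fourierCoeff (fun x => ((u x * v x : ℝ) : ℂ)) (-k) +
      (Complex.I * freq L k) ^ 3 * fourierCoeff (fun x => (φ x : ℂ)) k *
        fourierCoeff (fun x => (u x : ℂ)) (-k) := by
    intro k
    unfold fluxU prodCoef coef
    rw [freq_neg, mul_pow Complex.I _ 3, Complex.I_pow_three]
    push_cast
    ring
  rw [funext e]
  exact h1.add h2

lemma hasSum_fluxV (u : L2 L) {φ : AddCircle L → ℝ} (hφ : SmoothOnCircle φ) :
    HasSum (fun k => fourierCoeff (fun x => (φ x : ℂ)) k * fluxV u (-k))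
      ((∫ x, (u x) ^ 2 / 2 * circleDeriv 1 φ x ∂μL : ℝ) : ℂ) := by
  have h1 := ((hφ.circleDeriv 1).hasSum_integral_mul (integrable_mul_L2 u u)).mul_left (1 / 2)
  simp_rw [hφ.fourierCoeff_circleDeriv] at h1
  have e : ∀ k, fourierCoeff (fun x => (φ x : ℂ)) k * fluxV u (-k) =
      1 / 2 * ((Complex.I * freq L k) ^ 1 * fourierCoeff (fun x => (φ x : ℂ)) k *
        fourierCoeff (fun x => ((u x * u x : ℝ) : ℂ)) (-k)) := by
    intro k
    unfold fluxV prodCoef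
    rw [freq_neg]
    push_cast
    ring
  have e2 : ((∫ x, (u x) ^ 2 / 2 * circleDeriv 1 φ x ∂μL : ℝ) : ℂ) =
      1 / 2 * ((∫ x, u x * u x * circleDeriv 1 φ x ∂μL : ℝ) : ℂ) := by
    rw [show ∀ x : ℝ, (1 / 2 : ℂ) * x = ((1 / 2 * x : ℝ) : ℂ) from fun x => by push_cast; ring,
      ← integral_const_mul]
    congr 2
    ext x
    ring
  rw [funext e, e2]
  exact h1

omit [Fact (0 < L)] in
lemma abs_le_one_add_pow_three (x : ℝ) : |x| ≤ 1 + |x| ^ 3 := by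
  rcases le_total |x| 1 with h | h
  · have : 0 ≤ |x| ^ 3 := by positivity
    linarith
  · have := pow_le_pow_right₀ h (show 1 ≤ 3 by norm_num)
    linarith

lemma norm_fluxU_le (u v : L2 L) (k : ℤ) :
    ‖fluxU u v k‖ ≤ (‖u‖ * ‖v‖ + ‖u‖) * (1 + |freq L k| ^ 3) := by
  unfold fluxU
  refine (norm_add_le _ _).trans ?_
  simp only [norm_mul, norm_neg, Complex.norm_I, one_mul, Complex.norm_real, Real.norm_eq_abs,
    norm_pow]
  have h1 := norm_prodCoef_le u v k
  have h2 := norm_coef_le u k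
  have h3 := abs_le_one_add_pow_three (freq L k)
  calc |freq L k| * ‖prodCoef u v k‖ + |freq L k| ^ 3 * ‖coef u k‖
      ≤ (1 + |freq L k| ^ 3) * (‖u‖ * ‖v‖) + (1 + |freq L k| ^ 3) * ‖u‖ := by
        gcongr
        linarith
    _ = _ := by ring

lemma norm_fluxV_le (u : L2 L) (k : ℤ) :
    ‖fluxV u k‖ ≤ (‖u‖ * ‖u‖) * (1 + |freq L k| ^ 3) := by
  unfold fluxV
  simp only [norm_mul, norm_div, norm_neg, Complex.norm_I, one_mul, Complex.norm_real,
    Real.norm_eq_abs, Complex.norm_ofNat]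
  have h1 := norm_prodCoef_le u u k
  have h3 := abs_le_one_add_pow_three (freq L k)
  calc |freq L k| / 2 * ‖prodCoef u u k‖ ≤ (1 + |freq L k| ^ 3) * (‖u‖ * ‖u‖) := by
        gcongr
        linarith [abs_nonneg (freq L k)]
    _ = _ := by ring

lemma continuousOn_fluxU {I : Set ℝ} {u v : ℝ → L2 L} (hu : ContinuousOn u I)
    (hv : ContinuousOn v I) (k : ℤ) : ContinuousOn (fun s => fluxU (u s) (v s) k) I := by
  unfold fluxU
  have h1 := (continuous_prodCoef k).comp_continuousOn (hu.prodMk hv)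
  have h2 := (continuous_coef k).comp_continuousOn hu
  exact (h1.const_mul _).add (h2.const_mul _)

lemma continuousOn_fluxV {I : Set ℝ} {u : ℝ → L2 L} (hu : ContinuousOn u I) (k : ℤ) :
    ContinuousOn (fun s => fluxV (u s) k) I := by
  unfold fluxV
  exact ((continuous_prodCoef k).comp_continuousOn (hu.prodMk hu)).const_mul _

section Equivalence

variable {I : Set ℝ} (hI : ∀ t ∈ I, uIcc 0 t ⊆ I) {u v : ℝ → L2 L} (hu : ContinuousOn u I)
  (hv : ContinuousOn v I)

include hI hu hv

lemma weak_u_iff {t : ℝ} (ht : t ∈ I) :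
    (∀ φ : AddCircle L → ℝ, SmoothOnCircle φ → ∫ x, u t x * φ x ∂μL
      = (∫ x, u 0 x * φ x ∂μL) + ∫ s in (0 : ℝ)..t, ∫ x, (u s x * v s x * circleDeriv 1 φ x
            + u s x * circleDeriv 3 φ x) ∂μL) ↔
      ∀ k, coef (u t) k = coef (u 0) k + ∫ s in (0 : ℝ)..t, fluxU (u s) (v s) k := by
  have hu' := hu.mono (hI t ht)
  have hv' := hv.mono (hI t ht)
  obtain ⟨B, hB⟩ := isCompact_uIcc.exists_bound_of_continuousOn
    ((hu'.norm.mul hv'.norm).add hu'.norm)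
  refine weak_iff (f := fun k s => fluxU (u s) (v s) k) (B := B)
    (fun k => continuousOn_fluxU hu' hv' k) (fun s hs k => (norm_fluxU_le _ _ k).trans ?_)
    (fun φ hφ => hφ.hasSum_integral_mul (integrable_L2 (u t)))
    (fun φ hφ => hφ.hasSum_integral_mul (integrable_L2 (u 0)))
    (fun φ hφ s _ => hasSum_fluxU (u s) (v s) hφ)
  gcongr
  exact (le_abs_self _).trans (hB s hs)

omit hv in
lemma weak_v_iff {t : ℝ} (ht : t ∈ I) :
    (∀ φ : AddCircle L → ℝ, SmoothOnCircle φ → ∫ x, v t x * φ x ∂μL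
      = (∫ x, v 0 x * φ x ∂μL) + ∫ s in (0 : ℝ)..t, ∫ x, (u s x) ^ 2 / 2 * circleDeriv 1 φ x ∂μL) ↔
      ∀ k, coef (v t) k = coef (v 0) k + ∫ s in (0 : ℝ)..t, fluxV (u s) k := by
  have hu' := hu.mono (hI t ht)
  obtain ⟨B, hB⟩ := isCompact_uIcc.exists_bound_of_continuousOn (hu'.norm.mul hu'.norm)
  refine weak_iff (f := fun k s => fluxV (u s) k) (B := B)
    (fun k => continuousOn_fluxV hu' k) (fun s hs k => (norm_fluxV_le _ k).trans ?_)
    (fun φ hφ => hφ.hasSum_integral_mul (integrable_L2 (v t)))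
    (fun φ hφ => hφ.hasSum_integral_mul (integrable_L2 (v 0)))
    (fun φ hφ s _ => hasSum_fluxV (u s) hφ)
  gcongr
  exact (le_abs_self _).trans (hB s hs)

lemma FourierSol.isSolutionOn (h : FourierSol I u v) : IsSolutionOn I (u 0) (v 0) u v where
  continuousOn_u := hu
  continuousOn_v := hv
  initial_u := rfl
  initial_v := rfl
  eq_u φ hφ t ht := (weak_u_iff hI hu hv ht).2 (h.eq_u t ht) φ hφ
  eq_v φ hφ t ht := (weak_v_iff hI hu ht).2 (h.eq_v t ht) φ hφ

omit hu hv in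
lemma IsSolutionOn.fourierSol {u₀ v₀ : L2 L} (h : IsSolutionOn I u₀ v₀ u v) : FourierSol I u v := by
  have h1 := h.initial_u
  have h2 := h.initial_v
  subst h1 h2
  exact ⟨fun t ht => (weak_u_iff hI h.continuousOn_u h.continuousOn_v ht).1
      fun φ hφ => h.eq_u φ hφ t ht,
    fun t ht => (weak_v_iff hI h.continuousOn_u ht).1 fun φ hφ => h.eq_v φ hφ t ht⟩

end Equivalence

end DSW

/-! ### The interaction picture -/

namespace DSW

/-- Multiplication of an integral equation by an integrating factor. -/
lemma exp_mul_eq_integral {T : ℝ} {z f : ℝ → ℂ} {z₀ : ℂ} (hf : ContinuousOn f (Icc 0 T))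
    (hz : ∀ t ∈ Icc 0 T, z t = z₀ + ∫ s in (0 : ℝ)..t, f s) (w : ℝ) {t : ℝ} (ht : t ∈ Icc 0 T) :
    Complex.exp (Complex.I * (w : ℂ) * (t : ℂ)) * z t =
      z₀ + ∫ s in (0 : ℝ)..t, Complex.exp (Complex.I * (w : ℂ) * (s : ℂ)) *
        (Complex.I * w * z s + f s) := by
  have hT : 0 ≤ T := ht.1.trans ht.2
  -- A continuous extension of the integrand beyond [0, T] makes the solution formula differentiable
  -- on the whole line, so the fundamental theorem applies without endpoint conditions.
  set g : ℝ → ℂ := IccExtend hT ((Icc 0 T).domRestrict f) with hg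
  have gc : Continuous g := (continuousOn_iff_continuous_domRestrict.1 hf).Icc_extend'
  have hgf : ∀ s ∈ Icc 0 T, g s = f s := fun s hs => by
    rw [hg, IccExtend_of_mem _ _ hs]; rfl
  set Z : ℝ → ℂ := fun t => z₀ + ∫ s in (0 : ℝ)..t, g s with hZ
  have hzZ : ∀ s ∈ Icc 0 T, z s = Z s := by
    intro s hs
    rw [hz s hs, hZ]
    congr 1
    refine intervalIntegral.integral_congr fun r hr => ?_
    rw [uIcc_of_le hs.1] at hr
    exact (hgf r ⟨hr.1, hr.2.trans hs.2⟩).symm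
  have hZd : ∀ s, HasDerivAt Z (g s) s := fun s =>
    (gc.integral_hasStrictDerivAt 0 s).hasDerivAt.const_add _
  have hZc : Continuous Z := continuous_iff_continuousAt.2 fun s => (hZd s).continuousAt
  have hE : ∀ s : ℝ, HasDerivAt (fun s : ℝ => Complex.exp (Complex.I * (w : ℂ) * (s : ℂ)))
      (Complex.exp (Complex.I * (w : ℂ) * (s : ℂ)) * (Complex.I * w)) s := fun s => by
    have h1 : HasDerivAt (fun s : ℝ => Complex.I * (w : ℂ) * (s : ℂ)) (Complex.I * w) s := by
      simpa using (Complex.ofRealCLM.hasDerivAt (x := s)).const_mul (Complex.I * (w : ℂ))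
    exact h1.cexp
  have hI := intervalIntegral.integral_eq_sub_of_hasDerivAt (a := 0) (b := t)
    (fun s _ => (hE s).mul (hZd s)) (Continuous.intervalIntegrable (by fun_prop) _ _)
  rw [hzZ t ht]
  have h0 : Z 0 = z₀ := by simp [hZ]
  simp only [h0, Complex.ofReal_zero, mul_zero, Complex.exp_zero, one_mul, Pi.mul_apply] at hI
  have e : ∫ s in (0 : ℝ)..t, Complex.exp (Complex.I * (w : ℂ) * (s : ℂ)) *
      (Complex.I * w * z s + f s) = ∫ s in (0 : ℝ)..t,
      (Complex.exp (Complex.I * (w : ℂ) * (s : ℂ)) * (Complex.I * w) * Z s +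
        Complex.exp (Complex.I * (w : ℂ) * (s : ℂ)) * g s) := by
    refine intervalIntegral.integral_congr fun s hs => ?_
    rw [uIcc_of_le ht.1] at hs
    have hs' : s ∈ Icc 0 T := ⟨hs.1, hs.2.trans ht.2⟩
    rw [hzZ s hs', hgf s hs']
    ring
  rw [e, hI]
  ring

variable {L : ℝ} [Fact (0 < L)]

omit [Fact (0 < L)] in
lemma freq_zero : freq L 0 = 0 := by simp [freq]

/-- The equation for v is in divergence form, so its mean is conserved. This justifies a constant m
in the dispersion relation. -/
lemma FourierSol.coef_zero {I : Set ℝ} {u v : ℝ → L2 L} (h : FourierSol I u v) {t : ℝ} (ht : t ∈ I) :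
    coef (v t) 0 = coef (v 0) 0 := by
  rw [h.eq_v t ht]
  simp [fluxV, freq_zero]

/-- The dispersion relation of the frequencies of the circle. -/
noncomputable def phase (L m : ℝ) (k : ℤ) : ℝ := disp (2 * Real.pi / L) m k

omit [Fact (0 < L)] in
lemma phase_eq (m : ℝ) (k : ℤ) : phase L m k = freq L k ^ 3 - m * freq L k := rfl

/-- The Fourier coefficients in the interaction picture. -/
noncomputable def inter (m : ℝ) (u v : ℝ → L2 L) : ℤ ⊕ ℤ → ℝ → ℂ
  | .inl k, t => Complex.exp (Complex.I * ((-phase L m k : ℝ) : ℂ) * (t : ℂ)) * coef (u t) k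
  | .inr n, t => coef (v t) n - if n = 0 then (m : ℂ) else 0

/-- The equation for `u` in the interaction picture. -/
noncomputable def interFlux (m : ℝ) (u v : L2 L) (k : ℤ) : ℂ :=
  -Complex.I * freq L k * (prodCoef u v k - m * coef u k)

lemma fluxU_eq (m : ℝ) (u v : L2 L) (k : ℤ) :
    fluxU u v k = Complex.I * (phase L m k : ℂ) * coef u k + interFlux m u v k := by
  rw [phase_eq]
  unfold fluxU interFlux
  push_cast
  ring

lemma continuousOn_interFlux {I : Set ℝ} {u v : ℝ → L2 L} (hu : ContinuousOn u I)
    (hv : ContinuousOn v I) (m : ℝ) (k : ℤ) :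
    ContinuousOn (fun s => interFlux m (u s) (v s) k) I := by
  unfold interFlux
  have h1 := (continuous_prodCoef k).comp_continuousOn (hu.prodMk hv)
  have h2 := (continuous_coef k).comp_continuousOn hu
  exact (h1.sub (h2.const_mul _)).const_mul _

/-- The integrating factor exp(-i·phase·t) removes the linear part; the factor exp(i·phase·t)
restores it in the converse direction. -/
lemma eq_u_iff {T : ℝ} {u v : ℝ → L2 L} (hu : ContinuousOn u (Icc 0 T))
    (hv : ContinuousOn v (Icc 0 T)) (m : ℝ) (k : ℤ) :
    (∀ t ∈ Icc 0 T, coef (u t) k = coef (u 0) k + ∫ s in (0 : ℝ)..t, fluxU (u s) (v s) k) ↔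
    ∀ t ∈ Icc 0 T, Complex.exp (Complex.I * ((-phase L m k : ℝ) : ℂ) * (t : ℂ)) * coef (u t) k =
      coef (u 0) k + ∫ s in (0 : ℝ)..t,
        Complex.exp (Complex.I * ((-phase L m k : ℝ) : ℂ) * (s : ℂ)) * interFlux m (u s) (v s) k := by
  constructor
  · intro h t ht
    rw [exp_mul_eq_integral (continuousOn_fluxU hu hv k) h _ ht]
    congr 2
    ext s
    rw [fluxU_eq m]
    push_cast
    ring
  · intro h t ht
    have hc : ContinuousOn (fun s : ℝ =>
        Complex.exp (Complex.I * ((-phase L m k : ℝ) : ℂ) * (s : ℂ)) * interFlux m (u s) (v s) k)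
        (Icc 0 T) := by
      have := continuousOn_interFlux hu hv m k
      fun_prop
    have h1 := exp_mul_eq_integral hc h (phase L m k) ht
    have e : ∀ s : ℝ, Complex.exp (Complex.I * (phase L m k : ℂ) * (s : ℂ)) *
        Complex.exp (Complex.I * ((-phase L m k : ℝ) : ℂ) * (s : ℂ)) = 1 := fun s => by
      rw [← Complex.exp_add, ← Complex.exp_zero]
      congr 1
      push_cast
      ring
    rw [← mul_assoc, e, one_mul] at h1
    rw [h1]
    congr 2
    ext s
    rw [fluxU_eq m]
    linear_combination (Complex.I * (phase L m k : ℂ) * coef (u s) k + interFlux m (u s) (v s) k) * e s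

section Duhamel

variable {m lam : ℝ} {u v : ℝ → L2 L}

/-- The dispersive system for the circle of length `L`. -/
noncomputable abbrev circleSys (L m lam : ℝ) : QSys (ℤ ⊕ ℤ) ((ℤ × ℤ) ⊕ (ℤ × ℤ)) :=
  dswSys (2 * Real.pi / L) m lam

/-- The interactions which contribute to the frequency `k` of `u`. -/
def fiberInl (m lam : ℝ) (k : ℤ) : ℤ ≃ (circleSys L m lam).out ⁻¹' {.inl k} where
  toFun n := ⟨.inl (k, n), rfl⟩
  invFun e := match e with
    | ⟨.inl p, _⟩ => p.2
    | ⟨.inr _, _⟩ => 0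
  left_inv n := rfl
  right_inv := by
    rintro ⟨⟨k', n⟩ | p, he⟩
    · obtain rfl : k' = k := by simpa [dswSys] using he
      rfl
    · simp [dswSys] at he

/-- The interactions which contribute to the frequency `n` of `v`. -/
def fiberInr (m lam : ℝ) (n : ℤ) : ℤ ≃ (circleSys L m lam).out ⁻¹' {.inr n} where
  toFun k := ⟨.inr (n - k, k), by simp [dswSys]⟩
  invFun e := match e with
    | ⟨.inl _, _⟩ => 0
    | ⟨.inr p, _⟩ => p.2
  left_inv n := rfl
  right_inv := by
    rintro ⟨p | ⟨k, l⟩, he⟩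
    · simp [dswSys] at he
    · obtain rfl : k + l = n := by simpa [dswSys] using he
      simp

/-- The convolution formula for the coefficients of uv, with the n = 0 term m·u_k taken out. The
phase of each interaction compensates exactly the difference between the rotations of u_{k-n} and
u_k. -/
lemma rhs_inl (hlam : lam ≠ 0) {s : ℝ} (hv : coef (v (s / lam)) 0 = m) (k : ℤ) :
    (circleSys L m lam).rhs (fun i s => inter m u v i (s / lam)) (fun i s => inter m u v i (s / lam))
      (.inl k) s = (lam : ℂ)⁻¹ *
      (Complex.exp (Complex.I * ((-phase L m k : ℝ) : ℂ) * ((s / lam : ℝ) : ℂ)) *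
        interFlux m (u (s / lam)) (v (s / lam)) k) := by
  set τ := s / lam with hτ
  have hs : s = lam * τ := by rw [hτ]; field_simp
  have hsum : HasSum (fun n => coef (u τ) (k - n) * (coef (v τ) n - if n = 0 then (m : ℂ) else 0))
      (prodCoef (u τ) (v τ) k - m * coef (u τ) k) := by
    have h1 := hasSum_prodCoef (u τ) (v τ) k
    have h2 := hasSum_single (f := fun n => coef (u τ) (k - n) * if n = 0 then (m : ℂ) else 0) 0
      fun n hn => by simp [hn]
    simp only [sub_zero, if_true] at h2
    rw [mul_comm (m : ℂ)]
    simpa only [mul_sub] using h1.sub h2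
  have h3 := (hsum.mul_left ((lam : ℂ)⁻¹ *
    (Complex.exp (Complex.I * ((-phase L m k : ℝ) : ℂ) * ((τ : ℝ) : ℂ)) *
      (-Complex.I * freq L k)))).tsum_eq
  unfold QSys.rhs
  rw [← (fiberInl m lam k).tsum_eq]
  refine Eq.trans ?_ (h3.trans (by unfold interFlux; ring))
  refine tsum_congr fun n => ?_
  simp only [fiberInl, Equiv.coe_fn_mk, dswSys, Sum.elim_inl, inter, ← hτ]
  -- Here the assumption that v has mean m is needed: the term absent from the system is then zero
  -- in the convolution too.
  by_cases hn : n = 0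
  · subst hn
    simp [hv]
  · rw [if_neg hn, if_neg hn, sub_zero]
    have e : Complex.exp (Complex.I * (((disp (2 * Real.pi / L) m (k - n) -
        disp (2 * Real.pi / L) m k) / lam : ℝ) : ℂ) * (s : ℂ)) *
        Complex.exp (Complex.I * ((-phase L m (k - n) : ℝ) : ℂ) * (τ : ℂ)) =
        Complex.exp (Complex.I * ((-phase L m k : ℝ) : ℂ) * (τ : ℂ)) := by
      rw [← Complex.exp_add]
      congr 1
      have : (lam : ℂ) ≠ 0 := by exact_mod_cast hlam
      rw [hs]
      unfold phase
      push_cast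
      field_simp
      ring
    rw [← e]
    unfold freq
    push_cast
    ring

lemma rhs_inr (hlam : lam ≠ 0) {s : ℝ} (n : ℤ) :
    (circleSys L m lam).rhs (fun i s => inter m u v i (s / lam)) (fun i s => inter m u v i (s / lam))
      (.inr n) s = (lam : ℂ)⁻¹ * fluxV (u (s / lam)) n := by
  set τ := s / lam with hτ
  have hs : s = lam * τ := by rw [hτ]; field_simp
  have h3 := ((hasSum_prodCoef (u τ) (u τ) n).mul_left
    ((lam : ℂ)⁻¹ * (-Complex.I * freq L n / 2))).tsum_eq
  unfold QSys.rhs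
  rw [← (fiberInr m lam n).tsum_eq]
  refine Eq.trans ?_ (h3.trans (by unfold fluxV; ring))
  refine tsum_congr fun k => ?_
  simp only [fiberInr, Equiv.coe_fn_mk, dswSys, Sum.elim_inr, inter, ← hτ]
  have e : Complex.exp (Complex.I * (((disp (2 * Real.pi / L) m (n - k) +
      disp (2 * Real.pi / L) m k) / lam : ℝ) : ℂ) * (s : ℂ)) *
      (Complex.exp (Complex.I * ((-phase L m (n - k) : ℝ) : ℂ) * (τ : ℂ)) *
      Complex.exp (Complex.I * ((-phase L m k : ℝ) : ℂ) * (τ : ℂ))) = 1 := by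
    rw [← Complex.exp_add, ← Complex.exp_add, ← Complex.exp_zero]
    congr 1
    have : (lam : ℂ) ≠ 0 := by exact_mod_cast hlam
    rw [hs]
    unfold phase
    push_cast
    field_simp
    ring
  calc _ = -Complex.I * ((2 * Real.pi / L * (((n - k : ℤ) : ℝ) + k) / (2 * lam) : ℝ) : ℂ) *
        (Complex.exp (Complex.I * (((disp (2 * Real.pi / L) m (n - k) +
      disp (2 * Real.pi / L) m k) / lam : ℝ) : ℂ) * (s : ℂ)) *
      (Complex.exp (Complex.I * ((-phase L m (n - k) : ℝ) : ℂ) * (τ : ℂ)) *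
      Complex.exp (Complex.I * ((-phase L m k : ℝ) : ℂ) * (τ : ℂ)))) *
        (coef (u τ) (n - k) * coef (u τ) k) := by ring
    _ = _ := by
        rw [e]
        unfold freq
        push_cast
        ring

lemma integral_inv_mul_comp_div (lam : ℝ) (f : ℝ → ℂ) (t : ℝ) :
    ∫ s in (0 : ℝ)..t, (lam : ℂ)⁻¹ * f (s / lam) = ∫ s in (0 : ℝ)..t / lam, f s := by
  have := intervalIntegral.inv_smul_integral_comp_div (a := 0) (b := t) f lam
  rw [zero_div] at this
  rw [← this, intervalIntegral.integral_const_mul, Complex.real_smul]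
  push_cast
  rfl

variable (hlam : 0 < lam) (hv0 : ∀ t ∈ Icc 0 (1 / lam), coef (v t) 0 = m)

include hlam in
omit [Fact (0 < L)] in
lemma div_mem_Icc {s : ℝ} (hs : s ∈ Icc (0 : ℝ) 1) : s / lam ∈ Icc 0 (1 / lam) :=
  ⟨div_nonneg hs.1 hlam.le, by gcongr; exact hs.2⟩

include hlam hv0

lemma duh_inl {t : ℝ} (ht : t ∈ Icc (0 : ℝ) 1) (k : ℤ) :
    (circleSys L m lam).duh (fun i s => inter m u v i (s / lam)) (fun i s => inter m u v i (s / lam))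
      (.inl k) t = ∫ s in (0 : ℝ)..t / lam,
        Complex.exp (Complex.I * ((-phase L m k : ℝ) : ℂ) * (s : ℂ)) * interFlux m (u s) (v s) k := by
  rw [← integral_inv_mul_comp_div lam]
  unfold QSys.duh
  refine intervalIntegral.integral_congr fun s hs => ?_
  rw [uIcc_of_le ht.1] at hs
  exact rhs_inl hlam.ne' (hv0 _ (div_mem_Icc hlam ⟨hs.1, hs.2.trans ht.2⟩)) k

omit hv0 in
lemma duh_inr (t : ℝ) (n : ℤ) :
    (circleSys L m lam).duh (fun i s => inter m u v i (s / lam)) (fun i s => inter m u v i (s / lam))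
      (.inr n) t = ∫ s in (0 : ℝ)..t / lam, fluxV (u s) n := by
  rw [← integral_inv_mul_comp_div lam]
  unfold QSys.duh
  exact intervalIntegral.integral_congr fun s _ => rhs_inr hlam.ne' n

/-- The equations for the Fourier coefficients are equivalent to the abstract quadratic system. -/
lemma fourierSol_iff (hu : ContinuousOn u (Icc 0 (1 / lam))) (hv : ContinuousOn v (Icc 0 (1 / lam))) :
    FourierSol (Icc 0 (1 / lam)) u v ↔ ∀ t ∈ Icc (0 : ℝ) 1, ∀ i,
      inter m u v i (t / lam) = inter m u v i 0 + (circleSys L m lam).duh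
        (fun i s => inter m u v i (s / lam)) (fun i s => inter m u v i (s / lam)) i t := by
  have mul_mem : ∀ t ∈ Icc 0 (1 / lam), t * lam ∈ Icc (0 : ℝ) 1 := fun t ht =>
    ⟨mul_nonneg ht.1 hlam.le, (le_div_iff₀ hlam).1 ht.2⟩
  constructor
  · intro h t ht i
    have ht' := div_mem_Icc hlam ht
    rcases i with k | n
    · rw [duh_inl hlam hv0 ht]
      have := (eq_u_iff hu hv m k).1 (fun t ht => h.eq_u t ht k) _ ht'
      simp only [inter]
      rw [this]
      simp
    · rw [duh_inr hlam]
      simp only [inter]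
      rw [h.eq_v _ ht' n]
      ring
  · intro h
    refine ⟨fun t ht k => (eq_u_iff hu hv m k).2 (fun t ht => ?_) t ht, fun t ht n => ?_⟩
    · have := h _ (mul_mem t ht) (.inl k)
      rw [duh_inl hlam hv0 (mul_mem t ht), mul_div_cancel_right₀ _ hlam.ne'] at this
      simp only [inter] at this
      rw [this]
      simp
    · have := h _ (mul_mem t ht) (.inr n)
      rw [duh_inr hlam, mul_div_cancel_right₀ _ hlam.ne'] at this
      simp only [inter] at this
      linear_combination this

end Duhamel

end DSW

/-! ### Dilation in time and the class Y -/

namespace DSW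

section Scale

variable {ι : Type*}

/-- `c` is the restriction to `I` of a family with frequency density `α` of finite norm. -/
def HasRep (I : Set ℝ) (c : ι → ℝ → ℂ) : Prop :=
  ∃ α : ι → ℝ → ℂ, (∀ i, Measurable (α i)) ∧ zNorm (en α) ≠ ⊤ ∧
    ∀ t ∈ I, ∀ i, c i t = hat (α i) t

lemma HasRep.mono {I J : Set ℝ} {c : ι → ℝ → ℂ} (h : HasRep I c) (hJ : J ⊆ I) : HasRep J c := by
  obtain ⟨α, h1, h2, h3⟩ := h
  exact ⟨α, h1, h2, fun t ht => h3 t (hJ ht)⟩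

lemma HasRep.congr {I : Set ℝ} {c c' : ι → ℝ → ℂ} (h : HasRep I c)
    (hc : ∀ t ∈ I, ∀ i, c' i t = c i t) : HasRep I c' := by
  obtain ⟨α, h1, h2, h3⟩ := h
  exact ⟨α, h1, h2, fun t ht i => (hc t ht i).trans (h3 t ht i)⟩

/-- Translation in time, and multiplication by constants of modulus one. -/
lemma HasRep.shift {I J : Set ℝ} {c c' : ι → ℝ → ℂ} (h : HasRep I c) {t₀ : ℝ} {w : ι → ℂ}
    (hw : ∀ i, ‖w i‖ = 1) (hJ : ∀ s ∈ J, t₀ + s ∈ I)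
    (hc : ∀ s ∈ J, ∀ i, c' i s = w i * c i (t₀ + s)) : HasRep J c' := by
  obtain ⟨α, h1, h2, h3⟩ := h
  refine ⟨fun i τ => w i * (Complex.exp (Complex.I * (τ : ℂ) * (t₀ : ℂ)) * α i τ),
    fun i => ?_, ?_, fun s hs i => ?_⟩
  · have := h1 i
    fun_prop
  · convert h2 using 2
    ext i τ
    unfold en
    rw [enorm_mul, enorm_mul, enorm_exp_I_mul, one_mul, ← ofReal_norm (w i), hw, ENNReal.ofReal_one,
      one_mul]
  · rw [hc s hs, h3 _ (hJ s hs), hat_const_mul]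
    congr 1
    unfold hat
    congr 1
    ext τ
    rw [← mul_assoc, ← Complex.exp_add]
    congr 2
    push_cast
    ring

/-- Dilation of the frequency density. -/
noncomputable def scale (lam : ℝ) (α : ι → ℝ → ℂ) (i : ι) (τ : ℝ) : ℂ := lam * α i (lam * τ)

lemma ofReal_mul_lintegral_comp_mul {a : ℝ} (ha : 0 < a) {f : ℝ → ℝ≥0∞} (hf : Measurable f) :
    ENNReal.ofReal a * ∫⁻ x, f (a * x) = ∫⁻ x, f x := by
  conv_rhs => rw [← Real.smul_map_volume_mul_left ha.ne', lintegral_smul_measure, abs_of_pos ha,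
    lintegral_map hf (measurable_const_mul a)]
  rfl

variable {lam : ℝ} (hlam : 0 < lam) {α : ι → ℝ → ℂ}

lemma measurable_scale (h : ∀ i, Measurable (α i)) (i : ι) : Measurable (scale lam α i) := by
  have := h i
  unfold scale
  fun_prop

include hlam

lemma hat_scale (i : ι) (s : ℝ) : hat (scale lam α i) s = hat (α i) (s / lam) := by
  unfold hat scale
  have := Measure.integral_comp_mul_left (fun σ : ℝ =>
    Complex.exp (Complex.I * (σ : ℂ) * ((s / lam : ℝ) : ℂ)) * α i σ) lam
  rw [abs_of_pos (inv_pos.2 hlam), eq_inv_smul_iff₀ hlam.ne', ← integral_smul] at this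
  rw [← this]
  congr 1
  ext τ
  have : (lam : ℂ) ≠ 0 := by exact_mod_cast hlam.ne'
  rw [Complex.real_smul, show Complex.I * ((lam * τ : ℝ) : ℂ) * ((s / lam : ℝ) : ℂ) =
    Complex.I * τ * s by push_cast; field_simp]
  ring

lemma enorm_scale (i : ι) (τ : ℝ) : en (scale lam α) i τ = ENNReal.ofReal lam * ‖α i (lam * τ)‖ₑ := by
  unfold en scale
  rw [enorm_mul, ← ofReal_norm (lam : ℂ), Complex.norm_real, Real.norm_of_nonneg hlam.le]

variable (hα : ∀ i, Measurable (α i))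

include hα

lemma sNorm_scale : sNorm (en (scale lam α)) = sNorm (en α) := by
  unfold sNorm
  refine tsum_congr fun i => ?_
  simp_rw [enorm_scale hlam]
  have := (hα i).enorm
  rw [lintegral_const_mul _ (by fun_prop),
    ofReal_mul_lintegral_comp_mul hlam (f := fun x => ‖α i x‖ₑ) this]
  rfl

/-- Together with `sNorm_scale` this is the dilation invariance behind uniqueness for large
solutions: both parts of the right-hand side of `zNorm_cconv_le` keep their size. The inhomogeneous
norm would contain an L² part growing with lam. -/
lemma dNorm_scale : dNorm (en (scale lam α)) = dNorm (en α) := by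
  unfold dNorm
  refine tsum_congr fun i => ?_
  simp_rw [enorm_scale hlam]
  have hm := (hα i).enorm
  have := ofReal_mul_lintegral_comp_mul hlam (f := fun x => ENNReal.ofReal |x| * ‖α i x‖ₑ ^ 2)
    (by fun_prop)
  unfold en
  rw [← this, ← lintegral_const_mul _ (by fun_prop)]
  refine lintegral_congr fun τ => ?_
  rw [abs_mul, abs_of_pos hlam, ENNReal.ofReal_mul hlam.le]
  ring

/-- Used with the inverse dilation, to return from the unit interval to the original time, where the
inhomogeneous norm does not grow. -/
lemma hNorm_scale_le (h1 : lam ≤ 1) : hNorm (en (scale lam α)) ≤ hNorm (en α) := by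
  unfold hNorm
  refine ENNReal.tsum_le_tsum fun i => ?_
  simp_rw [enorm_scale hlam]
  have hm := (hα i).enorm
  have := ofReal_mul_lintegral_comp_mul hlam (f := fun x => jb x * ‖α i x‖ₑ ^ 2) (by fun_prop)
  unfold en
  rw [← this, ← lintegral_const_mul _ (by fun_prop)]
  refine lintegral_mono fun τ => ?_
  have e : ENNReal.ofReal lam * jb τ ≤ jb (lam * τ) := by
    unfold jb
    rw [← ENNReal.ofReal_mul hlam.le]
    refine ENNReal.ofReal_le_ofReal ?_
    rw [abs_mul, abs_of_pos hlam]
    linarith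
  calc jb τ * (ENNReal.ofReal lam * ‖α i (lam * τ)‖ₑ) ^ 2
      = ENNReal.ofReal lam * (ENNReal.ofReal lam * jb τ * ‖α i (lam * τ)‖ₑ ^ 2) := by ring
    _ ≤ _ := by gcongr

end Scale

section Rescale

variable {ι : Type*}

/-- A restricted family, with rescaled time, is represented on the unit interval with a bound that
does not depend on the scale. -/
lemma HasRep.exists_bound {I : Set ℝ} {c : ι → ℝ → ℂ} (h : HasRep I c) :
    ∃ ρ : ℝ≥0∞, ρ ≠ ⊤ ∧ ∀ lam : ℝ, 0 < lam → Icc 0 (1 / lam) ⊆ I →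
      ∃ γ, Rep γ (fun i s => c i (s / lam)) ∧ zNorm (en γ) ≤ ρ := by
  obtain ⟨α, h1, h2, h3⟩ := h
  refine ⟨profConst decayProfile * zNorm (en α),
    ENNReal.mul_ne_top isProfile_decay.profConst_ne_top h2, fun lam hlam hI => ?_⟩
  have hm := measurable_scale (lam := lam) h1
  -- Convolution with the decay profile provides the e^{-t} required by `Rep`. It also restores the
  -- inhomogeneous norm from the invariant ones, hence a bound without lam.
  have hb : zNorm (en (cconv decayProfile (scale lam α))) ≤ profConst decayProfile * zNorm (en α) := by
    refine (zNorm_cconv_le isProfile_decay.measurable hm).trans ?_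
    rw [dNorm_scale hlam h1, sNorm_scale hlam h1]
    unfold zNorm
    gcongr
    exact dNorm_le_hNorm _
  refine ⟨cconv decayProfile (scale lam α), ⟨measurable_cconv isProfile_decay.measurable hm,
    ne_top_of_le_ne_top (ENNReal.mul_ne_top isProfile_decay.profConst_ne_top h2) hb,
    fun t ht i => ?_⟩, hb⟩
  have hInt : Integrable (scale lam α i) := by
    refine integrable_of_enorm (hm i) ?_
    have : sNorm (en (scale lam α)) ≠ ⊤ := by
      rw [sNorm_scale hlam h1]
      exact ne_top_of_le_ne_top h2 (sNorm_le_zNorm _)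
    intro htop
    refine this (top_le_iff.1 (le_trans ?_ (ENNReal.le_tsum i)))
    unfold en
    rw [htop]
    simp
  rw [hat_cconv isProfile_decay.integrable hInt, hat_decay ht, hat_scale hlam, ← mul_assoc,
    ← Complex.exp_add, add_neg_cancel, Complex.exp_zero, one_mul,
    h3 _ (hI (div_mem_Icc hlam ht))]

/-- The converse passage: the factor e^t is absorbed by the growth profile, and the dilation is
undone. -/
lemma Rep.hasRep {γ a : ι → ℝ → ℂ} (h : Rep γ a) {lam : ℝ} (hlam : 1 ≤ lam) {c : ι → ℝ → ℂ}
    (hc : ∀ s ∈ Icc (0 : ℝ) 1, ∀ i, c i (s / lam) = a i s) : HasRep (Icc 0 (1 / lam)) c := by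
  have l0 : 0 < lam := by linarith
  have m1 := measurable_cconv isProfile_growth.measurable h.measurable
  have hz : zNorm (en (cconv growthProfile γ)) ≠ ⊤ :=
    ne_top_of_le_ne_top (ENNReal.mul_ne_top isProfile_growth.profConst_ne_top h.finite)
      (zNorm_cconv_le' isProfile_growth.measurable h.measurable)
  refine ⟨scale lam⁻¹ (cconv growthProfile γ), measurable_scale m1, ?_, fun t ht i => ?_⟩
  · refine ne_top_of_le_ne_top hz ?_
    unfold zNorm
    rw [sNorm_scale (inv_pos.2 l0) m1]
    gcongr
    exact hNorm_scale_le (inv_pos.2 l0) m1 (inv_le_one_of_one_le₀ hlam)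
  · have ht' : t * lam ∈ Icc (0 : ℝ) 1 := ⟨mul_nonneg ht.1 l0.le, (le_div_iff₀ l0).1 ht.2⟩
    have := hc _ ht' i
    rw [mul_div_cancel_right₀ _ l0.ne'] at this
    rw [this, hat_scale (inv_pos.2 l0), div_inv_eq_mul,
      hat_cconv isProfile_growth.integrable (h.integrable i), hat_growth ht', h.eq _ ht']

end Rescale

lemma ofReal_bracket_le (r : ℝ) : ENNReal.ofReal (bracket r) ≤ jb r := by
  refine ENNReal.ofReal_le_ofReal ?_
  unfold bracket
  rw [Real.sqrt_le_left (by positivity)]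
  nlinarith [abs_nonneg r, sq_abs r]

lemma jb_le_two_mul_ofReal_bracket (r : ℝ) : jb r ≤ 2 * ENNReal.ofReal (bracket r) := by
  unfold jb bracket
  rw [← ENNReal.ofReal_ofNat, ← ENNReal.ofReal_mul (by norm_num)]
  refine ENNReal.ofReal_le_ofReal ?_
  have h1 : 1 ≤ Real.sqrt (1 + r ^ 2) := Real.one_le_sqrt.2 (by nlinarith)
  have h2 : |r| ≤ Real.sqrt (1 + r ^ 2) := Real.abs_le_sqrt (by nlinarith)
  linarith

lemma hat_comp_add (a : ℝ → ℂ) (p t : ℝ) : hat (fun s => a (s + p)) t =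
    Complex.exp (Complex.I * ((-p : ℝ) : ℂ) * (t : ℂ)) * hat a t := by
  unfold hat
  rw [← integral_const_mul, ← integral_add_right_eq_self (μ := volume) (fun s : ℝ =>
    Complex.exp (Complex.I * ((-p : ℝ) : ℂ) * (t : ℂ)) *
      (Complex.exp (Complex.I * (s : ℂ) * (t : ℂ)) * a s)) p]
  congr 1
  ext s
  rw [← mul_assoc, ← Complex.exp_add]
  congr 2
  push_cast
  ring

variable {L : ℝ} [Fact (0 < L)]

local notation "μL" => AddCircle.haarAddCircle (T := L)

/-- Translating the density of the k-th coefficient by p k multiplies it in time by exp(-i p(k) t)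
and turns the weight ⟨τ - p k⟩^{1/2} into ⟨τ⟩^{1/2}. The two brackets in use are equivalent up to a
factor 2. -/
lemma memRestricted_iff (p : ℤ → ℝ) (I : Set ℝ) (w : ℝ → AddCircle L → ℝ) :
    MemRestricted p I w ↔ HasRep I (fun k t =>
      Complex.exp (Complex.I * ((-p k : ℝ) : ℂ) * (t : ℂ)) * fourierCoeff (fun x => (w t x : ℂ)) k) := by
  constructor
  · rintro ⟨a, h1, h2, h3, h4⟩
    refine ⟨fun k s => a k (s + p k), fun k => by have := h1 k; fun_prop, ?_, fun t ht k => ?_⟩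
    · refine ENNReal.add_ne_top.2 ⟨?_, ?_⟩
      · refine ne_top_of_le_ne_top (ENNReal.mul_ne_top (by finiteness : (2 : ℝ≥0∞) ≠ ⊤) h2.ne) ?_
        unfold hNorm
        rw [← ENNReal.tsum_mul_left]
        refine ENNReal.tsum_le_tsum fun k => ?_
        have hm := (h1 k).enorm
        have mb : Measurable fun τ => ENNReal.ofReal (bracket (τ - p k)) := by
          unfold bracket; fun_prop
        rw [← lintegral_const_mul _ (by fun_prop),
          ← lintegral_add_right_eq_self (fun τ => 2 * _) (p k)]
        refine lintegral_mono fun s => ?_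
        beta_reduce
        rw [add_sub_cancel_right, ← mul_assoc]
        gcongr
        · exact jb_le_two_mul_ofReal_bracket s
        · exact le_rfl
      · refine ne_top_of_le_ne_top h3.ne (le_of_eq ?_)
        unfold sNorm en
        refine tsum_congr fun k => ?_
        rw [lintegral_add_right_eq_self (fun τ => ‖a k τ‖ₑ)]
    · beta_reduce
      rw [hat_comp_add, h4 t ht k]
      rfl
  · rintro ⟨α, h1, h2, h3⟩
    refine ⟨fun k τ => α k (τ + -p k), fun k => by have := h1 k; fun_prop, ?_, ?_, fun t ht k => ?_⟩
    · refine lt_of_le_of_lt ?_ (lt_top_iff_ne_top.2 (ne_top_of_le_ne_top h2 (hNorm_le_zNorm _)))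
      unfold hNorm
      refine ENNReal.tsum_le_tsum fun k => ?_
      rw [← lintegral_add_right_eq_self (fun τ => jb τ * _) (-p k)]
      refine lintegral_mono fun s => ?_
      beta_reduce
      rw [← sub_eq_add_neg]
      gcongr
      · exact ofReal_bracket_le _
      · exact le_rfl
    · refine lt_of_eq_of_lt ?_ (lt_top_iff_ne_top.2 (ne_top_of_le_ne_top h2 (sNorm_le_zNorm _)))
      unfold sNorm en
      refine tsum_congr fun k => ?_
      rw [lintegral_add_right_eq_self (fun τ => ‖α k τ‖ₑ)]
    · have := hat_comp_add (α k) (-p k) t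
      unfold hat at this h3
      rw [this, ← h3 t ht k, ← mul_assoc, ← Complex.exp_add]
      rw [show Complex.I * ((-(-p k) : ℝ) : ℂ) * (t : ℂ) + Complex.I * ((-p k : ℝ) : ℂ) * (t : ℂ) = 0
        by push_cast; ring, Complex.exp_zero, one_mul]

lemma tsum_sum_type (f : ℤ ⊕ ℤ → ℝ≥0∞) : ∑' i, f i = ∑' k, f (.inl k) + ∑' k, f (.inr k) :=
  Summable.tsum_sum ENNReal.summable ENNReal.summable

lemma hasRep_sum_iff (I : Set ℝ) (c : ℤ ⊕ ℤ → ℝ → ℂ) :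
    HasRep I c ↔ HasRep I (fun k => c (.inl k)) ∧ HasRep I (fun k => c (.inr k)) := by
  have key : ∀ α : ℤ ⊕ ℤ → ℝ → ℂ, zNorm (en α) = zNorm (en fun k => α (.inl k)) +
      zNorm (en fun k => α (.inr k)) := by
    intro α
    unfold zNorm hNorm sNorm
    rw [tsum_sum_type, tsum_sum_type]
    unfold en
    ring
  constructor
  · rintro ⟨α, h1, h2, h3⟩
    rw [key, ENNReal.add_ne_top] at h2
    exact ⟨⟨_, fun k => h1 _, h2.1, fun t ht k => h3 t ht _⟩,
      ⟨_, fun k => h1 _, h2.2, fun t ht k => h3 t ht _⟩⟩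
  · rintro ⟨⟨α, h1, h2, h3⟩, ⟨β, h1', h2', h3'⟩⟩
    refine ⟨Sum.elim α β, ?_, ?_, ?_⟩
    · rintro (k | k)
      exacts [h1 k, h1' k]
    · rw [key]
      exact ENNReal.add_ne_top.2 ⟨h2, h2'⟩
    · rintro t ht (k | k)
      exacts [h3 t ht k, h3' t ht k]

lemma fourierCoeff_translate (w : AddCircle L → ℂ) (a : ℝ) (k : ℤ) :
    fourierCoeff (fun x => w (x + (a : AddCircle L))) k =
      Complex.exp (Complex.I * (freq L k : ℂ) * (a : ℂ)) * fourierCoeff w k := by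
  unfold fourierCoeff
  rw [← integral_const_mul, ← integral_sub_right_eq_self (μ := μL) _ (a : AddCircle L)]
  congr 1
  ext x
  beta_reduce
  rw [sub_add_cancel, smul_eq_mul, smul_eq_mul, ← mul_assoc]
  congr 1
  induction x using QuotientAddGroup.induction_on with
  | H y =>
    have : ((y : AddCircle L) - (a : AddCircle L)) = ((y - a : ℝ) : AddCircle L) := by simp
    refine (congrArg (fourier (-k)) this).trans ?_
    refine Eq.trans fourier_coe_apply ?_
    refine Eq.trans ?_ (congrArg _ (fourier_coe_apply (T := L) (n := -k) (x := y))).symm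
    rw [← Complex.exp_add]
    congr 1
    unfold freq
    push_cast
    ring

lemma fourierCoeff_sub_const (f : L2 L) (m : ℝ) (n : ℤ) :
    fourierCoeff (fun x => ((f x - m : ℝ) : ℂ)) n = coef f n - if n = 0 then (m : ℂ) else 0 := by
  have h := fourierCoeff_ofReal_add (integrable_L2 f) (integrable_const (-m)) n
  simp_rw [sub_eq_add_neg]
  rw [h, coef]
  congr 1
  have h2 := fourierCoeff.const_mul (T := L) (fourier 0) (-(m : ℂ)) n
  rw [fourierCoeff_fourier] at h2
  simp only [fourier_zero, mul_one] at h2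
  push_cast
  rw [h2]
  by_cases hn : n = 0
  · subst hn; simp
  · simp [hn]

/-- The translation by m t multiplies the k-th coefficient of u by exp(i m ξ t), which changes the
rotation by ξ³ into the rotation by ξ³ - mξ of the interaction picture. -/
lemma memY_iff (I : Set ℝ) (v₀ : L2 L) (u v : ℝ → L2 L) :
    MemY I v₀ u v ↔ HasRep I (inter (mean v₀) u v) := by
  unfold MemY MemKdV MemHalf
  rw [hasRep_sum_iff, memRestricted_iff, memRestricted_iff]
  refine and_congr (iff_of_eq ?_) (iff_of_eq ?_)
  · congr 1
    ext k t
    have := fourierCoeff_translate (fun x => (u t x : ℂ)) (mean v₀ * t) k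
    rw [this, ← mul_assoc, ← Complex.exp_add]
    simp only [inter]
    unfold coef
    congr 2
    rw [phase_eq]
    unfold freq
    push_cast
    ring
  · congr 1
    ext k t
    rw [fourierCoeff_sub_const]
    simp [inter]

/-- Membership in the solution class is preserved by translation in time. -/
lemma hasRep_inter_shift {I J : Set ℝ} {m : ℝ} {u v : ℝ → L2 L} (h : HasRep I (inter m u v)) {t₀ : ℝ}
    (hJ : ∀ s ∈ J, t₀ + s ∈ I) :
    HasRep J (inter m (fun s => u (t₀ + s)) (fun s => v (t₀ + s))) := by
  refine h.shift (t₀ := t₀) (w := Sum.elim (fun k => Complex.exp (Complex.I * (phase L m k : ℂ) *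
    (t₀ : ℂ))) fun _ => 1) ?_ hJ ?_
  · rintro (k | k)
    · exact norm_exp_I_mul _ _
    · simp
  · rintro s - (k | k)
    · simp only [inter, Sum.elim_inl]
      rw [← mul_assoc, ← Complex.exp_add]
      congr 2
      push_cast
      ring
    · simp [inter]

end DSW

/-! ### Continuity in L² and local existence -/

namespace DSW

variable {L : ℝ} [Fact (0 < L)]

/-- Parseval and dominated convergence for series: continuity of each coefficient and one square
summable majorant suffice. -/
lemma continuousOn_of_coef {I : Set ℝ} {u : ℝ → L2 L} {b : ℤ → ℝ} (hs : Summable fun k => b k ^ 2)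
    (hc : ∀ k, ContinuousOn (fun t => coef (u t) k) I)
    (hb : ∀ t ∈ I, ∀ t' ∈ I, ∀ k, ‖coef (u t) k - coef (u t') k‖ ≤ b k) : ContinuousOn u I := by
  intro t₀ ht₀
  have h1 : Filter.Tendsto (fun t => ∑' k, ‖coef (u t) k - coef (u t₀) k‖ ^ 2) (𝓝[I] t₀)
      (𝓝 (∑' _ : ℤ, (0 : ℝ))) := by
    refine tendsto_tsum_of_dominated_convergence hs (fun k => ?_) ?_
    · have := (((hc k) t₀ ht₀).sub_const (coef (u t₀) k)).norm.pow 2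
      simpa [ContinuousWithinAt] using this
    · filter_upwards [self_mem_nhdsWithin] with t ht k
      rw [Real.norm_of_nonneg (by positivity)]
      gcongr
      exact hb t ht t₀ ht₀ k
  rw [tsum_zero] at h1
  have h2 : ∀ t, ∑' k, ‖coef (u t) k - coef (u t₀) k‖ ^ 2 = ‖u t - u t₀‖ ^ 2 := fun t => by
    rw [← (hasSum_sq_coef (u t - u t₀)).tsum_eq]
    simp_rw [coef_sub]
  simp_rw [h2] at h1
  have h3 := h1.sqrt
  simp only [Real.sqrt_zero, Real.sqrt_sq (norm_nonneg _)] at h3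
  exact tendsto_iff_norm_sub_tendsto_zero.2 h3

section RepContinuity

variable {I : Set ℝ} {m : ℝ} {u v : ℝ → L2 L}

/-- The L¹ norms of the densities are a majorant valid at all times, square summable by the ℓ²L¹
condition. -/
lemma HasRep.exists_dominating {ι : Type*} {c : ι → ℝ → ℂ} (h : HasRep I c) :
    ∃ b : ι → ℝ, (Summable fun i => b i ^ 2) ∧ (∀ i, ContinuousOn (c i) I) ∧
      ∀ t ∈ I, ∀ i, ‖c i t‖ ≤ b i := by
  obtain ⟨α, h1, h2, h3⟩ := h
  have hInt := integrable_of_zNorm h1 h2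
  refine ⟨fun i => (∫⁻ s, ‖α i s‖ₑ).toReal, ?_, fun i => ?_, fun t ht i => ?_⟩
  · have : ∑' i, (∫⁻ s, ‖α i s‖ₑ) ^ 2 ≠ ⊤ := ne_top_of_le_ne_top h2 (sNorm_le_zNorm _)
    simpa only [ENNReal.toReal_pow] using ENNReal.summable_toReal this
  · exact (continuous_hat (hInt i)).continuousOn.congr fun t ht => h3 t ht i
  · rw [h3 t ht, ← toReal_enorm]
    exact ENNReal.toReal_mono (lintegral_enorm_ne_top h2 i) (enorm_hat_le _ _)

lemma coef_eq_exp_mul_inter (t : ℝ) (k : ℤ) :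
    coef (u t) k = Complex.exp (Complex.I * (phase L m k : ℂ) * (t : ℂ)) * inter m u v (.inl k) t := by
  simp only [inter]
  rw [← mul_assoc, ← Complex.exp_add]
  rw [show Complex.I * (phase L m k : ℂ) * (t : ℂ) + Complex.I * ((-phase L m k : ℝ) : ℂ) * (t : ℂ) = 0
    by push_cast; ring, Complex.exp_zero, one_mul]

lemma HasRep.continuousOn_u (h : HasRep I (inter m u v)) : ContinuousOn u I := by
  obtain ⟨b, hb, hc, hd⟩ := h.exists_dominating
  refine continuousOn_of_coef (b := fun k => 2 * b (.inl k)) ?_ (fun k => ?_) fun t ht t' ht' k => ?_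
  · have hs : Summable fun k => b (.inl k) ^ 2 := hb.comp_injective Sum.inl_injective
    simp_rw [mul_pow]
    exact hs.mul_left _
  · have := hc (.inl k)
    refine ContinuousOn.congr (f := fun t : ℝ => Complex.exp (Complex.I * (phase L m k : ℂ) * (t : ℂ)) *
      inter m u v (.inl k) t) (by fun_prop) fun t _ => coef_eq_exp_mul_inter t k
  · have e : ∀ t, ‖coef (u t) k‖ = ‖inter m u v (.inl k) t‖ := fun t => by
      rw [coef_eq_exp_mul_inter (m := m) (v := v), norm_mul, norm_exp_I_mul, one_mul]
    calc _ ≤ ‖coef (u t) k‖ + ‖coef (u t') k‖ := norm_sub_le _ _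
      _ ≤ _ := by rw [e, e, two_mul]; exact add_le_add (hd t ht _) (hd t' ht' _)

lemma HasRep.continuousOn_v (h : HasRep I (inter m u v)) : ContinuousOn v I := by
  obtain ⟨b, hb, hc, hd⟩ := h.exists_dominating
  refine continuousOn_of_coef (b := fun k => 2 * b (.inr k)) ?_ (fun k => ?_) fun t ht t' ht' k => ?_
  · have hs : Summable fun k => b (.inr k) ^ 2 := hb.comp_injective Sum.inr_injective
    simp_rw [mul_pow]
    exact hs.mul_left _
  · have := hc (.inr k)
    refine ContinuousOn.congr (f := fun t => inter m u v (.inr k) t + if k = 0 then (m : ℂ) else 0)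
      (this.add continuousOn_const) fun t _ => ?_
    simp [inter]
  · have e : coef (v t) k - coef (v t') k = inter m u v (.inr k) t - inter m u v (.inr k) t' := by
      simp [inter]
    calc _ ≤ ‖inter m u v (.inr k) t‖ + ‖inter m u v (.inr k) t'‖ := by
          rw [e]; exact norm_sub_le _ _
      _ ≤ _ := by rw [two_mul]; exact add_le_add (hd t ht _) (hd t' ht' _)

end RepContinuity

/-- Parseval's identity in the interaction picture. -/
lemma energy_eq_tsum_inter {m : ℝ} {u v : ℝ → L2 L} {t : ℝ} (h : coef (v t) 0 = m) :
    ENNReal.ofReal (‖u t‖ ^ 2) + ENNReal.ofReal (‖v t‖ ^ 2) =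
      ∑' i, ‖inter m u v i t‖ₑ ^ 2 + ∑' n : ℤ, ‖if n = 0 then (m : ℂ) else 0‖ₑ ^ 2 := by
  rw [tsum_sum_type, ← tsum_enorm_coef (u t), ← tsum_enorm_coef (v t), add_assoc]
  refine congrArg₂ (· + ·) ?_ ?_
  · refine tsum_congr fun k => ?_
    simp only [inter]
    rw [enorm_mul, enorm_exp_I_mul, one_mul]
  · rw [← ENNReal.tsum_add]
    refine tsum_congr fun n => ?_
    simp only [inter]
    by_cases hn : n = 0
    · subst hn; simp [h]
    · simp [hn]

lemma mean_le (f : L2 L) : |mean f| ≤ ‖f‖ := by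
  have := norm_coef_le f 0
  rwa [coef_zero_eq_mean, Complex.norm_real] at this

lemma base_pos : 0 < 2 * Real.pi / L := by
  have : 0 < L := Fact.out
  have := Real.pi_pos
  positivity

omit [Fact (0 < L)] in
lemma duh_inr_zero (m lam : ℝ) (a : ℤ ⊕ ℤ → ℝ → ℂ) (t : ℝ) :
    (circleSys L m lam).duh a a (.inr 0) t = 0 := by
  have : ∀ s, (circleSys L m lam).rhs a a (.inr 0) s = 0 := by
    intro s
    unfold QSys.rhs
    refine (tsum_congr fun e => ?_).trans tsum_zero
    obtain ⟨e | ⟨k, l⟩, he⟩ := e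
    · simp [dswSys] at he
    · have hkl : k + l = 0 := by simpa [dswSys] using he
      have : (k : ℝ) + l = 0 := by exact_mod_cast hkl
      simp only [dswSys, Sum.elim_inr, this, mul_zero, zero_div, Complex.ofReal_zero, zero_mul]
  unfold QSys.duh
  simp [this]

/-- Local existence, on a time interval whose length depends only on the size of the data. -/
theorem exists_local (L : ℝ) [Fact (0 < L)] (R : ℝ) : ∃ T : ℝ, 0 < T ∧ ∀ u₀ v₀ : L2 L,
    ‖u₀‖ ^ 2 + ‖v₀‖ ^ 2 ≤ R ^ 2 → ∃ u v : ℝ → L2 L, u 0 = u₀ ∧ v 0 = v₀ ∧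
      FourierSol (Icc 0 T) u v ∧ HasRep (Icc 0 T) (inter (mean v₀) u v) ∧
      ∀ t ∈ Icc 0 T, ‖u t‖ ^ 2 + ‖v t‖ ^ 2 ≤ ‖u₀‖ ^ 2 + ‖v₀‖ ^ 2 := by
  set h : ℝ := 2 * Real.pi / L with hh
  have h0 : 0 < h := base_pos
  set ρ : ℝ≥0∞ := ENNReal.ofReal (R ^ 2) with hρ
  have hρt : ρ ≠ ⊤ := ENNReal.ofReal_ne_top
  have hB : QSys.dataConst * ρ ≠ ⊤ := ENNReal.mul_ne_top QSys.dataConst_ne_top hρt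
  -- `lam` is chosen before the data, from `R` and `L` alone; the mean enters only through |m| ≤
  -- |R|.
  obtain ⟨lam, hlamB, hlam⟩ :=
    ((eventually_dswEps_mul_le h |R| hB).and (Filter.eventually_ge_atTop 1)).exists
  have l0 : 0 < lam := by linarith
  refine ⟨1 / lam, by positivity, fun u₀ v₀ hdata => ?_⟩
  set m := mean v₀ with hm
  have hmR : |m| ≤ |R| := (mean_le v₀).trans (by
    rw [← sq_le_sq₀ (norm_nonneg _) (abs_nonneg _), sq_abs]
    nlinarith [sq_nonneg ‖u₀‖])
  have hsmall := dswSys_small h0 hlam hmR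
  have hε : dswEps h |R| lam ≠ ⊤ := dswEps_ne_top
  have hεB : QSys.dataConst * dswEps h |R| lam * ρ ≤ 1 := by
    calc _ = dswEps h |R| lam * (QSys.dataConst * ρ) := by ring
      _ ≤ 1 := hlamB
  have hv00 : coef v₀ 0 = m := coef_zero_eq_mean v₀
  set c : ℤ ⊕ ℤ → ℂ := fun i => inter m (fun _ => u₀) (fun _ => v₀) i 0 with hc
  have hE := energy_eq_tsum_inter (m := m) (u := fun _ => u₀) (v := fun _ => v₀) (t := 0) hv00
  have hcρ : ∑' i, ‖c i‖ₑ ^ 2 ≤ ρ := by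
    calc ∑' i, ‖c i‖ₑ ^ 2 ≤ ENNReal.ofReal (‖u₀‖ ^ 2) + ENNReal.ofReal (‖v₀‖ ^ 2) := by
          rw [hE]; exact le_self_add
      _ = ENNReal.ofReal (‖u₀‖ ^ 2 + ‖v₀‖ ^ 2) := by
          rw [ENNReal.ofReal_add (by positivity) (by positivity)]
      _ ≤ ρ := ENNReal.ofReal_le_ofReal hdata
  have hcr : ∀ i, c ((dswSymm h m lam).bar i) = conj (c i) := by
    rintro (k | k)
    · simp [hc, dswSymm, inter, coef_neg]
    · by_cases hk : k = 0
      · simp [hc, dswSymm, inter, hk, hv00]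
      · simp [hc, dswSymm, inter, coef_neg, hk]
  obtain ⟨γ, a, hr, hb, heq⟩ := hsmall.exists_solution hε hρt hεB hcρ
  have hρ' : 16 * (QSys.opConst * dswEps h |R| lam * (10 * (profConst decayProfile * ρ))) ≤ 1 := by
    refine le_trans ?_ hεB
    unfold QSys.dataConst
    calc _ = 160 * (QSys.opConst * profConst decayProfile * dswEps h |R| lam * ρ) := by ring
      _ ≤ 256 * (QSys.opConst * profConst decayProfile * dswEps h |R| lam * ρ) := by
          gcongr; norm_num
      _ = _ := by ring
  have hreal : ∀ t ∈ Icc (0 : ℝ) 1, ∀ i, a ((dswSymm h m lam).bar i) t = conj (a i t) :=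
    fun t ht i => hsmall.real_of_real hε (dswSymm h m lam) hρ' hr hb hcr heq ht i
  have hen : ∀ t ∈ Icc (0 : ℝ) 1, ∑' i, ‖a i t‖ₑ ^ 2 ≤ ∑' i, ‖c i‖ₑ ^ 2 := fun t ht =>
    hsmall.energy_le hε (dswSymm h m lam) (dswSys_conservative h0 hlam hmR) hρt hεB hcρ hcr hr hb
      heq ht
  have hsum : ∀ t ∈ Icc (0 : ℝ) 1, ∑' k, ‖a (.inl k) t‖ₑ ^ 2 ≠ ⊤ ∧ ∑' k, ‖a (.inr k) t‖ₑ ^ 2 ≠ ⊤ := by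
    intro t ht
    have := hr.tsum_sq_ne_top ht
    rw [tsum_sum_type] at this
    exact ENNReal.add_ne_top.1 this
  have hzero : ∀ t ∈ Icc (0 : ℝ) 1, a (.inr 0) t = 0 := by
    intro t ht
    rw [heq t ht, duh_inr_zero]
    simp [hc, inter, hv00]
  have mul_mem : ∀ t ∈ Icc 0 (1 / lam), t * lam ∈ Icc (0 : ℝ) 1 := fun t ht =>
    ⟨mul_nonneg ht.1 l0.le, (le_div_iff₀ l0).1 ht.2⟩
  -- Outside the time interval nothing is known about `a`, and u is given the value 0 there; the
  -- same is done for v.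
  have hexu : ∀ t, ∃ f : L2 L, t ∈ Icc 0 (1 / lam) → ∀ k, coef f k =
      Complex.exp (Complex.I * (phase L m k : ℂ) * (t : ℂ)) * a (.inl k) (t * lam) := by
    intro t
    by_cases ht : t ∈ Icc 0 (1 / lam)
    · obtain ⟨f, hf⟩ := exists_coef_eq (L := L) (c := fun k =>
        Complex.exp (Complex.I * (phase L m k : ℂ) * (t : ℂ)) * a (.inl k) (t * lam)) (by
          simp_rw [enorm_mul, enorm_exp_I_mul, one_mul]
          exact (hsum _ (mul_mem t ht)).1) (fun k => by
          have := hreal _ (mul_mem t ht) (.inl k)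
          simp only [dswSymm, Sum.map_inl] at this
          rw [this, map_mul, ← Complex.exp_conj, map_mul, map_mul, Complex.conj_I,
            Complex.conj_ofReal, Complex.conj_ofReal]
          congr 2
          unfold phase
          rw [disp_neg]
          push_cast
          ring)
      exact ⟨f, fun _ => hf⟩
    · exact ⟨0, fun h => absurd h ht⟩
  have hexv : ∀ t, ∃ f : L2 L, t ∈ Icc 0 (1 / lam) → ∀ k, coef f k =
      a (.inr k) (t * lam) + if k = 0 then (m : ℂ) else 0 := by
    intro t
    by_cases ht : t ∈ Icc 0 (1 / lam)
    · obtain ⟨f, hf⟩ := exists_coef_eq (L := L) (c := fun k =>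
        a (.inr k) (t * lam) + if k = 0 then (m : ℂ) else 0) (by
          refine ne_top_of_le_ne_top (b := 2 * ∑' k, ‖a (.inr k) (t * lam)‖ₑ ^ 2 +
            2 * ∑' k : ℤ, ‖if k = 0 then (m : ℂ) else 0‖ₑ ^ 2) ?_ ?_
          · have h1 := (hsum _ (mul_mem t ht)).2
            have h2 : ∑' k : ℤ, ‖if k = 0 then (m : ℂ) else 0‖ₑ ^ 2 ≠ ⊤ := by
              rw [tsum_eq_single 0 fun k hk => by simp [hk]]
              finiteness
            finiteness
          · rw [← ENNReal.tsum_mul_left, ← ENNReal.tsum_mul_left, ← ENNReal.tsum_add]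
            refine ENNReal.tsum_le_tsum fun k => ?_
            refine le_trans ?_ (add_sq_le _ _)
            gcongr
            exact enorm_add_le _ _) (fun k => by
          have := hreal _ (mul_mem t ht) (.inr k)
          simp only [dswSymm, Sum.map_inr] at this
          rw [this, map_add]
          by_cases hk : k = 0
          · simp [hk]
          · simp [hk])
      exact ⟨f, fun _ => hf⟩
    · exact ⟨0, fun h => absurd h ht⟩
  choose u hu using hexu
  choose v hv using hexv
  have h0mem : (0 : ℝ) ∈ Icc 0 (1 / lam) := ⟨le_rfl, by positivity⟩
  have ha0 : ∀ i, a i 0 = c i := fun i => by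
    rw [heq 0 ⟨le_rfl, zero_le_one⟩]
    simp [QSys.duh]
  have hinter : ∀ s ∈ Icc (0 : ℝ) 1, ∀ i, inter m u v i (s / lam) = a i s := by
    intro s hs i
    have hs' := div_mem_Icc l0 hs
    rcases i with k | k
    · simp only [inter]
      rw [hu _ hs', div_mul_cancel₀ _ l0.ne', ← mul_assoc, ← Complex.exp_add]
      rw [show Complex.I * ((-phase L m k : ℝ) : ℂ) * ((s / lam : ℝ) : ℂ) +
        Complex.I * (phase L m k : ℂ) * ((s / lam : ℝ) : ℂ) = 0 by push_cast; ring, Complex.exp_zero,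
        one_mul]
    · simp only [inter]
      rw [hv _ hs', div_mul_cancel₀ _ l0.ne']
      ring
  have hmean : ∀ t ∈ Icc 0 (1 / lam), coef (v t) 0 = m := by
    intro t ht
    rw [hv t ht, hzero _ (mul_mem t ht)]
    simp
  have hrep : HasRep (Icc 0 (1 / lam)) (inter m u v) := hr.hasRep hlam hinter
  have hu0 : u 0 = u₀ := coef_injective fun k => by
    rw [hu 0 h0mem, zero_mul, ha0]
    simp [hc, inter]
  have hv0 : v 0 = v₀ := coef_injective fun k => by
    rw [hv 0 h0mem, zero_mul, ha0]
    simp [hc, inter]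
  have hci : ∀ i, inter m u v i 0 = c i := fun i => by
    have := hinter 0 ⟨le_rfl, zero_le_one⟩ i
    rwa [zero_div, ha0] at this
  refine ⟨u, v, hu0, hv0, ?_, hrep, fun t ht => ?_⟩
  · refine (fourierSol_iff l0 hmean hrep.continuousOn_u hrep.continuousOn_v).2 fun t ht i => ?_
    rw [hinter t ht, hci, heq t ht]
    congr 1
    exact QSys.duh_congr (fun s hs j => (hinter s hs j).symm) (fun s hs j => (hinter s hs j).symm) i ht
  · have hEt := energy_eq_tsum_inter (u := u) (hmean t ht)
    have e1 : ∑' i, ‖inter m u v i t‖ₑ ^ 2 ≤ ∑' i, ‖c i‖ₑ ^ 2 := by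
      refine le_trans (le_of_eq (tsum_congr fun i => ?_)) (hen _ (mul_mem t ht))
      rw [← hinter _ (mul_mem t ht), mul_div_cancel_right₀ _ l0.ne']
    have e2 : ENNReal.ofReal (‖u t‖ ^ 2 + ‖v t‖ ^ 2) ≤ ENNReal.ofReal (‖u₀‖ ^ 2 + ‖v₀‖ ^ 2) := by
      rw [ENNReal.ofReal_add (by positivity) (by positivity),
        ENNReal.ofReal_add (by positivity) (by positivity), hE, hEt]
      gcongr
    exact (ENNReal.ofReal_le_ofReal_iff (by positivity)).1 e2

end DSW

/-! ### Uniqueness in the class Y -/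

namespace DSW

variable {L : ℝ} [Fact (0 < L)]

lemma FourierSol.mono {I J : Set ℝ} {u v : ℝ → L2 L} (h : FourierSol I u v) (hJ : J ⊆ I) :
    FourierSol J u v :=
  ⟨fun t ht => h.eq_u t (hJ ht), fun t ht => h.eq_v t (hJ ht)⟩

/-- Two solutions of class `Y` with the same data agree for a short time. -/
lemma eventually_eq_of_hasRep {T m : ℝ} (hT : 0 < T) {u v u' v' : ℝ → L2 L}
    (hs : FourierSol (Icc 0 T) u v) (hs' : FourierSol (Icc 0 T) u' v')
    (hr : HasRep (Icc 0 T) (inter m u v)) (hr' : HasRep (Icc 0 T) (inter m u' v'))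
    (hm : coef (v 0) 0 = m) (hu0 : u 0 = u' 0) (hv0 : v 0 = v' 0) :
    ∃ δ > 0, ∀ t ∈ Icc 0 δ, u t = u' t ∧ v t = v' t := by
  obtain ⟨ρ, hρ, hb⟩ := hr.exists_bound
  obtain ⟨ρ', hρ', hb'⟩ := hr'.exists_bound
  have hB : 16 * (QSys.opConst * max ρ ρ') ≠ ⊤ := by
    have := QSys.opConst_ne_top
    have : max ρ ρ' ≠ ⊤ := by simp [hρ, hρ']
    finiteness
  -- The bounds ρ and ρ' were obtained first and hold for every dilation, so `lam` can be taken
  -- large in terms of them, however large the solutions are.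
  obtain ⟨lam, ⟨hlamB, hlam⟩, hlamT⟩ := (((eventually_dswEps_mul_le (2 * Real.pi / L) |m| hB).and
    (Filter.eventually_ge_atTop 1)).and (Filter.eventually_ge_atTop (1 / T))).exists
  have l0 : 0 < lam := by linarith
  have hsub : Icc 0 (1 / lam) ⊆ Icc 0 T := Icc_subset_Icc_right (by
    rw [div_le_iff₀ l0]; rwa [div_le_iff₀ hT, mul_comm] at hlamT)
  obtain ⟨γ, hγ, hγb⟩ := hb lam l0 hsub
  obtain ⟨γ', hγ', hγb'⟩ := hb' lam l0 hsub
  have hsmall := dswSys_small (base_pos (L := L)) hlam (le_refl |m|)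
  have eqs : ∀ {u v : ℝ → L2 L}, FourierSol (Icc 0 T) u v → HasRep (Icc 0 T) (inter m u v) →
      coef (v 0) 0 = m → ∀ t ∈ Icc (0 : ℝ) 1, ∀ i,
      inter m u v i (t / lam) = inter m u v i 0 + (circleSys L m lam).duh
        (fun i s => inter m u v i (s / lam)) (fun i s => inter m u v i (s / lam)) i t :=
    fun h hr hm => (fourierSol_iff l0 (fun t ht => (h.coef_zero (hsub ht)).trans hm)
      (hr.continuousOn_u.mono hsub) (hr.continuousOn_v.mono hsub)).1 (h.mono hsub)
  have hc : ∀ i, inter m u' v' i 0 = inter m u v i 0 := by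
    rintro (k | k) <;> simp [inter, hu0, hv0]
  have heq := eqs hs hr hm
  have heq' := eqs hs' hr' (by rw [← hv0, hm])
  simp_rw [hc] at heq'
  have key := fun t (ht : t ∈ Icc (0 : ℝ) 1) i => hsmall.eq_of_eq dswEps_ne_top (ρ := max ρ ρ')
    (by calc _ = dswEps (2 * Real.pi / L) |m| lam * (16 * (QSys.opConst * max ρ ρ')) := by ring
          _ ≤ 1 := hlamB) hγ hγ' (hγb.trans (le_max_left _ _)) (hγb'.trans (le_max_right _ _))
    heq heq' ht i
  refine ⟨1 / lam, by positivity, fun t ht => ?_⟩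
  have key' : ∀ i, inter m u v i t = inter m u' v' i t := fun i => by
    have := key (t * lam) ⟨mul_nonneg ht.1 l0.le, (le_div_iff₀ l0).1 ht.2⟩ i
    simpa only [mul_div_cancel_right₀ _ l0.ne'] using this
  constructor
  · refine coef_injective fun k => ?_
    rw [coef_eq_exp_mul_inter (m := m) (v := v), key', ← coef_eq_exp_mul_inter]
  · refine coef_injective fun k => ?_
    simpa [inter] using key' (.inr k)

lemma FourierSol.shift {I J : Set ℝ} {u v : ℝ → L2 L} {t₀ : ℝ} (h : FourierSol I u v)
    (hu : ContinuousOn u I) (hv : ContinuousOn v I) (ht₀ : 0 ≤ t₀)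
    (hJ : ∀ s ∈ J, 0 ≤ s ∧ Icc 0 (t₀ + s) ⊆ I) :
    FourierSol J (fun s => u (t₀ + s)) (fun s => v (t₀ + s)) := by
  have key : ∀ {f : ℝ → ℂ} {c : ℝ → ℂ}, ContinuousOn f I →
      (∀ t ∈ I, c t = c 0 + ∫ s in (0 : ℝ)..t, f s) → ∀ s ∈ J,
      c (t₀ + s) = c (t₀ + 0) + ∫ r in (0 : ℝ)..s, f (t₀ + r) := by
    intro f c hf hc s hs
    obtain ⟨hs0, hsub⟩ := hJ s hs
    have i1 : IntervalIntegrable f volume 0 t₀ := by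
      refine (hf.mono (subset_trans ?_ hsub)).intervalIntegrable
      rw [uIcc_of_le ht₀]
      exact Icc_subset_Icc_right (by linarith)
    have i2 : IntervalIntegrable f volume t₀ (t₀ + s) := by
      refine (hf.mono (subset_trans ?_ hsub)).intervalIntegrable
      rw [uIcc_of_le (by linarith)]
      exact Icc_subset_Icc_left ht₀
    rw [hc _ (hsub ⟨by linarith, le_rfl⟩), add_zero, hc t₀ (hsub ⟨ht₀, by linarith⟩),
      intervalIntegral.integral_comp_add_left (fun x => f x), add_zero,
      ← intervalIntegral.integral_add_adjacent_intervals i1 i2, add_assoc]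
  exact ⟨fun s hs k => key (c := fun t => coef (u t) k) (continuousOn_fluxU hu hv k)
      (fun t ht => h.eq_u t ht k) s hs,
    fun s hs k => key (c := fun t => coef (v t) k) (continuousOn_fluxV hu k)
      (fun t ht => h.eq_v t ht k) s hs⟩

/-- Concatenation of solutions. -/
lemma FourierSol.concat {T δ : ℝ} {u v : ℝ → L2 L} (hT : 0 ≤ T) (hδ : 0 ≤ δ)
    (h : FourierSol (Icc 0 T) u v)
    (hu : ContinuousOn u (Icc 0 (T + δ))) (hv : ContinuousOn v (Icc 0 (T + δ)))
    (h' : FourierSol (Icc 0 δ) (fun s => u (T + s)) (fun s => v (T + s))) :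
    FourierSol (Icc 0 (T + δ)) u v := by
  have key : ∀ {f : ℝ → ℂ} {c : ℝ → ℂ}, ContinuousOn f (Icc 0 (T + δ)) →
      (∀ t ∈ Icc 0 T, c t = c 0 + ∫ s in (0 : ℝ)..t, f s) →
      (∀ s ∈ Icc 0 δ, c (T + s) = c (T + 0) + ∫ r in (0 : ℝ)..s, f (T + r)) →
      ∀ t ∈ Icc 0 (T + δ), c t = c 0 + ∫ s in (0 : ℝ)..t, f s := by
    intro f c hf h1 h2 t ht
    rcases le_total t T with htT | htT
    · exact h1 t ⟨ht.1, htT⟩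
    have i1 : IntervalIntegrable f volume 0 T := by
      refine (hf.mono ?_).intervalIntegrable
      rw [uIcc_of_le hT]
      exact Icc_subset_Icc_right (by linarith)
    have i2 : IntervalIntegrable f volume T t := by
      refine (hf.mono ?_).intervalIntegrable
      rw [uIcc_of_le htT]
      exact Icc_subset_Icc hT ht.2
    have := h2 (t - T) ⟨by linarith, by linarith [ht.2]⟩
    rw [intervalIntegral.integral_comp_add_left (fun x => f x), add_zero, add_sub_cancel,
      h1 T ⟨hT, le_rfl⟩] at this
    rw [this, ← intervalIntegral.integral_add_adjacent_intervals i1 i2, add_assoc]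
  exact ⟨fun t ht k => key (c := fun t => coef (u t) k) (continuousOn_fluxU hu hv k)
      (fun t ht => h.eq_u t ht k) (fun s hs => h'.eq_u s hs k) t ht,
    fun t ht k => key (c := fun t => coef (v t) k) (continuousOn_fluxV hu k)
      (fun t ht => h.eq_v t ht k) (fun s hs => h'.eq_v s hs k) t ht⟩

/-- A solution which is locally forward in time of class `Y` extends each solution of class `Y`. -/
theorem eqOn_of_hasRep {m T : ℝ} {u v u' v' : ℝ → L2 L}
    (hs : FourierSol (Ici 0) u v) (hu : ContinuousOn u (Ici 0)) (hv : ContinuousOn v (Ici 0))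
    (hloc : ∀ t, 0 ≤ t → ∃ δ > 0,
      HasRep (Icc 0 δ) (inter m (fun s => u (t + s)) (fun s => v (t + s))))
    (hs' : FourierSol (Icc 0 T) u' v') (hr' : HasRep (Icc 0 T) (inter m u' v'))
    (hm : coef (v 0) 0 = m) (hu0 : u' 0 = u 0) (hv0 : v' 0 = v 0) :
    ∀ t ∈ Icc 0 T, u' t = u t ∧ v' t = v t := by
  have hu' := hr'.continuousOn_u
  have hv' := hr'.continuousOn_v
  have hcl : IsClosed ({t | u' t = u t ∧ v' t = v t} ∩ Icc 0 T) := by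
    have hc : ContinuousOn (fun t => (u' t - u t, v' t - v t)) (Icc 0 T) :=
      (hu'.sub (hu.mono Icc_subset_Ici_self)).prodMk (hv'.sub (hv.mono Icc_subset_Ici_self))
    have := hc.preimage_isClosed_of_isClosed isClosed_Icc (isClosed_singleton (x := 0))
    rw [inter_comm]
    convert this using 2
    ext t
    simp [sub_eq_zero]
  -- The set of agreement is closed by continuity and contains 0; it remains to move past any of its
  -- points x < T.
  refine hcl.Icc_subset_of_forall_exists_gt ⟨hu0, hv0⟩ ?_
  rintro x ⟨⟨hxu, hxv⟩, hx0, hxT⟩ y hy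
  obtain ⟨δ, hδ, hrep⟩ := hloc x hx0
  -- Restarted at x, one solution is of class Y up to time δ, the other up to T - x. The mean of v
  -- is unchanged, so the same interaction picture applies to both.
  have hT' : 0 < min δ (T - x) := lt_min hδ (by linarith)
  obtain ⟨η, hη, hagree⟩ := eventually_eq_of_hasRep (m := m) hT'
    (u := fun s => u' (x + s)) (v := fun s => v' (x + s))
    (u' := fun s => u (x + s)) (v' := fun s => v (x + s))
    (hs'.shift hu' hv' hx0 fun s hs => ⟨hs.1, Icc_subset_Icc_right (by
      have := hs.2.trans (min_le_right _ _); linarith)⟩)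
    (hs.shift hu hv hx0 fun s hs => ⟨hs.1, Icc_subset_Ici_self⟩)
    (hasRep_inter_shift hr' fun s hs => ⟨by linarith [hs.1], by
      have := hs.2.trans (min_le_right _ _); linarith⟩)
    (hrep.mono (Icc_subset_Icc_right (min_le_left _ _)))
    (by simp only [add_zero]; rw [hs'.coef_zero ⟨hx0, hxT.le⟩, hv0, hm])
    (by simpa using hxu) (by simpa using hxv)
  have hy' : x < y := hy
  have hη' : 0 < min η (y - x) := lt_min hη (by linarith)
  refine ⟨x + min η (y - x), hagree _ ⟨hη'.le, min_le_left _ _⟩, by linarith, ?_⟩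
  linarith [min_le_right η (y - x)]

end DSW

/-! ### Gluing and global existence -/

namespace DSW

/-- The piece is selected by the integer part of t/δ. At a right end point this already selects the
next piece, which is why consecutive pieces must match. -/
lemma exists_glue {X : Type*} {δ : ℝ} (hδ : 0 < δ) (f : ℕ → ℝ → X) (hf : ∀ n, f n δ = f (n + 1) 0) :
    ∃ g : ℝ → X, ∀ n : ℕ, ∀ s ∈ Icc 0 δ, g (n * δ + s) = f n s := by
  refine ⟨fun t => f ⌊t / δ⌋₊ (t - ⌊t / δ⌋₊ * δ), fun n s hs => ?_⟩
  rcases eq_or_lt_of_le hs.2 with rfl | hlt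
  · have : ⌊((n : ℝ) * s + s) / s⌋₊ = n + 1 := by
      rw [show ((n : ℝ) * s + s) / s = ((n + 1 : ℕ) : ℝ) by push_cast; field_simp, Nat.floor_natCast]
    simp only [this]
    rw [hf]
    congr 1
    push_cast
    ring
  · have : ⌊((n : ℝ) * δ + s) / δ⌋₊ = n := by
      rw [Nat.floor_eq_iff (div_nonneg (by have := hs.1; positivity) hδ.le)]
      constructor
      · rw [le_div_iff₀ hδ]; linarith [hs.1]
      · rw [div_lt_iff₀ hδ]; linarith
    simp only [this]
    congr 1
    ring

lemma continuousOn_Ici_of_glue {X : Type*} [TopologicalSpace X] {δ : ℝ} (hδ : 0 < δ) {g : ℝ → X}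
    (hg : ∀ n : ℕ, ContinuousOn (fun s => g (n * δ + s)) (Icc 0 δ)) : ContinuousOn g (Ici 0) := by
  have h1 : ∀ n : ℕ, ContinuousOn g (Icc (n * δ) (n * δ + δ)) := fun n => by
    have : ContinuousOn ((fun s => g (n * δ + s)) ∘ fun t => t - n * δ) (Icc (n * δ) (n * δ + δ)) :=
      (hg n).comp (by fun_prop) fun t ht => ⟨by linarith [ht.1], by linarith [ht.2]⟩
    exact this.congr fun t _ => by simp
  have h2 : ∀ n : ℕ, ContinuousOn g (Icc 0 (n * δ)) := by
    intro n
    induction n with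
    | zero => simp
    | succ n ih =>
      have hn : (0 : ℝ) ≤ n * δ := by positivity
      rw [show ((n + 1 : ℕ) : ℝ) * δ = n * δ + δ by push_cast; ring,
        ← Icc_union_Icc_eq_Icc hn (by linarith : (n : ℝ) * δ ≤ n * δ + δ)]
      exact ih.union_of_isClosed (h1 n) isClosed_Icc isClosed_Icc
  intro t ht
  obtain ⟨n, hn⟩ := exists_nat_gt (t / δ)
  rw [div_lt_iff₀ hδ] at hn
  refine (h2 n t ⟨ht, hn.le⟩).mono_of_mem_nhdsWithin ?_
  filter_upwards [self_mem_nhdsWithin, mem_nhdsWithin_of_mem_nhds (Iio_mem_nhds hn)] with s hs hs'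
  exact ⟨hs, le_of_lt hs'⟩

variable {L : ℝ} [Fact (0 < L)]

lemma FourierSol.of_glue {δ : ℝ} (hδ : 0 < δ) {u v : ℝ → L2 L} (hu : ContinuousOn u (Ici 0))
    (hv : ContinuousOn v (Ici 0)) (h : ∀ n : ℕ,
      FourierSol (Icc 0 δ) (fun s => u (n * δ + s)) (fun s => v (n * δ + s))) :
    FourierSol (Ici 0) u v := by
  have h2 : ∀ n : ℕ, FourierSol (Icc 0 (n * δ)) u v := by
    intro n
    induction n with
    | zero =>
      have : ∀ t : ℝ, t ∈ Icc 0 (((0 : ℕ) : ℝ) * δ) → t = 0 := fun t ht => by simpa using ht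
      exact ⟨fun t ht k => by simp [this t ht], fun t ht k => by simp [this t ht]⟩
    | succ n ih =>
      rw [show ((n + 1 : ℕ) : ℝ) * δ = n * δ + δ by push_cast; ring]
      exact ih.concat (by positivity) hδ.le (hu.mono Icc_subset_Ici_self)
        (hv.mono Icc_subset_Ici_self) (h n)
  have h3 : ∀ t ∈ Ici (0 : ℝ), ∃ n : ℕ, t ∈ Icc 0 (n * δ) := fun t ht => by
    obtain ⟨n, hn⟩ := exists_nat_gt (t / δ)
    rw [div_lt_iff₀ hδ] at hn
    exact ⟨n, ht, hn.le⟩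
  constructor <;> intro t ht k <;> obtain ⟨n, hn⟩ := h3 t ht
  · exact (h2 n).eq_u t hn k
  · exact (h2 n).eq_v t hn k

lemma FourierSol.congr {I : Set ℝ} {u v u' v' : ℝ → L2 L} (h : FourierSol I u v)
    (hI : ∀ t ∈ I, uIcc 0 t ⊆ I) (hu : EqOn u' u I) (hv : EqOn v' v I) : FourierSol I u' v' := by
  have h0 : ∀ t ∈ I, (0 : ℝ) ∈ I := fun t ht => hI t ht left_mem_uIcc
  constructor <;> intro t ht k
  · rw [hu ht, hu (h0 t ht), h.eq_u t ht]
    congr 1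
    exact intervalIntegral.integral_congr fun s hs => by
      simp only [hu (hI t ht hs), hv (hI t ht hs)]
  · rw [hv ht, hv (h0 t ht), h.eq_v t ht]
    congr 1
    exact intervalIntegral.integral_congr fun s hs => by simp only [hu (hI t ht hs)]

lemma uIcc_subset_Icc_zero {T t : ℝ} (ht : t ∈ Icc 0 T) : uIcc 0 t ⊆ Icc 0 T := by
  rw [uIcc_of_le ht.1]
  exact Icc_subset_Icc_right ht.2

lemma HasRep.congr_inter {I : Set ℝ} {m : ℝ} {u v u' v' : ℝ → L2 L} (h : HasRep I (inter m u v))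
    (hu : EqOn u' u I) (hv : EqOn v' v I) : HasRep I (inter m u' v') :=
  h.congr fun t ht i => by rcases i with k | k <;> simp only [inter, hu ht, hv ht]

/-- Iteration of the local existence theorem, by means of the a priori bound. -/
theorem exists_global {R δ : ℝ} (hδ : 0 < δ) (hloc : ∀ u₀ v₀ : L2 L,
      ‖u₀‖ ^ 2 + ‖v₀‖ ^ 2 ≤ R ^ 2 → ∃ u v : ℝ → L2 L, u 0 = u₀ ∧ v 0 = v₀ ∧
      FourierSol (Icc 0 δ) u v ∧ HasRep (Icc 0 δ) (inter (mean v₀) u v) ∧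
      ∀ t ∈ Icc 0 δ, ‖u t‖ ^ 2 + ‖v t‖ ^ 2 ≤ ‖u₀‖ ^ 2 + ‖v₀‖ ^ 2)
    {u₀ v₀ : L2 L} (hdata : ‖u₀‖ ^ 2 + ‖v₀‖ ^ 2 ≤ R ^ 2) :
    ∃ u v : ℝ → L2 L, u 0 = u₀ ∧ v 0 = v₀ ∧ ContinuousOn u (Ici 0) ∧ ContinuousOn v (Ici 0) ∧
      FourierSol (Ici 0) u v ∧ HasRep (Icc 0 δ) (inter (mean v₀) u v) ∧
      ∀ t, 0 ≤ t → ∃ η > 0,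
        HasRep (Icc 0 η) (inter (mean v₀) (fun s => u (t + s)) (fun s => v (t + s))) := by
  set m := mean v₀ with hm
  -- The admissible states carry the energy bound, which keeps the step δ available, and the mean,
  -- which keeps one interaction picture for all steps.
  let P := {p : L2 L × L2 L // ‖p.1‖ ^ 2 + ‖p.2‖ ^ 2 ≤ R ^ 2 ∧ mean p.2 = m}
  have hloc' : ∀ p : P, ∃ u v : ℝ → L2 L, u 0 = p.1.1 ∧ v 0 = p.1.2 ∧
      FourierSol (Icc 0 δ) u v ∧ HasRep (Icc 0 δ) (inter m u v) ∧
      ‖u δ‖ ^ 2 + ‖v δ‖ ^ 2 ≤ R ^ 2 ∧ mean (v δ) = m := by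
    rintro ⟨⟨f, g⟩, hfg, hg⟩
    obtain ⟨u, v, h1, h2, h3, h4, h5⟩ := hloc f g hfg
    have hmem : δ ∈ Icc 0 δ := ⟨hδ.le, le_rfl⟩
    refine ⟨u, v, h1, h2, h3, by rwa [← hg], (h5 δ hmem).trans hfg, ?_⟩
    have := h3.coef_zero hmem
    rw [coef_zero_eq_mean, coef_zero_eq_mean, h2] at this
    rw [← hg]
    exact_mod_cast this
  choose U V hU hV hsol hrep hbd hmean using hloc'
  let step : P → P := fun p => ⟨(U p δ, V p δ), hbd p, hmean p⟩
  let seq : ℕ → P := fun n => step^[n] ⟨(u₀, v₀), hdata, rfl⟩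
  have hseq : ∀ n, seq (n + 1) = step (seq n) := fun n => Function.iterate_succ_apply' _ _ _
  obtain ⟨u, hu⟩ := exists_glue hδ (fun n => U (seq n)) fun n => by rw [hU, hseq]
  obtain ⟨v, hv⟩ := exists_glue hδ (fun n => V (seq n)) fun n => by rw [hV, hseq]
  have huc : ContinuousOn u (Ici 0) := continuousOn_Ici_of_glue hδ fun n =>
    (hrep (seq n)).continuousOn_u.congr (hu n)
  have hvc : ContinuousOn v (Ici 0) := continuousOn_Ici_of_glue hδ fun n =>
    (hrep (seq n)).continuousOn_v.congr (hv n)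
  have hu0 : EqOn u (U (seq 0)) (Icc 0 δ) := fun s hs => by simpa using hu 0 s hs
  have hv0 : EqOn v (V (seq 0)) (Icc 0 δ) := fun s hs => by simpa using hv 0 s hs
  have h0 : (0 : ℝ) ∈ Icc 0 δ := ⟨le_rfl, hδ.le⟩
  refine ⟨u, v, ?_, ?_, huc, hvc, ?_, (hrep (seq 0)).congr_inter hu0 hv0, fun t ht => ?_⟩
  · rw [hu0 h0, hU]; rfl
  · rw [hv0 h0, hV]; rfl
  · exact FourierSol.of_glue hδ huc hvc fun n =>
      (hsol (seq n)).congr (fun t => uIcc_subset_Icc_zero) (hu n) (hv n)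
  · set n := ⌊t / δ⌋₊ with hn
    have n1 : n * δ ≤ t := (le_div_iff₀ hδ).1 (Nat.floor_le (div_nonneg ht hδ.le))
    have n2 : t < (n + 1) * δ := (div_lt_iff₀ hδ).1 (Nat.lt_floor_add_one _)
    have hJ : ∀ s ∈ Icc 0 (δ - (t - n * δ)), t - n * δ + s ∈ Icc 0 δ := fun s hs =>
      ⟨by linarith [hs.1], by linarith [hs.2]⟩
    -- Class Y is claimed only up to the end of the current step. This is positive time even at a
    -- grid point, since the integer part then picks the step that starts there.
    refine ⟨δ - (t - n * δ), by linarith, (hasRep_inter_shift (hrep (seq n)) hJ).congr_inter ?_ ?_⟩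
    · intro s hs
      simpa [← add_assoc] using hu n _ (hJ s hs)
    · intro s hs
      simpa [← add_assoc] using hv n _ (hJ s hs)

end DSW

/-! ### The main theorem -/

theorem corollary1p2 (L : ℝ) [Fact (0 < L)] :
    ∃ lifetime : ℝ → ℝ, (∀ r, 0 < lifetime r) ∧
      ∀ u₀ v₀ : DSW.L2 L, ∃ u v : ℝ → DSW.L2 L,
        DSW.IsSolutionOn (Set.Ici 0) u₀ v₀ u v ∧
        DSW.MemY (Set.Icc 0 (lifetime (‖u₀‖ + ‖v₀‖))) v₀ u v ∧
        ∀ T : ℝ, 0 < T → ∀ u' v' : ℝ → DSW.L2 L,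
          DSW.IsSolutionOn (Set.Icc 0 T) u₀ v₀ u' v' →
          DSW.MemY (Set.Icc 0 T) v₀ u' v' →
          Set.EqOn u' u (Set.Icc 0 T) ∧ Set.EqOn v' v (Set.Icc 0 T) := by
  choose lifetime hpos hloc using DSW.exists_local L
  refine ⟨lifetime, hpos, fun u₀ v₀ => ?_⟩
  -- The lifetime is that of the ball with R = ‖u₀‖ + ‖v₀‖, which contains the data; the same value
  -- serves as the step of the iteration.
  have hdata : ‖u₀‖ ^ 2 + ‖v₀‖ ^ 2 ≤ (‖u₀‖ + ‖v₀‖) ^ 2 := by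
    nlinarith [mul_nonneg (norm_nonneg u₀) (norm_nonneg v₀)]
  obtain ⟨u, v, rfl, rfl, hu, hv, hs, hr, hY⟩ := DSW.exists_global (hpos _) (hloc _) hdata
  refine ⟨u, v, ?_, (DSW.memY_iff _ _ _ _).2 hr, fun T _ u' v' hs' hY' => ?_⟩
  · refine hs.isSolutionOn (fun t ht => ?_) hu hv
    rw [Set.uIcc_of_le ht]
    exact Set.Icc_subset_Ici_self
  · have h := DSW.eqOn_of_hasRep hs hu hv hY
      (DSW.IsSolutionOn.fourierSol (fun t => DSW.uIcc_subset_Icc_zero) hs')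
      ((DSW.memY_iff _ _ _ _).1 hY') (DSW.coef_zero_eq_mean _) hs'.initial_u hs'.initial_v
    exact ⟨fun t ht => (h t ht).1, fun t ht => (h t ht).2⟩
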